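/- Let $\mathfrak Z=\bigsqcup_{n\ge 0}\mathfrak Z_n$ and $\mathfrak E=\bigsqcup_{n\ge 1}\mathfrak E_n$ be the countable vertex and edge sets of a graded graph with range and source maps $r,s$, such that: (i) $\mathfrak Z_0=\{1\}$ is a singleton, and $r(e)\in\mathfrak Z_n$, $s(e)\in\mathfrak Z_{n-1}$ for every $e\in\mathfrak E_n$, $n\ge1$; (ii) $e\mapsto(r(e),s(e))$ is injective; (iii) every vertex is the source of an edge; (iv) every vertex other than $1$ is the range of an edge. Let $\kappa:\mathfrak E\to[0,1]$ be a link, i.e. $\sum_{r(e)=z}\kappa(e)=1$ for every $z\in\mathfrak Z\setminus\{1\}$, and assume $\kappa(e)>0$ for all $e$. Let $m:\mathfrak E\to\{1,2,\dots\}\cup\{\infty\}$ be any function and $\beta\neq0$ a real number. Put $\mathcal H_1=\mathbb C$ and, inductively, $\mathcal H_z=\bigoplus_{r(e)=z}\mathcal H_{s(e)}\otimes\ell^2_{m(e)}$; let $A_n=\bigoplus_{z\in\mathfrak Z_n}B(\mathcal H_z)$ ($\ell^\infty$-direct sum) with the embeddings $A_{n-1}\hookrightarrow A_n$, $(x_{z'})_{z'}\mapsto\big(\bigoplus_{r(e)=z}x_{s(e)}\otimes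 1\big)_z$, and let $A=\varinjlim A_n$ be the inductive limit $C^*$-algebra. Regard $z\in\mathfrak Z_n$ as a minimal projection of the center of $A_n$, so that $zA_n=B(\mathcal H_z)$. A bounded linear functional on $A$ is locally normal if its restriction to each $A_n$ is normal. KMS conditions are understood in terms of boundary values of bounded continuous functions on the strip between $\operatorname{Im}\zeta=0$ and $\operatorname{Im}\zeta=\beta$ that are analytic inside, with $F(t)=\omega(a\,\alpha^t(b))$ and $F(t+i\beta)=\omega(\alpha^t(b)a)$. Then there is an inductive flow on $A$, i.e. a one-parameter group $(\alpha^t)_{t\in\mathbb R}$ of $*$-automorphisms of $A$ with $\alpha^t(A_n)=A_n$ for all $t$ and $n$, such that the following hold. (i) For every $a\in A$ and every locally normal bounded linear functional $\omega$ on $A$, the function $t\mapsto\omega(\alpha^t(a))$ is continuous; and for every $n$ and every normal linear functional $\omega$ on $A_n$, $\|\omega\circ\alpha^t|_{A_n}-\omega\|\to0$ as $t\to0$. (ii) For $z\in\mathfrak Z_n$, $z'\in\mathfrak Z_{n-1}$, $n\geq 1$, let $\kappa_{(\alpha^t,\beta)}(z,z')=\tau_z(zz')$, where $\tau_z$ is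 the unique normal $(\alpha^t|_{zA_n},\beta)$-KMS state on $zA_n$, and $\kappa_{(\alpha^t,\beta)}(z,z')=0$ if there is no such state. Then $\kappa_{(\alpha^t,\beta)}(r(e),s(e))=\kappa(e)$ for all $e\in\mathfrak E$, and $\kappa_{(\alpha^t,\beta)}(z,z')=0$ if $(z,z')$ is not of the form $(r(e),s(e))$. Consequently, let $K$ be the set of locally normal $(\alpha^t,\beta)$-KMS states on $A$ with the weak$^*$ topology, and let $H_1^+(\kappa)$ be the set of functions $\nu:\mathfrak Z\to[0,\infty)$ with $\nu(1)=1$ and $\nu(z')=\sum_{s(e)=z'}\nu(r(e))\kappa(e)$ for all $z'\in\mathfrak Z$, with the topology of pointwise convergence. Then $H_1^+(\kappa)$ is the projective limit of the sets of probability measures on $\mathfrak Z_n$ along the maps $(\nu\cdot\kappa)(z')=\sum_{s(e)=z'}\nu(r(e))\kappa(e)$; both $K$ and $H_1^+(\kappa)$ are convex and completely metrizable; and $\omega\mapsto(z\mapsto\omega(z))$ is an affine homeomorphism of $K$ onto $H_1^+(\kappa)$. -/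

import Mathlib

universe u v

noncomputable section

open Filter Topology UniformSpace
open scoped ENNReal ComplexOrder

namespace CStarLimit

variable {B : ℕ → Type*} [∀ n, CStarAlgebra (B n)] (f : ∀ n, B n →⋆ₐ[ℂ] B (n + 1))

/-- The `*`-algebra of eventually coherent sequences of an inductive system of `C*`-algebras. -/
def coherent : StarSubalgebra ℂ (∀ n, B n) where
  carrier := {a | ∃ N, ∀ n, N ≤ n → a (n + 1) = f n (a n)}
  mul_mem' := by
    rintro a b ⟨N, hN⟩ ⟨M, hM⟩
    refine ⟨max N M, fun n hn => ?_⟩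
    simp [hN n (le_of_max_le_left hn), hM n (le_of_max_le_right hn)]
  add_mem' := by
    rintro a b ⟨N, hN⟩ ⟨M, hM⟩
    refine ⟨max N M, fun n hn => ?_⟩
    simp [hN n (le_of_max_le_left hn), hM n (le_of_max_le_right hn)]
  algebraMap_mem' := fun r => ⟨0, fun n _ => by simp [AlgHomClass.commutes]⟩
  star_mem' := by
    rintro a ⟨N, hN⟩
    exact ⟨N, fun n hn => by simp [hN n hn, map_star]⟩

/-- The eventually coherent sequences, without the topology of the product. -/
def Pre : Type _ := coherent f

instance : Ring (Pre f) := inferInstanceAs (Ring (coherent f))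
instance : StarRing (Pre f) := inferInstanceAs (StarRing (coherent f))
instance : Algebra ℂ (Pre f) := inferInstanceAs (Algebra ℂ (coherent f))
instance : StarModule ℂ (Pre f) := inferInstanceAs (StarModule ℂ (coherent f))

variable {f}

/-- The terms of an eventually coherent sequence. -/
def Pre.seq (a : Pre f) : ∀ n, B n := a.1

/-- The seminorm `lim ‖a n‖` of an eventually coherent sequence. -/
def Pre.nrm (a : Pre f) : ℝ := limUnder atTop fun n => ‖a.seq n‖

lemma Pre.tendsto_nrm (a : Pre f) : Tendsto (fun n => ‖a.seq n‖) atTop (𝓝 a.nrm) := by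
  obtain ⟨N, hN⟩ := a.2
  apply tendsto_nhds_limUnder
  have h1 : ∀ n, N ≤ n → ‖a.seq (n + 1)‖ ≤ ‖a.seq n‖ := by
    intro n hn
    have h2 : a.seq (n + 1) = f n (a.seq n) := hN n hn
    rw [h2]
    exact NonUnitalStarAlgHom.norm_apply_le (f n) _
  have h : Antitone fun k => ‖a.seq (k + N)‖ := by
    apply antitone_nat_of_succ_le
    intro k
    have h3 := h1 (k + N) (by omega)
    rwa [show k + N + 1 = k + 1 + N by omega] at h3
  exact ⟨_, (tendsto_add_atTop_iff_nat N).1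
    (tendsto_atTop_ciInf h ⟨0, by rintro _ ⟨k, rfl⟩; exact norm_nonneg _⟩)⟩

lemma Pre.nrm_smul (c : ℂ) (a : Pre f) : (c • a).nrm = ‖c‖ * a.nrm :=
  tendsto_nhds_unique (c • a).tendsto_nrm <| by
    simpa [← norm_smul] using! a.tendsto_nrm.const_mul ‖c‖

lemma Pre.nrm_star_mul (a : Pre f) : (star a * a).nrm = a.nrm * a.nrm :=
  tendsto_nhds_unique (star a * a).tendsto_nrm <| by
    have := a.tendsto_nrm.mul a.tendsto_nrm
    simp_rw [← CStarRing.norm_star_mul_self] at this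
    exact this

lemma Pre.nrm_star (a : Pre f) : (star a).nrm = a.nrm :=
  tendsto_nhds_unique (star a).tendsto_nrm <| by
    have := a.tendsto_nrm
    simp_rw [← norm_star (E := B _) (a.seq _)] at this
    exact this

variable (f) in
/-- The seminorm `lim ‖a n‖` as a ring seminorm. -/
def seminorm : RingSeminorm (Pre f) where
  toFun := Pre.nrm
  map_zero' := by
    have := Pre.nrm_smul (f := f) 0 0
    simpa using this
  add_le' a b := le_of_tendsto_of_tendsto' (a + b).tendsto_nrm
    (a.tendsto_nrm.add b.tendsto_nrm) fun n => norm_add_le _ _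
  neg' a := by
    have := Pre.nrm_smul (f := f) (-1) a
    simpa using this
  mul_le' a b := le_of_tendsto_of_tendsto' (a * b).tendsto_nrm
    (a.tendsto_nrm.mul b.tendsto_nrm) fun n => norm_mul_le _ _

instance : SeminormedRing (Pre f) := (seminorm f).toSeminormedRing

lemma Pre.norm_def (a : Pre f) : ‖a‖ = a.nrm := rfl

instance : NormedAlgebra ℂ (Pre f) where
  norm_smul_le c a := (Pre.nrm_smul c a).le

lemma Pre.isometry_star : Isometry (star : Pre f → Pre f) :=
  AddMonoidHomClass.isometry_of_norm (starAddEquiv (R := Pre f)) Pre.nrm_star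

end CStarLimit

/-- The `C*`-algebra inductive limit of a sequence of unital `C*`-algebras and unital
`*`-homomorphisms: the Hausdorff completion of the eventually coherent sequences with respect to
the `C*`-seminorm `lim ‖a n‖`. -/
def CStarLimit {B : ℕ → Type*} [∀ n, CStarAlgebra (B n)] (f : ∀ n, B n →⋆ₐ[ℂ] B (n + 1)) : Type _ :=
  Completion (CStarLimit.Pre f)

namespace CStarLimit

variable {B : ℕ → Type*} [∀ n, CStarAlgebra (B n)] {f : ∀ n, B n →⋆ₐ[ℂ] B (n + 1)}

instance : NormedRing (CStarLimit f) := inferInstanceAs (NormedRing (Completion (Pre f)))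
instance : CompleteSpace (CStarLimit f) := inferInstanceAs (CompleteSpace (Completion (Pre f)))
instance : Algebra ℂ (CStarLimit f) := inferInstanceAs (Algebra ℂ (Completion (Pre f)))

/-- The canonical map from the eventually coherent sequences to the inductive limit. -/
def mk (a : Pre f) : CStarLimit f := (a : Completion (Pre f))

instance : Star (CStarLimit f) :=
  ⟨(Completion.map star : Completion (Pre f) → Completion (Pre f))⟩

lemma star_mk (a : Pre f) : star (mk a) = mk (star a) :=
  Completion.map_coe Pre.isometry_star.uniformContinuous a

lemma continuous_star' : Continuous (star : CStarLimit f → CStarLimit f) :=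
  Completion.continuous_map

lemma mk_add (a b : Pre f) : mk (a + b) = mk a + mk b := Completion.coe_add a b
lemma mk_mul (a b : Pre f) : mk (a * b) = mk a * mk b := Completion.coe_mul a b
lemma mk_smul (c : ℂ) (a : Pre f) : mk (c • a) = c • mk a := by
  rw [Algebra.smul_def, Algebra.smul_def, mk_mul]; rfl
lemma norm_mk (a : Pre f) : ‖mk a‖ = a.nrm := Completion.norm_coe a

lemma mk_induction {p : CStarLimit f → Prop} (hc : IsClosed {x | p x})
    (h : ∀ a, p (mk a)) (x : CStarLimit f) : p x := Completion.induction_on x hc h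

lemma mk_eq_of_eventually {a b : Pre f} (h : ∀ᶠ n in atTop, a.seq n = b.seq n) :
    mk a = mk b := by
  have h0 : (a + (-1 : ℂ) • b).nrm = 0 :=
    tendsto_nhds_unique (a + (-1 : ℂ) • b).tendsto_nrm <| by
      refine tendsto_const_nhds.congr' (h.mono fun n hn => ?_)
      have : (a + (-1 : ℂ) • b).seq n = a.seq n + (-1 : ℂ) • b.seq n := rfl
      beta_reduce
      rw [this, hn]
      simp
  rw [← norm_mk, norm_eq_zero, mk_add, mk_smul, neg_one_smul] at h0
  exact add_neg_eq_zero.1 h0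

instance : ContinuousStar (CStarLimit f) := ⟨continuous_star'⟩

instance : StarRing (CStarLimit f) where
  star_involutive := mk_induction (isClosed_eq (by fun_prop) (by fun_prop))
    fun a => by rw [star_mk, star_mk, star_star]
  star_mul x y := by
    revert y
    refine mk_induction (isClosed_eq (by fun_prop) (by fun_prop)) fun b => ?_
    revert x
    refine mk_induction (isClosed_eq (by fun_prop) (by fun_prop)) fun a => ?_
    rw [← mk_mul, star_mk, star_mk, star_mk, ← mk_mul, star_mul]
  star_add x y := by
    revert y
    refine mk_induction (isClosed_eq (by fun_prop) (by fun_prop)) fun b => ?_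
    revert x
    refine mk_induction (isClosed_eq (by fun_prop) (by fun_prop)) fun a => ?_
    rw [← mk_add, star_mk, star_mk, star_mk, ← mk_add, star_add]

instance : CStarAlgebra (CStarLimit f) where
  norm_smul_le c := by
    simp_rw [Algebra.smul_def]
    refine mk_induction (isClosed_le (by fun_prop) (by fun_prop)) fun a => ?_
    rw [← Algebra.smul_def, ← mk_smul, norm_mk, norm_mk, Pre.nrm_smul]
  norm_mul_self_le := by
    refine mk_induction (isClosed_le (by fun_prop) (by fun_prop)) fun a => ?_
    rw [star_mk, ← mk_mul, norm_mk, norm_mk, Pre.nrm_star_mul]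
  star_smul c := by
    simp_rw [Algebra.smul_def]
    refine mk_induction (isClosed_eq (by fun_prop) (by fun_prop)) fun a => ?_
    rw [← Algebra.smul_def, ← Algebra.smul_def, ← mk_smul, star_mk, star_mk, ← mk_smul, star_smul]

/-- The eventually coherent sequence starting with `a : B n` at the index `n`. -/
def seqFrom (f : ∀ n, B n →⋆ₐ[ℂ] B (n + 1)) (n : ℕ) (a : B n) : Pre f :=
  ⟨fun k => if h : n ≤ k then Nat.leRecOn h (fun {j} => f j) a else 0, n, fun k hk => by
    beta_reduce
    rw [dif_pos hk, dif_pos (Nat.le_succ_of_le hk), Nat.leRecOn_succ hk]⟩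

lemma seqFrom_self (n : ℕ) (a : B n) : (seqFrom f n a).seq n = a := by
  simp [seqFrom, Pre.seq, Nat.leRecOn_self]

lemma seqFrom_succ {n k : ℕ} (h : n ≤ k) (a : B n) :
    (seqFrom f n a).seq (k + 1) = f k ((seqFrom f n a).seq k) := by
  simp only [seqFrom, Pre.seq, dif_pos h, dif_pos (Nat.le_succ_of_le h), Nat.leRecOn_succ h]

/-- Two eventually coherent sequences that agree at one index in the coherent range define the
same element of the limit. -/
lemma mk_eq_of_coherent {a b : Pre f} (n : ℕ) (h : a.seq n = b.seq n)
    (ha : ∀ k, n ≤ k → a.seq (k + 1) = f k (a.seq k))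
    (hb : ∀ k, n ≤ k → b.seq (k + 1) = f k (b.seq k)) : mk a = mk b := by
  refine mk_eq_of_eventually (eventually_atTop.2 ⟨n, fun k hk => ?_⟩)
  induction k, hk using Nat.le_induction with
  | base => exact h
  | succ k hk ih => rw [ha k hk, hb k hk, ih]

variable (f) in
/-- The canonical `*`-homomorphism of the `n`-th algebra into the inductive limit. -/
def ι (n : ℕ) : B n →⋆ₐ[ℂ] CStarLimit f where
  toFun a := mk (seqFrom f n a)
  map_one' := mk_eq_of_coherent (b := 1) n (seqFrom_self n 1) (fun _ hk => seqFrom_succ hk 1)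
    fun k _ => (map_one (f k)).symm
  map_mul' a b := by
    rw [← mk_mul]
    refine mk_eq_of_coherent n ?_ (fun _ hk => seqFrom_succ hk _) fun k hk => ?_
    · change _ = (seqFrom f n a).seq n * (seqFrom f n b).seq n
      simp only [seqFrom_self]
    · change (seqFrom f n a).seq (k + 1) * (seqFrom f n b).seq (k + 1) =
        f k ((seqFrom f n a).seq k * (seqFrom f n b).seq k)
      rw [seqFrom_succ hk, seqFrom_succ hk, map_mul]
  map_zero' := mk_eq_of_coherent (b := 0) n (seqFrom_self n 0) (fun _ hk => seqFrom_succ hk 0)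
    fun k _ => (map_zero (f k)).symm
  map_add' a b := by
    rw [← mk_add]
    refine mk_eq_of_coherent n ?_ (fun _ hk => seqFrom_succ hk _) fun k hk => ?_
    · change _ = (seqFrom f n a).seq n + (seqFrom f n b).seq n
      simp only [seqFrom_self]
    · change (seqFrom f n a).seq (k + 1) + (seqFrom f n b).seq (k + 1) =
        f k ((seqFrom f n a).seq k + (seqFrom f n b).seq k)
      rw [seqFrom_succ hk, seqFrom_succ hk, map_add]
  commutes' r := mk_eq_of_coherent (b := algebraMap ℂ _ r) n (seqFrom_self n _)
    (fun _ hk => seqFrom_succ hk _) fun k _ => (AlgHomClass.commutes (f k) r).symm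
  map_star' a := by
    rw [star_mk]
    refine mk_eq_of_coherent n ?_ (fun _ hk => seqFrom_succ hk _) fun k hk => ?_
    · change _ = star ((seqFrom f n a).seq n)
      simp only [seqFrom_self]
    · change star ((seqFrom f n a).seq (k + 1)) = f k (star ((seqFrom f n a).seq k))
      rw [seqFrom_succ hk, map_star]

/-- The canonical maps are compatible with the inductive system. -/
lemma ι_succ (n : ℕ) (a : B n) : ι f (n + 1) (f n a) = ι f n a := by
  refine mk_eq_of_coherent (n + 1) ?_ (fun _ hk => seqFrom_succ hk _)
    fun k hk => seqFrom_succ (by omega) _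
  rw [seqFrom_self, seqFrom_succ le_rfl, seqFrom_self]

/-- The union of the images of the canonical maps is dense. -/
lemma dense_range_ι : Dense (⋃ n, Set.range (ι f n)) := by
  refine (Completion.denseRange_coe (α := Pre f)).mono ?_
  rintro _ ⟨a, rfl⟩
  obtain ⟨N, hN⟩ := a.2
  exact Set.mem_iUnion.2 ⟨N, a.seq N, mk_eq_of_coherent N (seqFrom_self N _)
    (fun _ hk => seqFrom_succ hk _) hN⟩

/-- For an isometric inductive system the canonical maps are isometric. -/
lemma norm_ι (hf : ∀ n a, ‖f n a‖ = ‖a‖) (n : ℕ) (a : B n) : ‖ι f n a‖ = ‖a‖ := by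
  change ‖mk (seqFrom f n a)‖ = _
  rw [norm_mk]
  refine tendsto_nhds_unique (seqFrom f n a).tendsto_nrm
    (tendsto_const_nhds.congr' (eventually_atTop.2 ⟨n, fun k hk => ?_⟩))
  induction k, hk using Nat.le_induction with
  | base => simp only [seqFrom_self]
  | succ k hk ih => simp only [seqFrom_succ hk, hf]; exact ih

end CStarLimit

/-- The Hilbert space `ℓ²(X)`. -/
abbrev Ell2 (X : Type*) : Type _ := lp (fun _ : X => ℂ) 2

namespace Ell2

variable {X C : Type*} {Q : C → Type*}

lemma hasSum_sq (v : Ell2 X) : HasSum (fun x => ‖v x‖ ^ 2) (‖v‖ ^ 2) := by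
  have := lp.hasSum_norm (p := 2) (by norm_num) v
  simpa using this

lemma memℓp_iff (v : X → ℂ) : Memℓp v 2 ↔ Summable fun x => ‖v x‖ ^ 2 := by
  rw [memℓp_gen_iff (by norm_num)]
  simp

/-- The component of a vector of `ℓ²(Σ c, Q c)` in the summand `ℓ²(Q c)`. -/
def slice (v : Ell2 (Σ c, Q c)) (c : C) : Ell2 (Q c) :=
  ⟨fun q => v ⟨c, q⟩, (memℓp_iff _).2 ((hasSum_sq v).summable.sigma_factor c)⟩

@[simp] lemma slice_apply (v : Ell2 (Σ c, Q c)) (c : C) (q : Q c) : slice v c q = v ⟨c, q⟩ := rfl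

lemma hasSum_slice (v : Ell2 (Σ c, Q c)) : HasSum (fun c => ‖slice v c‖ ^ 2) (‖v‖ ^ 2) :=
  (hasSum_sq v).sigma fun c => hasSum_sq (slice v c)

lemma memℓp_blockDiag (x : ∀ c, Ell2 (Q c) →L[ℂ] Ell2 (Q c)) (M : ℝ) (hM : ∀ c, ‖x c‖ ≤ M)
    (v : Ell2 (Σ c, Q c)) : Memℓp (fun p : Σ c, Q c => x p.1 (slice v p.1) p.2) 2 := by
  rw [memℓp_iff, summable_sigma_of_nonneg fun _ => by positivity]
  refine ⟨fun c => (hasSum_sq (x c (slice v c))).summable, ?_⟩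
  simp_rw [fun c => (hasSum_sq (x c (slice v c))).tsum_eq]
  refine Summable.of_nonneg_of_le (fun _ => by positivity) (fun c => ?_)
    ((hasSum_slice v).summable.mul_left (M ^ 2))
  rw [← mul_pow]
  gcongr
  exact (x c).le_of_opNorm_le (hM c) _

/-- The linear map underlying the block diagonal operator. -/
def blockDiagLin (x : ∀ c, Ell2 (Q c) →L[ℂ] Ell2 (Q c)) (M : ℝ) (hM : ∀ c, ‖x c‖ ≤ M) :
    Ell2 (Σ c, Q c) →ₗ[ℂ] Ell2 (Σ c, Q c) where
  toFun v := ⟨fun p => x p.1 (slice v p.1) p.2, memℓp_blockDiag x M hM v⟩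
  map_add' v w := by
    ext p
    have : slice (v + w) p.1 = slice v p.1 + slice w p.1 := rfl
    simp only [this, map_add]
    rfl
  map_smul' r v := by
    ext p
    have : slice (r • v) p.1 = r • slice v p.1 := rfl
    simp only [this, map_smul]
    rfl

lemma norm_blockDiagLin_le (x : ∀ c, Ell2 (Q c) →L[ℂ] Ell2 (Q c)) (M : ℝ) (hM0 : 0 ≤ M)
    (hM : ∀ c, ‖x c‖ ≤ M) (v : Ell2 (Σ c, Q c)) : ‖blockDiagLin x M hM v‖ ≤ M * ‖v‖ := by
  refine (pow_le_pow_iff_left₀ (norm_nonneg _) (by positivity) two_ne_zero).1 ?_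
  rw [mul_pow]
  have h : ∀ c, ‖slice (blockDiagLin x M hM v) c‖ ^ 2 ≤ M ^ 2 * ‖slice v c‖ ^ 2 := fun c => by
    have h1 : slice (blockDiagLin x M hM v) c = x c (slice v c) := rfl
    rw [h1, ← mul_pow]
    gcongr
    exact (x c).le_of_opNorm_le (hM c) _
  exact hasSum_le h (hasSum_slice _) ((hasSum_slice v).mul_left (M ^ 2))

/-- The block diagonal operator `⨁ c, x c` on `ℓ²(Σ c, Q c) = ⨁ c, ℓ²(Q c)`, for a uniformly
bounded family of operators `x c` on `ℓ²(Q c)`. -/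
def blockDiag (x : ∀ c, Ell2 (Q c) →L[ℂ] Ell2 (Q c)) (M : ℝ) (hM0 : 0 ≤ M)
    (hM : ∀ c, ‖x c‖ ≤ M) : Ell2 (Σ c, Q c) →L[ℂ] Ell2 (Σ c, Q c) :=
  (blockDiagLin x M hM).mkContinuous M (norm_blockDiagLin_le x M hM0 hM)

lemma slice_blockDiag (x : ∀ c, Ell2 (Q c) →L[ℂ] Ell2 (Q c)) (M : ℝ) (hM0 : 0 ≤ M)
    (hM : ∀ c, ‖x c‖ ≤ M) (v : Ell2 (Σ c, Q c)) (c : C) :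
    slice (blockDiag x M hM0 hM v) c = x c (slice v c) := rfl

lemma ext_slice {v w : Ell2 (Σ c, Q c)} (h : ∀ c, slice v c = slice w c) : v = w := by
  ext ⟨c, q⟩
  exact congrArg (fun u : Ell2 (Q c) => u q) (h c)

lemma hasSum_inner_slice (v w : Ell2 (Σ c, Q c)) :
    HasSum (fun c => inner ℂ (slice v c) (slice w c)) (inner ℂ v w) :=
  (lp.hasSum_inner v w).sigma fun c => lp.hasSum_inner (slice v c) (slice w c)

lemma slice_surjective (c : C) : Function.Surjective fun v : Ell2 (Σ c, Q c) => slice v c := by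
  classical
  intro w
  let g : (Σ c, Q c) → ℂ := fun p => if h : p.1 = c then w (h ▸ p.2) else 0
  have hg : ∀ q, g ⟨c, q⟩ = w q := fun q => by simp [g]
  refine ⟨⟨g, (memℓp_iff _).2 ?_⟩, by ext q; exact hg q⟩
  rw [← (sigma_mk_injective (i := c)).summable_iff]
  · simpa [Function.comp_def, hg] using (hasSum_sq w).summable
  · rintro ⟨c', q⟩ hq
    have : c' ≠ c := by rintro rfl; exact hq ⟨q, rfl⟩
    simp [g, this]

instance [Nonempty X] : Nontrivial (Ell2 X) := by
  classical
  obtain ⟨x⟩ := ‹Nonempty X›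
  refine ⟨lp.single 2 x 1, 0, fun h => ?_⟩
  have := congrArg (fun v : Ell2 X => v x) h
  simp at this

end Ell2

section KMS

variable {A : Type*} [CStarAlgebra A]

/-- States on a unital `C*`-algebra. -/
def IsCStarState (ω : A →L[ℂ] ℂ) : Prop := ω 1 = 1 ∧ ∀ a, 0 ≤ ω (star a * a)

/-- The closed strip between the lines `Im z = 0` and `Im z = β`. -/
def kmsStrip (β : ℝ) : Set ℂ := {z | min 0 β ≤ z.im ∧ z.im ≤ max 0 β}

/-- The `(α^t, β)`-KMS condition (for `β ≠ 0`), in terms of boundary values of bounded analytic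
functions on the strip. No continuity of `α^t` is needed. -/
def IsKMS (α : ℝ → A → A) (β : ℝ) (ω : A →L[ℂ] ℂ) : Prop :=
  ∀ a b : A, ∃ F : ℂ → ℂ, ContinuousOn F (kmsStrip β) ∧
    (∃ C : ℝ, ∀ z ∈ kmsStrip β, ‖F z‖ ≤ C) ∧
    DifferentiableOn ℂ F (interior (kmsStrip β)) ∧
    ∀ t : ℝ, F t = ω (a * α t b) ∧ F (t + β * Complex.I) = ω (α t b * a)

end KMS

/-- A graded graph `(𝔷, 𝔈, r, s)`: `V n` is the set of vertices of level `n`, and `E n` is the set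
of edges whose source has level `n` and whose range has level `n + 1`. -/
structure GradedGraph where
  V : ℕ → Type u
  E : ℕ → Type v
  r : ∀ {n}, E n → V (n + 1)
  s : ∀ {n}, E n → V n
  countable_V : ∀ n, Countable (V n)
  countable_E : ∀ n, Countable (E n)
  /-- There is exactly one vertex of level `0`. -/
  uniqueRoot : Unique (V 0)
  /-- There is at most one edge with a given range and source. -/
  injective : ∀ n, Function.Injective fun e : E n => (r e, s e)
  /-- Every vertex is the source of an edge. -/
  surjective_s : ∀ n, Function.Surjective fun e : E n => s e
  /-- Every vertex of positive level is the range of an edge. -/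
  surjective_r : ∀ n, Function.Surjective fun e : E n => r e

/-- A multiplicity function `m : 𝔈 → {1, 2, …} ∪ {∞}`. -/
structure GradedGraph.Multiplicity (G : GradedGraph.{u, v}) where
  toFun : ∀ {n}, G.E n → ℕ∞
  pos : ∀ {n} (e : G.E n), 1 ≤ toFun e

namespace GradedGraph

variable {G : GradedGraph.{u, v}}

namespace Multiplicity

variable (m : G.Multiplicity)

/-- The standard index set with `m e` elements. -/
abbrev Idx {n : ℕ} (e : G.E n) : Type := {k : ℕ // (k : ℕ∞) < m.toFun e}

/-- The index set of the direct summands of the Hilbert space at `z`: an edge `e` with range `z` and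
one of the `m e` standard basis vectors of `ℓ²_{m(e)}`. -/
abbrev Summand {n : ℕ} (z : G.V (n + 1)) : Type v := Σ e : {e : G.E n // G.r e = z}, m.Idx e.1

/-- The standard orthonormal basis of the Hilbert space at a vertex: the paths from the root to the
vertex, each edge `e` being equipped with an index smaller than `m e`. -/
def Path : ∀ {n}, G.V n → Type v
  | 0, _ => PUnit
  | _ + 1, z => Σ c : m.Summand z, Path (G.s c.1.1)

instance nonempty_path : ∀ {n} (z : G.V n), Nonempty (m.Path z)
  | 0, _ => ⟨PUnit.unit⟩
  | n + 1, z => by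
    obtain ⟨e, he⟩ := G.surjective_r n z
    obtain ⟨p⟩ := nonempty_path (G.s e)
    exact ⟨⟨⟨⟨e, he⟩, ⟨0, lt_of_lt_of_le (by simp) (m.pos e)⟩⟩, p⟩⟩

/-- The Hilbert space `H_z`. It is `ℂ` at the root, and for a vertex `z` of level `n + 1`
it is `⨁_{r(e) = z} H_{s(e)} ⊗ ℓ²_{m(e)}`, where the tensor product is realized as the direct sum
of `m e` copies of `H_{s(e)}`. -/
abbrev H {n : ℕ} (z : G.V n) : Type v := Ell2 (m.Path z)

/-- The atomic `W*`-algebra `A_n = ⨁_z B(H_z)` of bounded families of operators. -/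
def Alg (n : ℕ) : Type (max u v) := lp (fun z : G.V n => m.H z →L[ℂ] m.H z) ∞

instance (n : ℕ) : NormedRing (m.Alg n) := lp.inftyNormedRing
instance (n : ℕ) : NormedAlgebra ℂ (m.Alg n) := lp.inftyNormedAlgebra
instance (n : ℕ) : StarRing (m.Alg n) := lp.inftyStarRing

instance (n : ℕ) : CStarAlgebra (m.Alg n) where
  star_add := star_add
  toCompleteSpace := inferInstanceAs (CompleteSpace (lp (fun z : G.V n => m.H z →L[ℂ] m.H z) ∞))
  toCStarRing := inferInstanceAs (CStarRing (lp (fun z : G.V n => m.H z →L[ℂ] m.H z) ∞))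
  toStarModule := inferInstanceAs (StarModule ℂ (lp (fun z : G.V n => m.H z →L[ℂ] m.H z) ∞))

variable {m}

/-- The component in `B(H_z)` of an element of `A_n`. -/
def comp {n : ℕ} (a : m.Alg n) (z : G.V n) : m.H z →L[ℂ] m.H z := a.1 z

lemma norm_comp_le {n : ℕ} (a : m.Alg n) (z : G.V n) : ‖comp a z‖ ≤ ‖a‖ :=
  lp.norm_apply_le_norm ENNReal.top_ne_zero _ z

lemma ext_comp {n : ℕ} {a b : m.Alg n} (h : ∀ z, comp a z = comp b z) : a = b :=
  lp.ext (funext h)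

/-- The component at `z` of the image of `a` under the inclusion `A_n → A_{n+1}`: the block diagonal
operator with the blocks `a_{s(e)}`, each repeated `m e` times, for the edges `e` with range `z`. -/
def inclComp {n : ℕ} (a : m.Alg n) (z : G.V (n + 1)) : m.H z →L[ℂ] m.H z :=
  Ell2.blockDiag (Q := fun c : m.Summand z => m.Path (G.s c.1.1))
    (fun c => comp a (G.s c.1.1)) ‖a‖ (norm_nonneg a) fun _ => norm_comp_le a _

/-- The component of a vector of `H_z` in the direct summand of index `c`. -/
abbrev slice {n : ℕ} {z : G.V (n + 1)} (v : m.H z) (c : m.Summand z) : m.H (G.s c.1.1) :=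
  Ell2.slice (Q := fun c : m.Summand z => m.Path (G.s c.1.1)) v c

lemma slice_inclComp {n : ℕ} (a : m.Alg n) (z : G.V (n + 1)) (v : m.H z) (c : m.Summand z) :
    slice (inclComp a z v) c = comp a (G.s c.1.1) (slice v c) := rfl

lemma slice_add {n : ℕ} {z : G.V (n + 1)} (v w : m.H z) (c : m.Summand z) :
    slice (v + w) c = slice v c + slice w c := rfl

lemma slice_smul {n : ℕ} {z : G.V (n + 1)} (r : ℂ) (v : m.H z) (c : m.Summand z) :
    slice (r • v) c = r • slice v c := rfl

lemma hasSum_inner_slice {n : ℕ} {z : G.V (n + 1)} (v w : m.H z) :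
    HasSum (fun c => inner ℂ (slice v c) (slice w c)) (inner ℂ v w) :=
  Ell2.hasSum_inner_slice (Q := fun c : m.Summand z => m.Path (G.s c.1.1)) v w

lemma slice_surjective {n : ℕ} {z : G.V (n + 1)} (c : m.Summand z) :
    Function.Surjective fun v : m.H z => slice v c :=
  Ell2.slice_surjective (Q := fun c : m.Summand z => m.Path (G.s c.1.1)) c

lemma ext_H {n : ℕ} {z : G.V (n + 1)} {T S : m.H z →L[ℂ] m.H z}
    (h : ∀ v c, slice (T v) c = slice (S v) c) : T = S :=
  ContinuousLinearMap.ext fun v => Ell2.ext_slice (h v)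

lemma norm_inclComp_le {n : ℕ} (a : m.Alg n) (z : G.V (n + 1)) : ‖inclComp a z‖ ≤ ‖a‖ :=
  LinearMap.mkContinuous_norm_le _ (norm_nonneg a) (Ell2.norm_blockDiagLin_le _ _ (norm_nonneg a) _)

lemma comp_one {n : ℕ} (z : G.V n) : comp (1 : m.Alg n) z = 1 := rfl
lemma comp_zero {n : ℕ} (z : G.V n) : comp (0 : m.Alg n) z = 0 := rfl
lemma comp_mul {n : ℕ} (a b : m.Alg n) (z : G.V n) : comp (a * b) z = comp a z * comp b z := rfl
lemma comp_add {n : ℕ} (a b : m.Alg n) (z : G.V n) : comp (a + b) z = comp a z + comp b z := rfl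
lemma comp_star {n : ℕ} (a : m.Alg n) (z : G.V n) : comp (star a) z = star (comp a z) := rfl
lemma comp_smul {n : ℕ} (r : ℂ) (a : m.Alg n) (z : G.V n) : comp (r • a) z = r • comp a z := rfl

/-- The underlying map of the inclusion `A_n → A_{n+1}`. -/
def inclFun {n : ℕ} (a : m.Alg n) : m.Alg (n + 1) :=
  ⟨inclComp a, memℓp_infty ⟨‖a‖, by rintro _ ⟨z, rfl⟩; exact norm_inclComp_le a z⟩⟩

lemma comp_inclFun {n : ℕ} (a : m.Alg n) (z : G.V (n + 1)) : comp (inclFun a) z = inclComp a z :=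
  rfl

lemma inclFun_one {n : ℕ} : inclFun (1 : m.Alg n) = 1 := by
  refine ext_comp fun z => ext_H fun v c => ?_
  rw [comp_inclFun, slice_inclComp, comp_one, comp_one, one_apply_eq_self,
    one_apply_eq_self]

lemma inclFun_mul {n : ℕ} (a b : m.Alg n) : inclFun (a * b) = inclFun a * inclFun b := by
  refine ext_comp fun z => ext_H fun v c => ?_
  rw [comp_inclFun, slice_inclComp, comp_mul, comp_mul, mul_apply_eq_comp,
    mul_apply_eq_comp, comp_inclFun, comp_inclFun, slice_inclComp, slice_inclComp]

lemma inclFun_add {n : ℕ} (a b : m.Alg n) : inclFun (a + b) = inclFun a + inclFun b := by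
  refine ext_comp fun z => ext_H fun v c => ?_
  rw [comp_inclFun, slice_inclComp, comp_add, comp_add, add_apply,
    add_apply, comp_inclFun, comp_inclFun, slice_add, slice_inclComp,
    slice_inclComp]

lemma inclFun_smul {n : ℕ} (r : ℂ) (a : m.Alg n) : inclFun (r • a) = r • inclFun a := by
  refine ext_comp fun z => ext_H fun v c => ?_
  rw [comp_inclFun, slice_inclComp, comp_smul, comp_smul, smul_apply,
    smul_apply, comp_inclFun, slice_smul, slice_inclComp]

lemma inclFun_star {n : ℕ} (a : m.Alg n) : inclFun (star a) = star (inclFun a) := by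
  refine ext_comp fun z => ?_
  rw [comp_star, comp_inclFun, comp_inclFun, ContinuousLinearMap.star_eq_adjoint,
    ContinuousLinearMap.eq_adjoint_iff]
  intro v w
  refine (hasSum_inner_slice _ _).unique ?_
  convert hasSum_inner_slice v (inclComp a z w) using 2 with c
  rw [slice_inclComp, slice_inclComp, comp_star, ContinuousLinearMap.star_eq_adjoint,
    ContinuousLinearMap.adjoint_inner_left]

variable (m)

/-- The inclusion `A_n → A_{n+1}`, a unital normal `*`-homomorphism. -/
def incl (n : ℕ) : m.Alg n →⋆ₐ[ℂ] m.Alg (n + 1) where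
  toFun := inclFun
  map_one' := inclFun_one
  map_mul' := inclFun_mul
  map_zero' := by
    have := inclFun_smul (m := m) (n := n) 0 0
    rwa [zero_smul, zero_smul] at this
  map_add' := inclFun_add
  commutes' r := by
    rw [Algebra.algebraMap_eq_smul_one, Algebra.algebraMap_eq_smul_one, inclFun_smul, inclFun_one]
  map_star' := inclFun_star

lemma incl_injective (n : ℕ) : Function.Injective (m.incl n) := by
  refine (injective_iff_map_eq_zero (m.incl n)).2 fun a ha => ext_comp fun z' => ?_
  obtain ⟨e, rfl⟩ := G.surjective_s n z'
  refine ContinuousLinearMap.ext fun w => ?_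
  let c : m.Summand (G.r e) := ⟨⟨e, rfl⟩, ⟨0, lt_of_lt_of_le (by simp) (m.pos e)⟩⟩
  obtain ⟨v, rfl⟩ := slice_surjective c w
  have h : slice (comp (m.incl n a) (G.r e) v) c = slice (comp (0 : m.Alg (n + 1)) (G.r e) v) c := by
    rw [ha]
  exact h

/-- The `C*`-algebra `A = lim A_n`. -/
abbrev Limit : Type (max u v) := CStarLimit m.incl

/-- The inclusion of `A_n` into `A`. -/
abbrev ι (n : ℕ) : m.Alg n →⋆ₐ[ℂ] m.Limit := CStarLimit.ι m.incl n

lemma ι_injective (n : ℕ) : Function.Injective (m.ι n) := by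
  refine (injective_iff_map_eq_zero (m.ι n)).2 fun a ha => ?_
  rw [← norm_eq_zero, ← CStarLimit.norm_ι (f := m.incl)
    (fun n => NonUnitalStarAlgHom.norm_map (m.incl n) (m.incl_injective n)) n a]
  exact norm_eq_zero.2 ha

variable {m}

open Classical in
/-- The inclusion of `B(H_z) = zA_n` into `A_n`. -/
def corner {n : ℕ} (z : G.V n) (x : m.H z →L[ℂ] m.H z) : m.Alg n :=
  lp.single (E := fun z : G.V n => m.H z →L[ℂ] m.H z) ∞ z x

variable (m) in
/-- The vertex `z`, as a minimal projection of the center of `A_n`. -/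
def proj {n : ℕ} (z : G.V n) : m.Alg n := corner z 1

/-- Normal linear functionals on `B(H_z)`: the functionals `x ↦ ∑ₖ ⟪ηₖ, x ξₖ⟫`
with `∑ₖ ‖ξₖ‖ ‖ηₖ‖ < ∞`, i.e. the `σ`-weakly continuous ones. -/
def IsNormalCorner {n : ℕ} {z : G.V n} (τ : (m.H z →L[ℂ] m.H z) → ℂ) : Prop :=
  ∃ ξ η : ℕ → m.H z, (Summable fun k => ‖ξ k‖ * ‖η k‖) ∧
    ∀ x, HasSum (fun k => inner ℂ (η k) (x (ξ k))) (τ x)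

/-- Normal linear functionals on `A_n = ⨁_z B(H_z)`: the functionals `a ↦ ∑ₖ ⟪ηₖ, a ξₖ⟫` with
`∑ₖ ‖ξₖ‖ ‖ηₖ‖ < ∞`, i.e. the `σ`-weakly continuous ones. Decomposing vectors of `⨁_z H_z`, we may
require that every `ξₖ` and `ηₖ` lies in one of the spaces `H_z`. -/
def IsNormal {n : ℕ} (ω : m.Alg n → ℂ) : Prop :=
  ∃ (z : ℕ → G.V n) (ξ η : ∀ k, m.H (z k)), (Summable fun k => ‖ξ k‖ * ‖η k‖) ∧
    ∀ a, HasSum (fun k => inner ℂ (η k) (comp a (z k) (ξ k))) (ω a)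

/-- Locally normal bounded linear functionals on `A`. -/
def IsLocallyNormal (ω : m.Limit →L[ℂ] ℂ) : Prop := ∀ n, IsNormal fun a => ω (m.ι n a)

variable (m)

/-- An inductive flow on `A = lim A_n`: a one-parameter group of `*`-automorphisms that maps every
`A_n` onto itself. No continuity is required. -/
structure InductiveFlow where
  toFun : ℝ → m.Limit ≃⋆ₐ[ℂ] m.Limit
  map_zero : ∀ a, toFun 0 a = a
  map_add : ∀ s t a, toFun (s + t) a = toFun s (toFun t a)
  map_range : ∀ t n, toFun t '' Set.range (m.ι n) = Set.range (m.ι n)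

namespace InductiveFlow

variable {m} (α : m.InductiveFlow)

lemma exists_local (n : ℕ) (t : ℝ) (a : m.Alg n) : ∃ b, m.ι n b = α.toFun t (m.ι n a) := by
  rw [← Set.mem_range, ← α.map_range t n]
  exact ⟨_, ⟨a, rfl⟩, rfl⟩

/-- The local flow `α_n^t` on `A_n`, the restriction of `α^t`. -/
def loc (n : ℕ) (t : ℝ) (a : m.Alg n) : m.Alg n := (α.exists_local n t a).choose

lemma ι_loc (n : ℕ) (t : ℝ) (a : m.Alg n) : m.ι n (α.loc n t a) = α.toFun t (m.ι n a) :=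
  (α.exists_local n t a).choose_spec

/-- The local flow `α_z^t` on `B(H_z) = zA_n`, the restriction of `α_n^t`. -/
def locVertex {n : ℕ} (z : G.V n) (t : ℝ) (x : m.H z →L[ℂ] m.H z) : m.H z →L[ℂ] m.H z :=
  comp (α.loc n t (corner z x)) z

/-- For each `a ∈ A`, the function `t ↦ α^t(a)` is continuous with respect to the weak topology
induced by the locally normal linear functionals. -/
def IsWeaklyContinuous : Prop :=
  ∀ (a : m.Limit) (ω : m.Limit →L[ℂ] ℂ), IsLocallyNormal ω → Continuous fun t => ω (α.toFun t a)

/-- For each `n`, `‖ω ∘ α_n^t - ω‖ → 0` as `t → 0`, for all normal linear functionals on `A_n`. -/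
def IsUContinuous : Prop :=
  ∀ (n : ℕ) (ω : m.Alg n →L[ℂ] ℂ), IsNormal ω → ∀ ε > 0, ∀ᶠ t in 𝓝 (0 : ℝ),
    ∀ a, ‖ω (α.loc n t a) - ω a‖ ≤ ε * ‖a‖

/-- The set `K_β^ln(α^t)` of locally normal `(α^t, β)`-KMS states on `A`, with the weak*
topology. -/
def locallyNormalKMS (β : ℝ) : Set (WeakDual ℂ m.Limit) :=
  {ω | IsCStarState ω ∧ IsKMS (fun t a => α.toFun t a) β ω ∧ IsLocallyNormal ω}

/-- The set `K_β^n(α_z^t)` of normal `(α_z^t, β)`-KMS states on `B(H_z)`. It has at most one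
element, if `α^t` is continuous and `β ≠ 0`. -/
def vertexKMS (β : ℝ) {n : ℕ} (z : G.V n) : Set ((m.H z →L[ℂ] m.H z) →L[ℂ] ℂ) :=
  {τ | IsCStarState τ ∧ IsKMS (α.locVertex z) β τ ∧ IsNormalCorner τ}

open Classical in
/-- The link `κ_(α^t,β)(z, z')` for vertices `z` and `z'` of levels `n + 1` and `n`: the value of the
normal `(α_z^t, β)`-KMS state at `zz' ∈ zA_{n+1}`, or zero if there is no such state. -/
def link (β : ℝ) {n : ℕ} (z : G.V (n + 1)) (z' : G.V n) : ℂ :=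
  if h : (α.vertexKMS β z).Nonempty then h.some (comp (m.incl n (m.proj z')) z) else 0

end InductiveFlow
end Multiplicity

variable (G)

/-- A link over the graph, i.e. a function `κ : 𝔈 → [0, 1]` with `∑_{r(e) = z} κ(e) = 1` for
every vertex `z` of positive level. -/
structure IsLink (κ : ∀ n, G.E n → ℝ) : Prop where
  nonneg : ∀ n e, 0 ≤ κ n e
  le_one : ∀ n e, κ n e ≤ 1
  hasSum : ∀ n (z : G.V (n + 1)), HasSum (fun e : {e : G.E n // G.r e = z} => κ n e.1) 1

/-- The normalized, positive `κ`-harmonic functions on the vertices, with the topology of pointwise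
convergence. -/
def harmonic (κ : ∀ n, G.E n → ℝ) : Set (∀ n, G.V n → ℝ) :=
  {ν | (∀ n z, 0 ≤ ν n z) ∧ ν 0 G.uniqueRoot.default = 1 ∧
    ∀ n (z' : G.V n),
      HasSum (fun e : {e : G.E n // G.s e = z'} => ν (n + 1) (G.r e.1) * κ n e.1) (ν n z')}

/-- The discrete probability measures on the vertices of level `n`. -/
def probMeasures (n : ℕ) : Set (G.V n → ℝ) := {ν | (∀ z, 0 ≤ ν z) ∧ HasSum ν 1}

variable {G} in
/-- The map `ν ↦ ν · κ` from measures on the vertices of level `n + 1` to measures on the vertices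
of level `n`. -/
def pushLink (κ : ∀ n, G.E n → ℝ) {n : ℕ} (ν : G.V (n + 1) → ℝ) (z' : G.V n) : ℝ :=
  ∑' e : {e : G.E n // G.s e = z'}, ν (G.r e.1) * κ n e.1

/-- The projective limit of the chain of the sets of probability measures with respect to the
maps `ν ↦ ν · κ`. -/
def projectiveLimit (κ : ∀ n, G.E n → ℝ) : Set (∀ n, G.V n → ℝ) :=
  {ν | (∀ n, ν n ∈ G.probMeasures n) ∧ ∀ n, pushLink κ (ν (n + 1)) = ν n}

end GradedGraph

end

/-! The density operators come first and the flow is read off from them. The standard basis of `H z`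
consists of the paths from the root to z, each edge carrying a copy index. A path gets the product
over its edges of κ(e) times a strictly positive probability weight on the copies of e. Because κ is
a link, the weights of the paths ending at z sum to one (`hasSum_pathWeight`), so they are the
eigenvalues of a density operator. With h = -log(weight)/β (`ham`) that operator is exp(-βh), and
the unitaries exp(ith) implement the flow on B(H_z). Weights multiply along paths, so on a direct
summand of H_z the function h is that of the source vertex plus a constant; constants cancel under
conjugation, the local flows are compatible (`algFlow_incl`), and they pass to the limit.

Matrix units are eigenvectors of the flow. On an eigenvector the KMS condition compares two
multiples of one exponential on the edges of the strip, and Phragmén–Lindelöf turns it into τ(E_pq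
a) = (w_p / w_q) τ(a E_pq). A normal functional with this property is a multiple of the Gibbs state
(`Ell2.eq_weightState_of_gibbs`). So `vertexState` is the only normal KMS state on B(H_z), and
adding the weights of the paths with last edge e shows that its link value is κ(e).

The same argument on A_n writes a locally normal KMS state ω as the sum of ω(z) times the vertex
states (`hasSum_of_isKMS`); evaluated at a central projection one level down, this is harmonicity.
Conversely, a harmonic ν is a probability measure on every level, and the resulting states are
compatible because ν(r(e))κ(e) may be summed over edges by range or by source (`levelState_incl`).

For the topology, Scheffé's lemma identifies pointwise convergence of harmonic functions with ℓ¹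
convergence on every level. This gives continuity of ν ↦ ω, and realizes the harmonic functions as a
closed subset of a countable product of Banach spaces. -/

noncomputable section

open Filter Topology UniformSpace
open scoped ENNReal ComplexOrder

/-! ### Boundary values of bounded analytic functions on the strip -/

section Strip

variable {β : ℝ}

/-- The functions `f` and `g` on the line are the boundary values on `Im z = 0` and `Im z = β` of a
bounded continuous function on the strip that is analytic inside. -/
def IsStripPair (β : ℝ) (f g : ℝ → ℂ) : Prop :=
  ∃ F : ℂ → ℂ, ContinuousOn F (kmsStrip β) ∧
    (∃ C : ℝ, ∀ z ∈ kmsStrip β, ‖F z‖ ≤ C) ∧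
    DifferentiableOn ℂ F (interior (kmsStrip β)) ∧
    ∀ t : ℝ, F t = f t ∧ F (t + β * Complex.I) = g t

lemma interior_kmsStrip (β : ℝ) :
    interior (kmsStrip β) = Complex.im ⁻¹' Set.Ioo (min 0 β) (max 0 β) := by
  have h : kmsStrip β = Complex.im ⁻¹' Set.Icc (min 0 β) (max 0 β) := rfl
  rw [h, Complex.interior_preimage_im, interior_Icc]

lemma closure_interior_kmsStrip (hβ : β ≠ 0) :
    closure (Complex.im ⁻¹' Set.Ioo (min 0 β) (max 0 β)) = kmsStrip β := by
  have h : min 0 β ≠ max 0 β := fun h => hβ (by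
    rcases le_total 0 β with h' | h' <;> simp [h'] at h <;> simp [h])
  rw [Complex.closure_preimage_im, closure_Ioo h]
  rfl

lemma real_mem_kmsStrip (t : ℝ) : (t : ℂ) ∈ kmsStrip β := by simp [kmsStrip]

lemma real_add_mem_kmsStrip (t : ℝ) : (t : ℂ) + β * Complex.I ∈ kmsStrip β := by simp [kmsStrip]

/-- A bounded analytic function on the strip attains its bound on the boundary. -/
lemma norm_le_of_boundary (hβ : β ≠ 0) {F : ℂ → ℂ} {C : ℝ} (hc : ContinuousOn F (kmsStrip β))
    (hb : ∃ C : ℝ, ∀ z ∈ kmsStrip β, ‖F z‖ ≤ C)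
    (hd : DifferentiableOn ℂ F (interior (kmsStrip β)))
    (h0 : ∀ t : ℝ, ‖F t‖ ≤ C) (h1 : ∀ t : ℝ, ‖F (t + β * Complex.I)‖ ≤ C) {z : ℂ}
    (hz : z ∈ kmsStrip β) : ‖F z‖ ≤ C := by
  have hline : ∀ w : ℂ, w.im = 0 ∨ w.im = β → ‖F w‖ ≤ C := by
    rintro w (hw | hw)
    · convert h0 w.re using 3
      exact Complex.ext rfl (by simp [hw])
    · convert h1 w.re using 3
      exact Complex.ext (by simp) (by simp [hw])
  refine PhragmenLindelof.horizontal_strip (a := min 0 β) (b := max 0 β) ⟨?_, ?_⟩ ?_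
    (fun w hw => hline w ?_) (fun w hw => hline w ?_) hz.1 hz.2
  · rwa [← interior_kmsStrip]
  · rwa [closure_interior_kmsStrip hβ]
  · obtain ⟨M, hM⟩ := hb
    have hpos : 0 < max 0 β - min 0 β := by
      rw [max_sub_min_eq_abs']; simpa using hβ
    -- Since F is bounded, the growth condition of Phragmén–Lindelöf holds with both constants zero,
    -- the comparison function being 1.
    refine ⟨0, by positivity, 0, ?_⟩
    refine Asymptotics.IsBigO.of_bound M ?_
    filter_upwards [mem_inf_of_right (mem_principal_self _)] with w hw
    simpa using hM w ⟨hw.1.le, hw.2.le⟩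
  · rcases min_choice 0 β with h | h <;> rw [h] at hw <;> simp [hw]
  · rcases max_choice 0 β with h | h <;> rw [h] at hw <;> simp [hw]

lemma norm_exp_mul_I (c : ℝ) (z : ℂ) :
    ‖Complex.exp (Complex.I * c * z)‖ = Real.exp (-(c * z.im)) := by
  rw [Complex.norm_exp]
  congr 1
  simp

lemma exp_mul_bounded (β c : ℝ) :
    ∃ C : ℝ, ∀ z ∈ kmsStrip β, ‖Complex.exp (Complex.I * c * z)‖ ≤ C := by
  refine ⟨Real.exp (|c| * |β|), fun z hz => ?_⟩
  rw [norm_exp_mul_I, Real.exp_le_exp]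
  refine (le_abs_self _).trans ?_
  rw [abs_neg, abs_mul]
  have h1 := hz.1
  have h2 := hz.2
  have h3 : |z.im| ≤ |β| := abs_le.2 ⟨(le_min (by simp) (neg_abs_le β)).trans h1,
    h2.trans (max_le (abs_nonneg β) (le_abs_self β))⟩
  gcongr

namespace IsStripPair

variable {f g f' g' : ℝ → ℂ}

/-- Exponentials are boundary values of entire functions. -/
lemma exp (β : ℝ) (c : ℂ) (l : ℝ) : IsStripPair β (fun t => c * Complex.exp (Complex.I * l * t))
    (fun t => c * Real.exp (-(β * l)) * Complex.exp (Complex.I * l * t)) := by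
  refine ⟨fun z => c * Complex.exp (Complex.I * l * z), by fun_prop, ?_,
    (by fun_prop : Differentiable ℂ _).differentiableOn, fun t => ⟨rfl, ?_⟩⟩
  · obtain ⟨C, hC⟩ := exp_mul_bounded β l
    refine ⟨‖c‖ * C, fun z hz => ?_⟩
    rw [norm_mul]
    gcongr
    exact hC z hz
  · beta_reduce
    rw [mul_assoc c, Complex.ofReal_exp, ← Complex.exp_add]
    congr 2
    push_cast
    linear_combination (l * β : ℂ) * Complex.I_sq

lemma add (h : IsStripPair β f g) (h' : IsStripPair β f' g') :
    IsStripPair β (fun t => f t + f' t) (fun t => g t + g' t) := by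
  obtain ⟨F, hc, ⟨C, hC⟩, hd, hb⟩ := h
  obtain ⟨F', hc', ⟨C', hC'⟩, hd', hb'⟩ := h'
  refine ⟨fun z => F z + F' z, hc.add hc', ⟨C + C', fun z hz => ?_⟩, hd.add hd', fun t => ?_⟩
  · exact (norm_add_le _ _).trans (add_le_add (hC z hz) (hC' z hz))
  · simp [(hb t).1, (hb t).2, (hb' t).1, (hb' t).2]

lemma const_mul (c : ℂ) (h : IsStripPair β f g) :
    IsStripPair β (fun t => c * f t) (fun t => c * g t) := by
  obtain ⟨F, hc, ⟨C, hC⟩, hd, hb⟩ := h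
  refine ⟨fun z => c * F z, hc.const_mul c, ⟨‖c‖ * C, fun z hz => ?_⟩, hd.const_mul c, fun t => ?_⟩
  · rw [norm_mul]
    gcongr
    exact hC z hz
  · simp [(hb t).1, (hb t).2]

lemma zero : IsStripPair β (fun _ => 0) (fun _ => 0) :=
  ⟨fun _ => 0, continuousOn_const, ⟨0, by simp⟩, differentiableOn_const 0, by simp⟩

lemma finset_sum {J : Type*} (s : Finset J) {f g : J → ℝ → ℂ}
    (h : ∀ j, IsStripPair β (f j) (g j)) :
    IsStripPair β (fun t => ∑ j ∈ s, f j t) (fun t => ∑ j ∈ s, g j t) := by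
  classical
  induction s using Finset.induction_on with
  | empty => simpa using zero
  | insert j s hj ih =>
    simp_rw [Finset.sum_insert hj]
    exact (h j).add ih

/-- Uniform limits of boundary values of bounded analytic functions are boundary values of bounded
analytic functions. -/
lemma of_tendstoUniformly (hβ : β ≠ 0) {J : Type*} {l : Filter J} [l.NeBot] {f g : J → ℝ → ℂ}
    {f₀ g₀ : ℝ → ℂ} (h : ∀ j, IsStripPair β (f j) (g j)) (hf : TendstoUniformly f f₀ l)
    (hg : TendstoUniformly g g₀ l) : IsStripPair β f₀ g₀ := by
  choose F hc hbd hd hb using h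
  -- The maximum principle carries the uniform Cauchy property from the two boundary lines to the
  -- whole strip.
  have hcauchy : UniformCauchySeqOn F l (kmsStrip β) := by
    intro u hu
    obtain ⟨ε, hε, hεu⟩ := Metric.mem_uniformity_dist.1 hu
    have h1 := Metric.tendstoUniformly_iff.1 hf (ε / 4) (by positivity)
    have h2 := Metric.tendstoUniformly_iff.1 hg (ε / 4) (by positivity)
    have h12 := h1.and h2
    filter_upwards [h12.prod_mk h12] with ⟨i, j⟩ ⟨⟨hfi, hgi⟩, ⟨hfj, hgj⟩⟩ z hz
    refine hεu ?_
    rw [dist_eq_norm]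
    refine lt_of_le_of_lt (norm_le_of_boundary hβ (F := fun z => F i z - F j z) (C := ε / 2)
      ((hc i).sub (hc j)) ?_ ((hd i).sub (hd j)) ?_ ?_ hz) (by linarith)
    · obtain ⟨C, hC⟩ := hbd i
      obtain ⟨C', hC'⟩ := hbd j
      exact ⟨C + C', fun z hz => (norm_sub_le _ _).trans (add_le_add (hC z hz) (hC' z hz))⟩
    · intro t
      rw [(hb i t).1, (hb j t).1, ← dist_eq_norm]
      have := dist_triangle_left (f i t) (f j t) (f₀ t)
      linarith [hfi t, hfj t]
    · intro t
      rw [(hb i t).2, (hb j t).2, ← dist_eq_norm]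
      have := dist_triangle_left (g i t) (g j t) (g₀ t)
      linarith [hgi t, hgj t]
  have hlim : ∀ z ∈ kmsStrip β, ∃ y, Tendsto (fun j => F j z) l (𝓝 y) := fun z hz =>
    cauchy_map_iff_exists_tendsto.1 (hcauchy.cauchy_map hz)
  let F₀ : ℂ → ℂ := fun z => limUnder l fun j => F j z
  have hF₀ : ∀ z ∈ kmsStrip β, Tendsto (fun j => F j z) l (𝓝 (F₀ z)) := fun z hz =>
    tendsto_nhds_limUnder (hlim z hz)
  have hunif : TendstoUniformlyOn F F₀ l (kmsStrip β) :=
    hcauchy.tendstoUniformlyOn_of_tendsto hF₀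
  refine ⟨F₀, hunif.continuousOn (Eventually.of_forall hc).frequently, ?_, ?_, fun t => ⟨?_, ?_⟩⟩
  · obtain ⟨j, hj⟩ := (Metric.tendstoUniformlyOn_iff.1 hunif 1 one_pos).exists
    obtain ⟨C, hC⟩ := hbd j
    refine ⟨1 + C, fun z hz => ?_⟩
    have h1 := hj z hz
    rw [dist_eq_norm] at h1
    have h2 := norm_add_le (F₀ z - F j z) (F j z)
    rw [sub_add_cancel] at h2
    linarith [hC z hz]
  · exact (hunif.mono interior_subset).tendstoLocallyUniformlyOn.differentiableOn
      (Eventually.of_forall hd) isOpen_interior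
  · refine tendsto_nhds_unique (hF₀ t (real_mem_kmsStrip t)) ?_
    simp_rw [(hb _ t).1]
    exact hf.tendsto_at t
  · refine tendsto_nhds_unique (hF₀ _ (real_add_mem_kmsStrip t)) ?_
    simp_rw [(hb _ t).2]
    exact hg.tendsto_at t

/-- Sums of boundary values of bounded analytic functions. -/
lemma tsum (hβ : β ≠ 0) {J : Type*} {f g : J → ℝ → ℂ} {u : J → ℝ} (hu : Summable u)
    (h : ∀ j, IsStripPair β (f j) (g j)) (hf : ∀ j t, ‖f j t‖ ≤ u j) (hg : ∀ j t, ‖g j t‖ ≤ u j) :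
    IsStripPair β (fun t => ∑' j, f j t) (fun t => ∑' j, g j t) :=
  of_tendstoUniformly hβ (l := atTop) (fun s => finset_sum s h) (tendstoUniformly_tsum hu hf)
    (tendstoUniformly_tsum hu hg)

/-- If the boundary values of a bounded analytic function are constant on each of the two boundary
lines, then the two constants agree. -/
lemma eq_of_const (hβ : β ≠ 0) {c d : ℂ} (h : IsStripPair β (fun _ => c) (fun _ => d)) : c = d := by
  obtain ⟨F, hc, ⟨C, hC⟩, hd, hb⟩ := h
  -- Both constants turn out to be the value of F at the midpoint of the strip.
  set z₀ : ℂ := (β / 2 : ℝ) * Complex.I with hz₀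
  have hz₀im : z₀.im = β / 2 := by simp [hz₀]
  have hz₀mem : z₀ ∈ kmsStrip β := by
    constructor <;> rw [hz₀im]
    · rcases le_total 0 β with h | h <;> simp [h] <;> linarith
    · rcases le_total 0 β with h | h <;> simp [h] <;> linarith
  -- The factor exp(i(k/β)z) has modulus 1 on the real line, exp(-k) on the other line and exp(-k/2)
  -- at the midpoint. Taking a = c, k = n or a = d, k = -n kills the difference on one line, and n →
  -- ∞ forces F z₀ = a.
  have key : ∀ (a : ℂ) (k : ℝ) (M : ℝ), (‖c - a‖ ≤ M) → ‖d - a‖ * Real.exp (-k) ≤ M →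
      ‖F z₀ - a‖ * Real.exp (-(k / 2)) ≤ M := by
    intro a k M h0 h1
    have hk : k / β * z₀.im = k / 2 := by rw [hz₀im]; field_simp
    have := norm_le_of_boundary hβ
      (F := fun z => (F z - a) * Complex.exp (Complex.I * (k / β : ℝ) * z)) (C := M)
      ((hc.sub continuousOn_const).mul (by fun_prop)) ?_
      ((hd.sub_const a).mul (by fun_prop : Differentiable ℂ _).differentiableOn) ?_ ?_ hz₀mem
    · beta_reduce at this
      rwa [norm_mul, norm_exp_mul_I, hk] at this
    · obtain ⟨C', hC'⟩ := exp_mul_bounded β (k / β)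
      refine ⟨(C + ‖a‖) * C', fun z hz => ?_⟩
      rw [norm_mul]
      refine mul_le_mul ((norm_sub_le _ _).trans (by linarith [hC z hz])) (hC' z hz)
        (norm_nonneg _) ?_
      exact add_nonneg ((norm_nonneg _).trans (hC z hz)) (norm_nonneg a)
    · intro t
      rw [norm_mul, norm_exp_mul_I, (hb t).1]
      simpa using h0
    · intro t
      rw [norm_mul, norm_exp_mul_I, (hb t).2]
      have : k / β * ((t : ℂ) + β * Complex.I).im = k := by simp; field_simp
      rwa [this]
  have h1 : F z₀ = c := by
    rw [← sub_eq_zero, ← norm_le_zero_iff]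
    have hle : ∀ n : ℕ, ‖F z₀ - c‖ ≤ ‖d - c‖ * Real.exp (-(n / 2 : ℝ)) := fun n => by
      have := key c n (‖d - c‖ * Real.exp (-n)) (by simp; positivity) le_rfl
      rw [show (-(n : ℝ)) = -(n / 2 : ℝ) + -(n / 2 : ℝ) by ring, Real.exp_add, ← mul_assoc] at this
      exact le_of_mul_le_mul_right this (Real.exp_pos _)
    refine ge_of_tendsto' (x := atTop) ?_ hle
    have h2 : Tendsto (fun n : ℕ => (n / 2 : ℝ)) atTop atTop :=
      tendsto_natCast_atTop_atTop.atTop_div_const two_pos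
    simpa using ((Real.tendsto_exp_atBot.comp (tendsto_neg_atTop_atBot.comp h2)).const_mul ‖d - c‖)
  have h2 : F z₀ = d := by
    rw [← sub_eq_zero, ← norm_le_zero_iff]
    have hle : ∀ n : ℕ, ‖F z₀ - d‖ ≤ ‖c - d‖ * Real.exp (-(n / 2 : ℝ)) := fun n => by
      have := key d (-n) (‖c - d‖) le_rfl (by simp)
      rw [show (-(-(n : ℝ) / 2)) = (n / 2 : ℝ) by ring] at this
      rw [Real.exp_neg, ← div_eq_mul_inv, le_div_iff₀ (Real.exp_pos _)]
      exact this
    refine ge_of_tendsto' (x := atTop) ?_ hle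
    have h2 : Tendsto (fun n : ℕ => (n / 2 : ℝ)) atTop atTop :=
      tendsto_natCast_atTop_atTop.atTop_div_const two_pos
    simpa using ((Real.tendsto_exp_atBot.comp (tendsto_neg_atTop_atBot.comp h2)).const_mul ‖c - d‖)
  rw [← h1, h2]

/-- Multiplication by an exponential. -/
lemma mul_exp (l : ℝ) (h : IsStripPair β f g) :
    IsStripPair β (fun t => f t * Complex.exp (Complex.I * l * t))
      (fun t => g t * (Real.exp (-(β * l)) * Complex.exp (Complex.I * l * t))) := by
  obtain ⟨F, hc, ⟨C, hC⟩, hd, hb⟩ := h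
  obtain ⟨F', hc', ⟨C', hC'⟩, hd', hb'⟩ := IsStripPair.exp β 1 l
  refine ⟨fun z => F z * F' z, hc.mul hc', ⟨C * C', fun z hz => ?_⟩, hd.mul hd', fun t => ?_⟩
  · rw [norm_mul]
    exact mul_le_mul (hC z hz) (hC' z hz) (norm_nonneg _) ((norm_nonneg _).trans (hC z hz))
  · simp [(hb t).1, (hb t).2, (hb' t).1, (hb' t).2]

/-- Multiplication by exp(-ilz) makes the boundary values constant, so that `eq_of_const` applies.
Every Gibbs relation below has its source here. -/
lemma eq_of_exp (hβ : β ≠ 0) {c d : ℂ} {l : ℝ}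
    (h : IsStripPair β (fun t => c * Complex.exp (Complex.I * l * t))
      (fun t => d * Complex.exp (Complex.I * l * t))) : d = Real.exp (-(β * l)) * c := by
  have h1 := h.mul_exp (-l)
  have e1 : ∀ t : ℝ, Complex.exp (Complex.I * l * t) * Complex.exp (Complex.I * (-l : ℝ) * t) = 1 :=
    fun t => by rw [← Complex.exp_add, ← Complex.exp_zero]; congr 1; push_cast; ring
  have e2 : (Real.exp (-(β * l)) : ℂ) * Real.exp (-(β * -l)) = 1 := by
    rw [← Complex.ofReal_mul, ← Real.exp_add]; simp
  have h2 : IsStripPair β (fun _ => c) (fun _ => d * Real.exp (-(β * -l))) := by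
    convert h1 using 2 with t t
    · linear_combination -c * e1 t
    · linear_combination -(d * Real.exp (-(β * -l))) * e1 t
  have h3 := h2.eq_of_const hβ
  linear_combination (-d) * e2 - (Real.exp (-(β * l)) : ℂ) * h3

end IsStripPair

/-! ### The KMS condition on eigenvectors and on dense sets -/

section KMSGeneral

variable {A : Type*} [CStarAlgebra A] {α : ℝ → A → A} {ω : A →L[ℂ] ℂ}

/-- The KMS condition for eigenvectors of the flow. -/
lemma IsKMS.apply_mul_of_eigenvector (hβ : β ≠ 0) (h : IsKMS α β ω) {v : A} {l : ℝ}
    (hv : ∀ t, α t v = Complex.exp (Complex.I * l * t) • v) (a : A) :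
    ω (v * a) = Real.exp (-(β * l)) * ω (a * v) := by
  refine IsStripPair.eq_of_exp hβ (l := l) ?_
  have h1 : IsStripPair β (fun t => ω (a * α t v)) (fun t => ω (α t v * a)) := h a v
  convert h1 using 2 with t t <;> rw [hv] <;> simp [mul_comm]

/-- The KMS condition holds if it holds for all elements of a dense set. -/
lemma IsKMS.of_dense (hβ : β ≠ 0) {D : Set A} (hD : Dense D)
    (hα : ∀ t a b, α t (a - b) = α t a - α t b) (hn : ∀ t a, ‖α t a‖ = ‖a‖)
    (h : ∀ a ∈ D, ∀ b ∈ D, IsStripPair β (fun t => ω (a * α t b)) (fun t => ω (α t b * a))) :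
    IsKMS α β ω := by
  intro a b
  obtain ⟨x, hxD, hx⟩ := mem_closure_iff_seq_limit.1 (hD a)
  obtain ⟨y, hyD, hy⟩ := mem_closure_iff_seq_limit.1 (hD b)
  -- This error bound does not involve t, because the flow is isometric; hence the approximation is
  -- uniform on both boundary lines.
  have hz : Tendsto (fun k => ‖ω‖ * (‖a - x k‖ * ‖b‖ + ‖x k‖ * ‖b - y k‖)) atTop (𝓝 0) := by
    have h1 := (tendsto_const_nhds (x := a)).sub hx
    have h2 := (tendsto_const_nhds (x := b)).sub hy
    rw [sub_self] at h1 h2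
    simpa using ((h1.norm.mul_const ‖b‖).add (hx.norm.mul h2.norm)).const_mul ‖ω‖
  refine IsStripPair.of_tendstoUniformly hβ (l := atTop) (fun k => h (x k) (hxD k) (y k) (hyD k)) ?_ ?_
  · rw [Metric.tendstoUniformly_iff]
    intro ε hε
    filter_upwards [hz.eventually (gt_mem_nhds hε)] with k hk t
    refine lt_of_le_of_lt ?_ hk
    rw [dist_eq_norm, ← map_sub]
    refine ω.le_opNorm_of_le ?_
    rw [show a * α t b - x k * α t (y k) = (a - x k) * α t b + x k * α t (b - y k) by
      rw [hα]; noncomm_ring]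
    refine (norm_add_le _ _).trans (add_le_add ?_ ?_)
    · exact (norm_mul_le _ _).trans_eq (by rw [hn])
    · exact (norm_mul_le _ _).trans_eq (by rw [hn])
  · rw [Metric.tendstoUniformly_iff]
    intro ε hε
    filter_upwards [hz.eventually (gt_mem_nhds hε)] with k hk t
    refine lt_of_le_of_lt ?_ hk
    rw [dist_eq_norm, ← map_sub]
    refine ω.le_opNorm_of_le ?_
    rw [show α t b * a - α t (y k) * x k = α t b * (a - x k) + α t (b - y k) * x k by
      rw [hα]; noncomm_ring]
    refine (norm_add_le _ _).trans (add_le_add ?_ ?_)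
    · exact (norm_mul_le _ _).trans_eq (by rw [hn, mul_comm])
    · exact (norm_mul_le _ _).trans_eq (by rw [hn, mul_comm])

end KMSGeneral

end Strip

/-! ### Matrix units and diagonal unitary groups on ℓ² -/

namespace Ell2

variable {X : Type*}

open Classical in
/-- The standard basis vectors of `ℓ²(X)`. -/
def e (x : X) : Ell2 X := lp.single 2 x 1

lemma inner_e (x : X) (v : Ell2 X) : inner ℂ (e x) v = v x := by
  classical
  rw [e, lp.inner_single_left]
  simp

lemma norm_e (x : X) : ‖e x‖ = 1 := by
  classical
  rw [e, lp.norm_single (by norm_num)]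
  simp

lemma e_apply_self (x : X) : e x x = 1 := by
  classical
  simp [e]

lemma e_apply_ne {x y : X} (h : y ≠ x) : e x y = 0 := by
  classical
  simp [e, h]

lemma hasSum_e (v : Ell2 X) : HasSum (fun x => v x • e x) v := by
  classical
  have := lp.hasSum_single (p := 2) (by norm_num) v
  convert this using 2 with x
  rw [e, ← lp.single_smul]
  simp

/-- The matrix units. -/
def E (x y : X) : Ell2 X →L[ℂ] Ell2 X := InnerProductSpace.rankOne ℂ (e x) (e y)

lemma E_apply (x y : X) (v : Ell2 X) : E x y v = v y • e x := by
  rw [E, InnerProductSpace.rankOne_apply, inner_e]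

lemma E_mul_E (x y z : X) : E x y * E y z = E x z := by
  ext1 v
  simp [E_apply, e_apply_self]

lemma E_mul_mul_E (x : X) (a : Ell2 X →L[ℂ] Ell2 X) : E x x * a * E x x = a (e x) x • E x x := by
  ext1 v
  simp [E_apply, smul_smul, mul_comm]

lemma hasSum_E_apply (v : Ell2 X) : HasSum (fun x => E x x v) v := by
  simpa only [E_apply] using hasSum_e v

lemma memℓp_mul (f : X → ℂ) (hf : ∀ x, ‖f x‖ ≤ 1) (v : Ell2 X) :
    Memℓp (fun x => f x * v x) 2 := by
  rw [memℓp_iff]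
  refine Summable.of_nonneg_of_le (fun _ => by positivity) (fun x => ?_) (hasSum_sq v).summable
  rw [norm_mul]
  gcongr
  exact mul_le_of_le_one_left (norm_nonneg _) (hf x)

/-- The diagonal operators with diagonal entries of modulus at most one. -/
def diag (f : X → ℂ) (hf : ∀ x, ‖f x‖ ≤ 1) : Ell2 X →L[ℂ] Ell2 X :=
  LinearMap.mkContinuous
    { toFun := fun v => ⟨fun x => f x * v x, memℓp_mul f hf v⟩
      map_add' := fun v w => by ext x; exact mul_add _ _ _
      map_smul' := fun r v => by ext x; exact mul_left_comm _ _ _ } 1 fun v => by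
    rw [one_mul]
    refine (pow_le_pow_iff_left₀ (norm_nonneg _) (norm_nonneg _) two_ne_zero).1 ?_
    refine hasSum_le (fun x => ?_) (hasSum_sq _) (hasSum_sq v)
    simp only [LinearMap.coe_mk, AddHom.coe_mk, norm_mul]
    gcongr
    exact mul_le_of_le_one_left (norm_nonneg _) (hf x)

lemma diag_apply (f : X → ℂ) (hf : ∀ x, ‖f x‖ ≤ 1) (v : Ell2 X) (x : X) :
    diag f hf v x = f x * v x := rfl

lemma norm_diag_le (f : X → ℂ) (hf : ∀ x, ‖f x‖ ≤ 1) : ‖diag f hf‖ ≤ 1 :=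
  LinearMap.mkContinuous_norm_le _ zero_le_one _

lemma star_diag (f g : X → ℂ) (hf : ∀ x, ‖f x‖ ≤ 1) (hg : ∀ x, ‖g x‖ ≤ 1)
    (h : ∀ x, g x = star (f x)) : star (diag f hf) = diag g hg := by
  rw [ContinuousLinearMap.star_eq_adjoint, eq_comm, ContinuousLinearMap.eq_adjoint_iff]
  intro v w
  refine (lp.hasSum_inner _ _).unique ?_
  convert lp.hasSum_inner v (diag f hf w) using 2 with x
  rw [diag_apply, diag_apply, h]
  simp
  ring

/-- Such a sum is diagonal with entries 0 and 1. The uniform bound lets normal functionals follow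
these sums to their strong limit 1. -/
lemma norm_sum_E_le (s : Finset X) : ‖∑ x ∈ s, E x x‖ ≤ 1 := by
  classical
  convert norm_diag_le (fun x => if x ∈ s then (1 : ℂ) else 0)
    (fun x => by split_ifs <;> simp) using 2
  ext v y
  rw [diag_apply, sum_apply]
  simp_rw [E_apply]
  rw [lp.coeFn_sum, Finset.sum_apply]
  simp_rw [lp.coeFn_smul, Pi.smul_apply, smul_eq_mul]
  split_ifs with hy
  · rw [Finset.sum_eq_single y (fun x _ hx => by rw [e_apply_ne hx.symm, mul_zero])
      (fun h => absurd hy h), e_apply_self]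
    ring
  · rw [Finset.sum_eq_zero, zero_mul]
    intro x hx
    rw [e_apply_ne (fun h => hy (by rwa [h])), mul_zero]

lemma norm_phase_le (h : X → ℝ) (t : ℝ) (x : X) : ‖Complex.exp (Complex.I * h x * t)‖ ≤ 1 := by
  rw [norm_exp_mul_I]
  simp

/-- The unitary group generated by the diagonal operator with the entries `h x`. -/
def phase (h : X → ℝ) (t : ℝ) : Ell2 X →L[ℂ] Ell2 X :=
  diag (fun x => Complex.exp (Complex.I * h x * t)) (norm_phase_le h t)

lemma phase_apply (h : X → ℝ) (t : ℝ) (v : Ell2 X) (x : X) :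
    phase h t v x = Complex.exp (Complex.I * h x * t) * v x := rfl

lemma norm_phase_op_le (h : X → ℝ) (t : ℝ) : ‖phase h t‖ ≤ 1 := norm_diag_le _ _

lemma phase_zero (h : X → ℝ) : phase h 0 = 1 := by
  ext v x
  simp [phase_apply]

lemma phase_mul (h : X → ℝ) (s t : ℝ) : phase h s * phase h t = phase h (s + t) := by
  ext v x
  rw [mul_apply_eq_comp, phase_apply, phase_apply, phase_apply, ← mul_assoc, ← Complex.exp_add]
  congr 2
  push_cast
  ring

lemma star_phase (h : X → ℝ) (t : ℝ) : star (phase h t) = phase h (-t) := by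
  refine star_diag _ _ _ _ fun x => ?_
  rw [Complex.star_def, ← Complex.exp_conj]
  congr 1
  simp

lemma phase_e (h : X → ℝ) (t : ℝ) (x : X) :
    phase h t (e x) = Complex.exp (Complex.I * h x * t) • e x := by
  ext y
  rw [phase_apply, lp.coeFn_smul, Pi.smul_apply, smul_eq_mul]
  by_cases hy : y = x
  · rw [hy]
  · rw [e_apply_ne hy, mul_zero, mul_zero]

/-- The function h may be unbounded, so only strong continuity can be expected. At t = 0 the squared
distance to v is a series of continuous functions dominated by (2‖v x‖)²; the group law moves
continuity to every other point. -/
lemma continuous_phase (h : X → ℝ) (v : Ell2 X) : Continuous fun t => phase h t v := by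
  have h1 : Continuous fun t => ‖phase h t v - v‖ ^ 2 := by
    have : (fun t => ‖phase h t v - v‖ ^ 2) =
        fun t : ℝ => ∑' x, ‖Complex.exp (Complex.I * h x * t) * v x - v x‖ ^ 2 := by
      ext t
      exact (hasSum_sq (phase h t v - v)).tsum_eq.symm
    rw [this]
    refine continuous_tsum (u := fun x => (2 * ‖v x‖) ^ 2) (fun x => by fun_prop) ?_ fun x t => ?_
    · simp_rw [mul_pow]
      exact (hasSum_sq v).summable.mul_left _
    · rw [norm_pow, norm_norm]
      gcongr
      refine (norm_sub_le _ _).trans ?_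
      rw [norm_mul, two_mul]
      gcongr
      exact mul_le_of_le_one_left (norm_nonneg _) (norm_phase_le h t x)
  have h2 : Tendsto (fun t => phase h t v) (𝓝 0) (𝓝 v) := by
    rw [tendsto_iff_norm_sub_tendsto_zero]
    have h3 := (h1.tendsto 0).sqrt
    simpa [phase_zero, Real.sqrt_sq] using h3
  refine continuous_iff_continuousAt.2 fun s => ?_
  have h3 : (fun t => phase h t v) = fun t => phase h s (phase h (t - s) v) := by
    ext1 t
    rw [← mul_apply_eq_comp, phase_mul, add_sub_cancel]
  have h4 : phase h s v = phase h s (phase h (s - s) v) := by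
    rw [sub_self, phase_zero, one_apply_eq_self]
  rw [ContinuousAt, h4, h3, sub_self, phase_zero, one_apply_eq_self]
  refine ((phase h s).continuous.tendsto _).comp (h2.comp ?_)
  have : Tendsto (fun t : ℝ => t - s) (𝓝 s) (𝓝 (s - s)) := tendsto_id.sub_const s
  rwa [sub_self] at this

/-- The flow of inner automorphisms implemented by the unitary group `phase h`. -/
def conj (h : X → ℝ) (t : ℝ) (a : Ell2 X →L[ℂ] Ell2 X) : Ell2 X →L[ℂ] Ell2 X :=
  phase h t * a * phase h (-t)

lemma conj_E (h : X → ℝ) (t : ℝ) (x y : X) :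
    conj h t (E x y) = Complex.exp (Complex.I * (h x - h y : ℝ) * t) • E x y := by
  ext1 v
  rw [conj, mul_apply_eq_comp, mul_apply_eq_comp, E_apply, map_smul, phase_e, phase_apply,
    smul_apply, E_apply, smul_smul, smul_smul]
  congr 1
  rw [mul_right_comm, ← Complex.exp_add]
  congr 2
  push_cast
  ring

lemma conj_apply_e (h : X → ℝ) (t : ℝ) (a : Ell2 X →L[ℂ] Ell2 X) (x y : X) :
    conj h t a (e x) y = Complex.exp (Complex.I * (h y - h x : ℝ) * t) * a (e x) y := by
  rw [conj, mul_apply_eq_comp, mul_apply_eq_comp, phase_e, map_smul, map_smul, lp.coeFn_smul,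
    Pi.smul_apply, smul_eq_mul, phase_apply, ← mul_assoc, ← Complex.exp_add]
  congr 2
  push_cast
  ring

lemma star_apply_e (a : Ell2 X →L[ℂ] Ell2 X) (x y : X) :
    star a (e x) y = star (a (e y) x) := by
  rw [← inner_e y (star a (e x)), ContinuousLinearMap.star_eq_adjoint,
    ContinuousLinearMap.adjoint_inner_right, ← inner_e x (a (e y)), Complex.star_def,
    inner_conj_symm]

/-- This is the coordinate expansion of the inner product of `star a (e x)` with `b (e x)`. -/
lemma hasSum_matrix_mul (a b : Ell2 X →L[ℂ] Ell2 X) (x : X) :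
    HasSum (fun y => a (e y) x * b (e x) y) ((a * b) (e x) x) := by
  have h1 : HasSum (fun y => inner ℂ (star a (e x) y) (b (e x) y))
      (inner ℂ (star a (e x)) (b (e x))) := lp.hasSum_inner _ _
  have h2 : inner ℂ (star a (e x)) (b (e x)) = (a * b) (e x) x := by
    rw [ContinuousLinearMap.star_eq_adjoint, ContinuousLinearMap.adjoint_inner_left, inner_e]
    rfl
  rw [h2] at h1
  refine h1.congr_fun fun y => ?_
  rw [star_apply_e]
  simp [mul_comm]

lemma hasSum_norm_sq_row (a : Ell2 X →L[ℂ] Ell2 X) (x : X) :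
    HasSum (fun y => ‖a (e y) x‖ ^ 2) (‖star a (e x)‖ ^ 2) := by
  simpa only [star_apply_e, norm_star] using hasSum_sq (star a (e x))

lemma norm_apply_e_le (a : Ell2 X →L[ℂ] Ell2 X) (x : X) : ‖a (e x)‖ ≤ ‖a‖ := by
  simpa [norm_e] using a.le_opNorm (e x)

lemma norm_apply_e_apply_le (a : Ell2 X →L[ℂ] Ell2 X) (x y : X) : ‖a (e x) y‖ ≤ ‖a‖ :=
  (lp.norm_apply_le_norm (by norm_num) _ y).trans (norm_apply_e_le a x)

/-- From AB ≤ A² + B² every inner sum is at most M, so the weighted double sum is at most M times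
the total weight. -/
lemma summable_prod_mul {w s : X → ℝ} (hw : ∀ x, 0 ≤ w x) (hs : Summable w) {A B : X → X → ℝ}
    (hA : ∀ x y, 0 ≤ A x y) (hB : ∀ x y, 0 ≤ B x y) {M : ℝ}
    (h : ∀ x, HasSum (fun y => A x y ^ 2 + B x y ^ 2) (s x)) (hM : ∀ x, s x ≤ M) :
    Summable fun j : X × X => w j.1 * (A j.1 j.2 * B j.1 j.2) := by
  have h2 : ∀ x y, A x y * B x y ≤ A x y ^ 2 + B x y ^ 2 := fun x y => by
    nlinarith [sq_nonneg (A x y - B x y), mul_nonneg (hA x y) (hB x y)]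
  have h3 : ∀ x, Summable fun y => A x y * B x y := fun x =>
    Summable.of_nonneg_of_le (fun y => mul_nonneg (hA x y) (hB x y)) (h2 x) (h x).summable
  have h4 : ∀ j : X × X, 0 ≤ w j.1 * (A j.1 j.2 * B j.1 j.2) := fun j =>
    mul_nonneg (hw j.1) (mul_nonneg (hA j.1 j.2) (hB j.1 j.2))
  refine (summable_prod_of_nonneg h4).2 ⟨fun x => (h3 x).mul_left (w x), ?_⟩
  have h5 : (fun x => ∑' y, w x * (A x y * B x y)) = fun x => w x * ∑' y, A x y * B x y :=
    funext fun x => tsum_mul_left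
  change Summable fun x => ∑' y, w x * (A x y * B x y)
  rw [h5]
  refine Summable.of_nonneg_of_le
    (fun x => mul_nonneg (hw x) (tsum_nonneg fun y => mul_nonneg (hA x y) (hB x y)))
    (fun x => ?_) (hs.mul_right M)
  refine mul_le_mul_of_nonneg_left ?_ (hw x)
  refine ((h3 x).tsum_le_tsum (h2 x) (h x).summable).trans ?_
  rw [(h x).tsum_eq]
  exact hM x

/-- Rows of a and columns of b have ℓ² norms at most ‖a‖ and ‖b‖. This is the absolute convergence
behind exchanging the summations in a Gibbs state of a product. -/
lemma summable_matrix_mul {w : X → ℝ} (hw : ∀ x, 0 ≤ w x) (hs : Summable w)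
    (a b : Ell2 X →L[ℂ] Ell2 X) :
    Summable fun j : X × X => w j.1 * (‖a (e j.2) j.1‖ * ‖b (e j.1) j.2‖) := by
  refine summable_prod_mul hw hs (A := fun x y => ‖a (e y) x‖) (B := fun x y => ‖b (e x) y‖)
    (fun _ _ => norm_nonneg _) (fun _ _ => norm_nonneg _)
    (fun x => (hasSum_norm_sq_row a x).add (hasSum_sq (b (e x)))) (M := ‖a‖ ^ 2 + ‖b‖ ^ 2)
    fun x => ?_
  have h4 := norm_apply_e_le (star a) x
  rw [ContinuousLinearMap.star_eq_adjoint, LinearIsometryEquiv.norm_map] at h4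
  exact add_le_add (pow_le_pow_left₀ (norm_nonneg _) h4 2)
    (pow_le_pow_left₀ (norm_nonneg _) (norm_apply_e_le b x) 2)

/-! ### Diagonal Gibbs states -/

section WeightState

variable {w : X → ℝ} (hw : ∀ x, 0 ≤ w x) (hs : HasSum w 1)

include hw hs in
lemma summable_weight_diag (a : Ell2 X →L[ℂ] Ell2 X) :
    Summable fun x => (w x : ℂ) * a (e x) x := by
  refine Summable.of_norm_bounded (hs.summable.mul_right ‖a‖) fun x => ?_
  rw [norm_mul, Complex.norm_real, Real.norm_of_nonneg (hw x)]
  exact mul_le_mul_of_nonneg_left (norm_apply_e_apply_le a x x) (hw x)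

/-- The normal state `a ↦ ∑ₓ w x ⟪e x, a (e x)⟫`. -/
def weightState : (Ell2 X →L[ℂ] Ell2 X) →L[ℂ] ℂ :=
  LinearMap.mkContinuous
    { toFun := fun a => ∑' x, (w x : ℂ) * a (e x) x
      map_add' := fun a b => by
        rw [← (summable_weight_diag hw hs a).tsum_add (summable_weight_diag hw hs b)]
        exact tsum_congr fun x => mul_add _ _ _
      map_smul' := fun r a => by
        rw [RingHom.id_apply, smul_eq_mul, ← tsum_mul_left]
        exact tsum_congr fun x => mul_left_comm _ _ _ } 1 fun a => by
    refine (tsum_of_norm_bounded (hs.mul_right ‖a‖) fun x => ?_)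
    rw [norm_mul, Complex.norm_real, Real.norm_of_nonneg (hw x)]
    exact mul_le_mul_of_nonneg_left (norm_apply_e_apply_le a x x) (hw x)

lemma hasSum_weightState (a : Ell2 X →L[ℂ] Ell2 X) :
    HasSum (fun x => (w x : ℂ) * a (e x) x) (weightState hw hs a) :=
  (summable_weight_diag hw hs a).hasSum

lemma norm_weightState_le (a : Ell2 X →L[ℂ] Ell2 X) : ‖weightState hw hs a‖ ≤ ‖a‖ := by
  simpa using (weightState hw hs).le_of_opNorm_le (LinearMap.mkContinuous_norm_le _ zero_le_one _) a

lemma weightState_one : weightState hw hs 1 = 1 := by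
  refine (hasSum_weightState hw hs 1).unique ?_
  have := Complex.hasSum_ofReal.2 hs
  rw [Complex.ofReal_one] at this
  refine this.congr_fun fun x => ?_
  simp [e_apply_self]

lemma weightState_star_mul_self (a : Ell2 X →L[ℂ] Ell2 X) :
    0 ≤ weightState hw hs (star a * a) := by
  refine (hasSum_weightState hw hs _).nonneg fun x => mul_nonneg (by simpa using hw x) ?_
  rw [← inner_e, mul_apply_eq_comp, ContinuousLinearMap.star_eq_adjoint,
    ContinuousLinearMap.adjoint_inner_right, inner_self_eq_norm_sq_to_K]
  rw [← RCLike.ofReal_pow]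
  exact Complex.zero_le_real.2 (sq_nonneg _)

lemma isCStarState_weightState : IsCStarState (weightState hw hs) :=
  ⟨weightState_one hw hs, weightState_star_mul_self hw hs⟩

/-- The diagonal Gibbs state satisfies the KMS condition. -/
lemma isStripPair_weightState {β : ℝ} (hβ : β ≠ 0) (h : X → ℝ)
    (hh : ∀ x y, w y = w x * Real.exp (-(β * (h y - h x)))) (a b : Ell2 X →L[ℂ] Ell2 X) :
    IsStripPair β (fun t => weightState hw hs (a * conj h t b))
      (fun t => weightState hw hs (conj h t b * a)) := by
  -- In matrix entries, the state of a α^t(b) is the sum of w x · a_xy · b_yx · exp(i(h y - h x)t).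
  -- Each term extends to an entire exponential, and by `hh` its value on the line Im z = β has w y
  -- in place of w x.
  let f : X × X → ℝ → ℂ := fun j t =>
    (w j.1 * (a (e j.2) j.1 * b (e j.1) j.2)) * Complex.exp (Complex.I * (h j.2 - h j.1 : ℝ) * t)
  let g : X × X → ℝ → ℂ := fun j t =>
    (w j.2 * (a (e j.2) j.1 * b (e j.1) j.2)) * Complex.exp (Complex.I * (h j.2 - h j.1 : ℝ) * t)
  -- One summable bound has to serve both boundary lines, hence the two summands.
  let u : X × X → ℝ := fun j => w j.1 * (‖a (e j.2) j.1‖ * ‖b (e j.1) j.2‖) +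
    w j.2 * (‖a (e j.2) j.1‖ * ‖b (e j.1) j.2‖)
  have hu : Summable u := by
    refine (summable_matrix_mul hw hs.summable a b).add ?_
    have := (Equiv.prodComm X X).summable_iff.2 (summable_matrix_mul hw hs.summable b a)
    refine this.congr fun j => ?_
    simp [mul_comm ‖b _ _‖]
  have hexp : ∀ (l t : ℝ), ‖Complex.exp (Complex.I * l * t)‖ = 1 := fun l t => by
    rw [norm_exp_mul_I]; simp
  have hf : ∀ j t, ‖f j t‖ = w j.1 * (‖a (e j.2) j.1‖ * ‖b (e j.1) j.2‖) := fun j t => by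
    simp only [f, norm_mul, hexp, Complex.norm_real, Real.norm_of_nonneg (hw _), mul_one]
  have hg : ∀ j t, ‖g j t‖ = w j.2 * (‖a (e j.2) j.1‖ * ‖b (e j.1) j.2‖) := fun j t => by
    simp only [g, norm_mul, hexp, Complex.norm_real, Real.norm_of_nonneg (hw _), mul_one]
  have hfu : ∀ j t, ‖f j t‖ ≤ u j := fun j t => by
    rw [hf]
    exact le_add_of_nonneg_right (mul_nonneg (hw _) (by positivity))
  have hgu : ∀ j t, ‖g j t‖ ≤ u j := fun j t => by
    rw [hg]
    exact le_add_of_nonneg_left (mul_nonneg (hw _) (by positivity))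
  have hfg : ∀ j, IsStripPair β (f j) (g j) := fun j => by
    convert IsStripPair.exp β (w j.1 * (a (e j.2) j.1 * b (e j.1) j.2)) (h j.2 - h j.1) using 2
      with t
    simp only [g]
    rw [hh j.1 j.2]
    push_cast
    ring
  convert IsStripPair.tsum hβ hu hfg hfu hgu using 2 with t t
  · refine (hasSum_weightState hw hs _).unique ?_
    refine (Summable.of_norm_bounded hu fun j => hfu j t).hasSum.prod_fiberwise fun x => ?_
    refine ((hasSum_matrix_mul a (conj h t b) x).mul_left (w x : ℂ)).congr_fun fun y => ?_
    simp only [f]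
    rw [conj_apply_e]
    ring
  · refine (hasSum_weightState hw hs _).unique ?_
    -- In the reversed product the outer index of the diagonal sum is the second coordinate.
    have h1 := (Equiv.prodComm X X).hasSum_iff.2
      (Summable.of_norm_bounded hu fun j => hgu j t).hasSum
    refine h1.prod_fiberwise fun x => ?_
    refine ((hasSum_matrix_mul (conj h t b) a x).mul_left (w x : ℂ)).congr_fun fun y => ?_
    simp only [g, Function.comp_apply, Equiv.prodComm_apply, Prod.fst_swap, Prod.snd_swap]
    rw [conj_apply_e]
    ring

/-- A normal functional that satisfies the Gibbs condition on the matrix units is a multiple of the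
diagonal Gibbs state. -/
lemma eq_weightState_of_gibbs (hpos : ∀ x, 0 < w x) (τ : (Ell2 X →L[ℂ] Ell2 X) →ₗ[ℂ] ℂ)
    (hG : ∀ x y a, τ (E x y * a) = (w x / w y : ℝ) * τ (a * E x y))
    (hN : ∀ a, HasSum (fun x => τ (a * E x x)) (τ a)) (a : Ell2 X →L[ℂ] Ell2 X) :
    τ a = τ 1 * weightState hw hs a := by
  have hne : ∀ x, (w x : ℂ) ≠ 0 := fun x => by exact_mod_cast (hpos x).ne'
  obtain ⟨x₀⟩ : Nonempty X := by
    by_contra hX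
    rw [not_nonempty_iff] at hX
    exact zero_ne_one (hasSum_empty.unique hs)
  -- The Gibbs relation with x = y moves `E x x` around, so a is compressed to its diagonal entry.
  have h1 : ∀ a x, τ (a * E x x) = a (e x) x * τ (E x x) := fun a x => by
    have h2 := hG x x (a * E x x)
    rw [div_self (hpos x).ne', Complex.ofReal_one, one_mul, mul_assoc a, E_mul_E, ← mul_assoc,
      E_mul_mul_E, map_smul, smul_eq_mul] at h2
    exact h2.symm
  -- Factor `E x x` through x₀ and exchange the two factors.
  have h2 : ∀ x, τ (E x x) = w x * (τ (E x₀ x₀) / w x₀) := fun x => by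
    have h3 := hG x x₀ (E x₀ x)
    rw [E_mul_E, E_mul_E] at h3
    rw [h3]
    push_cast
    ring
  have h3 : ∀ a, τ a = (τ (E x₀ x₀) / w x₀) * weightState hw hs a := fun a => by
    refine (hN a).unique ?_
    refine ((hasSum_weightState hw hs a).mul_left (τ (E x₀ x₀) / w x₀)).congr_fun fun x => ?_
    rw [h1, h2]
    ring
  rw [h3 a, h3 1, weightState_one, mul_one]

end WeightState

end Ell2

/-! ### Homomorphisms and functionals induced on the inductive limit -/

namespace CStarLimit

variable {B : ℕ → Type*} [∀ n, CStarAlgebra (B n)] {f : ∀ n, B n →⋆ₐ[ℂ] B (n + 1)}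

lemma exists_ι_eq_mk (a : Pre f) : ∃ n b, ι f n b = mk a := by
  obtain ⟨N, hN⟩ := a.2
  exact ⟨N, a.seq N, mk_eq_of_coherent N (seqFrom_self N _) (fun _ hk => seqFrom_succ hk _) hN⟩

/-- A closed property holds on the limit if it holds on all algebras of the system. -/
lemma ι_induction {p : CStarLimit f → Prop} (hc : IsClosed {x | p x})
    (h : ∀ n b, p (ι f n b)) (x : CStarLimit f) : p x := by
  refine mk_induction hc (fun a => ?_) x
  obtain ⟨n, b, hb⟩ := exists_ι_eq_mk a
  rw [← hb]
  exact h n b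

lemma exists_ι_of_le {n k : ℕ} (hnk : n ≤ k) (a : B n) : ∃ b, ι f k b = ι f n a := by
  induction k, hnk using Nat.le_induction with
  | base => exact ⟨a, rfl⟩
  | succ k hk ih =>
    obtain ⟨b, hb⟩ := ih
    exact ⟨f k b, by rw [ι_succ, hb]⟩

section Map

variable (g : ∀ n, B n →⋆ₐ[ℂ] B n) (hg : ∀ n a, g (n + 1) (f n a) = f n (g n a))

/-- The map induced by a compatible family of `*`-homomorphisms on eventually coherent
sequences. -/
def preMap : Pre f →ₗ[ℂ] Pre f where
  toFun a := ⟨fun n => g n (a.seq n), by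
    obtain ⟨N, hN⟩ := a.2
    exact ⟨N, fun n hn => by
      beta_reduce
      rw [← hg, ← show a.seq (n + 1) = f n (a.seq n) from hN n hn]⟩⟩
  map_add' a b := Subtype.ext (funext fun n => map_add (g n) (a.seq n) (b.seq n))
  map_smul' r a := Subtype.ext (funext fun n => map_smul (g n) r (a.seq n))

lemma preMap_seq (a : Pre f) (n : ℕ) : (preMap g hg a).seq n = g n (a.seq n) := rfl

lemma norm_preMap_le (a : Pre f) : ‖preMap g hg a‖ ≤ ‖a‖ :=
  le_of_tendsto_of_tendsto' (preMap g hg a).tendsto_nrm a.tendsto_nrm fun n =>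
    NonUnitalStarAlgHom.norm_apply_le (g n) _

lemma uniformContinuous_preMap : UniformContinuous (preMap g hg) :=
  (AddMonoidHomClass.lipschitz_of_bound (preMap g hg) 1
    fun a => by simpa using norm_preMap_le g hg a).uniformContinuous

/-- The underlying function of the map induced on the limit. -/
def mapFun : CStarLimit f → CStarLimit f :=
  (Completion.map (preMap g hg) : Completion (Pre f) → Completion (Pre f))

lemma mapFun_mk (a : Pre f) : mapFun g hg (mk a) = mk (preMap g hg a) :=
  Completion.map_coe (uniformContinuous_preMap g hg) a

lemma continuous_mapFun : Continuous (mapFun g hg) := Completion.continuous_map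

lemma mapFun_ι (n : ℕ) (a : B n) : mapFun g hg (ι f n a) = ι f n (g n a) := by
  change mapFun g hg (mk (seqFrom f n a)) = mk (seqFrom f n (g n a))
  rw [mapFun_mk]
  refine mk_eq_of_coherent n ?_ (fun k hk => ?_) fun _ hk => seqFrom_succ hk _
  · rw [preMap_seq, seqFrom_self, seqFrom_self]
  · rw [preMap_seq, preMap_seq, seqFrom_succ hk, hg]

/-- The `*`-homomorphism of the limit induced by a compatible family of `*`-homomorphisms. -/
def map : CStarLimit f →⋆ₐ[ℂ] CStarLimit f where
  toFun := mapFun g hg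
  map_one' := by rw [← map_one (ι f 0), mapFun_ι, map_one]
  map_zero' := by rw [← map_zero (ι f 0), mapFun_ι, map_zero]
  commutes' r := by
    rw [← AlgHomClass.commutes (ι f 0) r, mapFun_ι, AlgHomClass.commutes]
  map_add' x y := by
    have := continuous_mapFun g hg
    revert y
    refine mk_induction (isClosed_eq (by fun_prop) (by fun_prop)) fun b => ?_
    revert x
    refine mk_induction (isClosed_eq (by fun_prop) (by fun_prop)) fun a => ?_
    rw [← mk_add, mapFun_mk, mapFun_mk, mapFun_mk, ← mk_add, map_add]
  map_mul' x y := by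
    have := continuous_mapFun g hg
    revert y
    refine mk_induction (isClosed_eq (by fun_prop) (by fun_prop)) fun b => ?_
    revert x
    refine mk_induction (isClosed_eq (by fun_prop) (by fun_prop)) fun a => ?_
    rw [← mk_mul, mapFun_mk, mapFun_mk, mapFun_mk, ← mk_mul]
    congr 1
    exact Subtype.ext (funext fun n => map_mul (g n) (a.seq n) (b.seq n))
  map_star' x := by
    have := continuous_mapFun g hg
    revert x
    refine mk_induction (isClosed_eq (by fun_prop) (by fun_prop)) fun a => ?_
    rw [star_mk, mapFun_mk, mapFun_mk, star_mk]
    congr 1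
    exact Subtype.ext (funext fun n => map_star (g n) (a.seq n))

lemma map_ι (n : ℕ) (a : B n) : map g hg (ι f n a) = ι f n (g n a) := mapFun_ι g hg n a

lemma continuous_map : Continuous (map g hg) := continuous_mapFun g hg

end Map

section Functional

variable (φ : ∀ n, B n →ₗ[ℂ] ℂ) (hφ : ∀ n a, φ (n + 1) (f n a) = φ n a)
  (hn : ∀ n a, ‖φ n a‖ ≤ ‖a‖)

include hφ in
lemma tendsto_functional (a : Pre f) :
    Tendsto (fun n => φ n (a.seq n)) atTop (𝓝 (limUnder atTop fun n => φ n (a.seq n))) := by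
  obtain ⟨N, hN⟩ := a.2
  refine tendsto_nhds_limUnder ⟨φ N (a.seq N), tendsto_const_nhds.congr'
    (eventually_atTop.2 ⟨N, fun n hn => ?_⟩)⟩
  induction n, hn using Nat.le_induction with
  | base => rfl
  | succ n hn ih => rw [ih, show a.seq (n + 1) = f n (a.seq n) from hN n hn, hφ]

/-- The functional induced by a compatible family of functionals on eventually coherent
sequences. -/
def preFunctional : Pre f →ₗ[ℂ] ℂ where
  toFun a := limUnder atTop fun n => φ n (a.seq n)
  map_add' a b := tendsto_nhds_unique (tendsto_functional φ hφ (a + b)) <|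
    ((tendsto_functional φ hφ a).add (tendsto_functional φ hφ b)).congr fun n =>
      (map_add (φ n) _ _).symm
  map_smul' r a := tendsto_nhds_unique (tendsto_functional φ hφ (r • a)) <|
    ((tendsto_functional φ hφ a).const_mul r).congr fun n => (map_smul (φ n) r _).symm

include hn in
lemma norm_preFunctional_le (a : Pre f) : ‖preFunctional φ hφ a‖ ≤ ‖a‖ :=
  le_of_tendsto_of_tendsto' (tendsto_functional φ hφ a).norm a.tendsto_nrm fun n => hn n _

/-- The underlying function of the functional induced on the limit. -/
def functionalFun : CStarLimit f → ℂ :=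
  (Completion.extension (preFunctional φ hφ) : Completion (Pre f) → ℂ)

include hn in
lemma functionalFun_mk (a : Pre f) : functionalFun φ hφ (mk a) = preFunctional φ hφ a :=
  Completion.extension_coe (AddMonoidHomClass.lipschitz_of_bound (preFunctional φ hφ) 1
    fun a => by simpa using norm_preFunctional_le φ hφ hn a).uniformContinuous a

lemma continuous_functionalFun : Continuous (functionalFun φ hφ) := Completion.continuous_extension

include hn in
lemma norm_functionalFun_le (x : CStarLimit f) : ‖functionalFun φ hφ x‖ ≤ ‖x‖ := by
  have := continuous_functionalFun φ hφ
  revert x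
  refine mk_induction (isClosed_le this.norm continuous_norm) fun a => ?_
  rw [functionalFun_mk _ _ hn, norm_mk]
  exact norm_preFunctional_le φ hφ hn a

/-- The underlying linear map of the functional induced on the limit. -/
def functionalLin : CStarLimit f →ₗ[ℂ] ℂ where
  toFun := functionalFun φ hφ
  map_add' x y := by
    have := continuous_functionalFun φ hφ
    revert y
    refine mk_induction (isClosed_eq (by fun_prop) (by fun_prop)) fun b => ?_
    revert x
    refine mk_induction (isClosed_eq (by fun_prop) (by fun_prop)) fun a => ?_
    rw [← mk_add, functionalFun_mk _ _ hn, functionalFun_mk _ _ hn, functionalFun_mk _ _ hn,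
      map_add]
  map_smul' r x := by
    have := continuous_functionalFun φ hφ
    have h1 : Continuous fun x : CStarLimit f => r • x := by
      simp_rw [Algebra.smul_def]
      fun_prop
    revert x
    refine mk_induction (isClosed_eq (this.comp h1) (this.const_smul r)) fun a => ?_
    rw [← mk_smul, functionalFun_mk _ _ hn, functionalFun_mk _ _ hn, map_smul, RingHom.id_apply]

/-- The functional on the limit induced by a compatible family of contractive functionals. -/
def functional : CStarLimit f →L[ℂ] ℂ :=
  (functionalLin φ hφ hn).mkContinuous 1 fun x => by
    rw [one_mul]
    exact norm_functionalFun_le φ hφ hn x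

lemma functional_ι (n : ℕ) (a : B n) : functional φ hφ hn (ι f n a) = φ n a := by
  change functionalFun φ hφ (mk (seqFrom f n a)) = _
  rw [functionalFun_mk _ _ hn]
  refine tendsto_nhds_unique (tendsto_functional φ hφ _) (tendsto_const_nhds.congr'
    (eventually_atTop.2 ⟨n, fun k hk => ?_⟩))
  induction k, hk using Nat.le_induction with
  | base => beta_reduce; rw [seqFrom_self]
  | succ k hk ih => rw [ih]; beta_reduce; rw [seqFrom_succ hk, hφ]

lemma norm_functional_le (x : CStarLimit f) : ‖functional φ hφ hn x‖ ≤ ‖x‖ := by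
  simpa using (functional φ hφ hn).le_of_opNorm_le (LinearMap.mkContinuous_norm_le _ zero_le_one _) x

end Functional

lemma functional_ext {ω ω' : CStarLimit f →L[ℂ] ℂ} (h : ∀ n a, ω (ι f n a) = ω' (ι f n a)) :
    ω = ω' :=
  ContinuousLinearMap.ext fun x =>
    ι_induction (isClosed_eq ω.continuous ω'.continuous) h x

end CStarLimit

/-! ### Probability weights on paths -/

lemma hasSum_sigma_of_nonneg {ι : Type*} {γ : ι → Type*} {f : (Σ i, γ i) → ℝ} {g : ι → ℝ} {a : ℝ}
    (hf : ∀ x, 0 ≤ f x) (h : ∀ i, HasSum (fun c => f ⟨i, c⟩) (g i)) (hg : HasSum g a) :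
    HasSum f a := by
  refine HasSum.sigma_of_hasSum hg h ?_
  rw [summable_sigma_of_nonneg hf]
  refine ⟨fun i => (h i).summable, ?_⟩
  simpa only [(h _).tsum_eq] using hg.summable

/-- A strictly positive probability weight on `{k : ℕ | k < M}`. -/
def idxWeight (M : ℕ∞) (k : ℕ) : ℝ := if M = ⊤ then (1 / 2) ^ (k + 1) else (M.toNat : ℝ)⁻¹

lemma idxWeight_pos {M : ℕ∞} (hM : 1 ≤ M) (k : ℕ) : 0 < idxWeight M k := by
  rw [idxWeight]
  split_ifs with h
  · positivity
  · have : 0 < M.toNat := by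
      rw [Nat.pos_iff_ne_zero, Ne, ENat.toNat_eq_zero]
      rintro (h' | h')
      · simp [h'] at hM
      · exact h h'
    positivity

/-- A geometric series for M = ∞, uniform weights otherwise. Any strictly positive weights of total
mass one would do. -/
lemma hasSum_idxWeight {M : ℕ∞} (hM : 1 ≤ M) :
    HasSum (fun k : {k : ℕ // (k : ℕ∞) < M} => idxWeight M k) 1 := by
  induction M using ENat.recTopCoe with
  | top =>
    have h : (fun k : {k : ℕ // (k : ℕ∞) < ⊤} => idxWeight ⊤ k) =
        (fun k : ℕ => ((1 : ℝ) / 2) ^ (k + 1)) ∘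
          (Equiv.subtypeUnivEquiv (p := fun k : ℕ => (k : ℕ∞) < ⊤) fun k => ENat.natCast_lt_top k) := by
      ext k
      simp [idxWeight]
    rw [h, Equiv.hasSum_iff]
    simpa [pow_succ, div_eq_mul_inv] using hasSum_geometric_two.mul_right (1 / 2 : ℝ)
  | coe M =>
    have hM' : (M : ℝ) ≠ 0 := by
      have : 1 ≤ M := by exact_mod_cast hM
      exact_mod_cast (by omega : M ≠ 0)
    let s := {k : ℕ // (k : ℕ∞) < (M : ℕ∞)}
    let e : Fin M ≃ s :=
      { toFun := fun i => ⟨i, by exact_mod_cast i.2⟩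
        invFun := fun k => ⟨k.1, by exact_mod_cast k.2⟩
        left_inv := fun _ => rfl
        right_inv := fun _ => rfl }
    rw [← e.hasSum_iff]
    have h1 : (fun k : s => idxWeight M k) ∘ e = fun _ => (M : ℝ)⁻¹ := by
      ext k
      simp [idxWeight]
    rw [h1]
    convert hasSum_fintype (fun _ : Fin M => (M : ℝ)⁻¹)
    simp [hM']

namespace GradedGraph.Multiplicity

variable {G : GradedGraph.{u, v}} (m : G.Multiplicity) (κ : ∀ n, G.E n → ℝ)

/-- The weight of a direct summand: the value of the link, distributed among the copies of the
edge. -/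
def summandWeight {n : ℕ} {z : G.V (n + 1)} (c : m.Summand z) : ℝ :=
  κ n c.1.1 * idxWeight (m.toFun c.1.1) c.2.1

/-- The weight of a path. -/
def pathWeight : ∀ {n} (z : G.V n), m.Path z → ℝ
  | 0, _, _ => 1
  | _ + 1, _, ⟨c, p⟩ => summandWeight m κ c * pathWeight (G.s c.1.1) p

lemma pathWeight_succ {n : ℕ} (z : G.V (n + 1)) (c : m.Summand z) (p : m.Path (G.s c.1.1)) :
    pathWeight m κ z ⟨c, p⟩ = summandWeight m κ c * pathWeight m κ (G.s c.1.1) p := rfl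

variable {κ}

lemma summandWeight_pos (hpos : ∀ n e, 0 < κ n e) {n : ℕ} {z : G.V (n + 1)} (c : m.Summand z) :
    0 < summandWeight m κ c := mul_pos (hpos _ _) (idxWeight_pos (m.pos _) _)

lemma pathWeight_pos (hpos : ∀ n e, 0 < κ n e) : ∀ {n} (z : G.V n) (p : m.Path z),
    0 < pathWeight m κ z p
  | 0, _, _ => one_pos
  | _ + 1, _, ⟨c, p⟩ => mul_pos (summandWeight_pos m hpos c) (pathWeight_pos hpos (G.s c.1.1) p)

/-- Together the copies of an edge carry exactly κ(e); this is why the link of the flow does not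
depend on the multiplicities. -/
lemma hasSum_idx {n : ℕ} {z : G.V (n + 1)} (e : {e : G.E n // G.r e = z}) :
    HasSum (fun k : m.Idx e.1 => summandWeight m κ ⟨e, k⟩) (κ n e.1) := by
  have h := (hasSum_idxWeight (m.pos e.1)).mul_left (κ n e.1)
  rw [mul_one] at h
  exact h

lemma hasSum_summandWeight (hκ : G.IsLink κ) (hpos : ∀ n e, 0 < κ n e) {n : ℕ} (z : G.V (n + 1)) :
    HasSum (fun c : m.Summand z => summandWeight m κ c) 1 :=
  hasSum_sigma_of_nonneg (fun c => (summandWeight_pos m hpos c).le) (hasSum_idx m) (hκ.hasSum n z)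

/-- Induction on the level, splitting off the last edge and its copy index. Since the total is one,
the Gibbs states need no normalizing constant. -/
lemma hasSum_pathWeight (hκ : G.IsLink κ) (hpos : ∀ n e, 0 < κ n e) : ∀ {n} (z : G.V n),
    HasSum (pathWeight m κ z) 1
  | 0, _ => by
    have h : HasSum (fun _ : PUnit.{v + 1} => (1 : ℝ)) 1 := by
      simp
    exact h
  | n + 1, z => by
    refine hasSum_sigma_of_nonneg (γ := fun c : m.Summand z => m.Path (G.s c.1.1))
      (g := fun c => summandWeight m κ c)
      (fun x => (pathWeight_pos m hpos z x).le) (fun c => ?_) (hasSum_summandWeight m hκ hpos z)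
    have h := (hasSum_pathWeight hκ hpos (G.s c.1.1)).mul_left (summandWeight m κ c)
    rw [mul_one] at h
    exact h

/-! ### The inductive flow of a link -/

variable (κ) (β : ℝ)

/-- The diagonal of the generator of the flow on `B(H_z)`. -/
def ham {n : ℕ} (z : G.V n) (p : m.Path z) : ℝ := -Real.log (pathWeight m κ z p) / β

/-- The logarithm turns multiplicativity of the weights into additivity: on the summand c the
generator is that of the source vertex plus a constant. -/
lemma ham_succ (hpos : ∀ n e, 0 < κ n e) {n : ℕ} (z : G.V (n + 1)) (c : m.Summand z)
    (p : m.Path (G.s c.1.1)) : ham m κ β z ⟨c, p⟩ =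
      -Real.log (summandWeight m κ c) / β + ham m κ β (G.s c.1.1) p := by
  unfold ham
  rw [pathWeight_succ, Real.log_mul (summandWeight_pos m hpos c).ne'
    (pathWeight_pos m hpos _ p).ne']
  ring

/-- Dividing by β in `ham` makes the path weights the Boltzmann factors at inverse temperature β,
for either sign of β. -/
lemma pathWeight_eq_exp (hpos : ∀ n e, 0 < κ n e) {β : ℝ} (hβ : β ≠ 0) {n : ℕ} (z : G.V n)
    (p q : m.Path z) : Real.exp (-(β * (ham m κ β z q - ham m κ β z p))) =
      pathWeight m κ z q / pathWeight m κ z p := by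
  unfold ham
  have : -(β * (-Real.log (pathWeight m κ z q) / β - -Real.log (pathWeight m κ z p) / β)) =
      Real.log (pathWeight m κ z q) - Real.log (pathWeight m κ z p) := by
    field_simp
    ring
  rw [this, Real.exp_sub, Real.exp_log (pathWeight_pos m hpos z q),
    Real.exp_log (pathWeight_pos m hpos z p)]

/-- The unitary group implementing the flow on `A_n`. -/
def unitaryGroup (n : ℕ) (t : ℝ) : m.Alg n :=
  ⟨fun z => Ell2.phase (ham m κ β z) t,
    memℓp_infty ⟨1, by rintro _ ⟨z, rfl⟩; exact Ell2.norm_phase_op_le _ t⟩⟩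

lemma comp_unitaryGroup {n : ℕ} (t : ℝ) (z : G.V n) :
    comp (unitaryGroup m κ β n t) z = Ell2.phase (ham m κ β z) t := rfl

lemma unitaryGroup_zero (n : ℕ) : unitaryGroup m κ β n 0 = 1 :=
  ext_comp fun z => by rw [comp_unitaryGroup, Ell2.phase_zero, comp_one]

lemma unitaryGroup_mul (n : ℕ) (s t : ℝ) :
    unitaryGroup m κ β n s * unitaryGroup m κ β n t = unitaryGroup m κ β n (s + t) :=
  ext_comp fun z => by
    rw [comp_mul, comp_unitaryGroup, comp_unitaryGroup, comp_unitaryGroup, Ell2.phase_mul]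

lemma unitaryGroup_neg_mul (n : ℕ) (t : ℝ) :
    unitaryGroup m κ β n (-t) * unitaryGroup m κ β n t = 1 := by
  rw [unitaryGroup_mul, neg_add_cancel, unitaryGroup_zero]

lemma unitaryGroup_mul_neg (n : ℕ) (t : ℝ) :
    unitaryGroup m κ β n t * unitaryGroup m κ β n (-t) = 1 := by
  rw [unitaryGroup_mul, add_neg_cancel, unitaryGroup_zero]

lemma star_unitaryGroup (n : ℕ) (t : ℝ) :
    star (unitaryGroup m κ β n t) = unitaryGroup m κ β n (-t) :=
  ext_comp fun z => by
    rw [comp_star, comp_unitaryGroup, comp_unitaryGroup, Ell2.star_phase]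

/-- The flow on `A_n`. -/
def algFlow (n : ℕ) (t : ℝ) : m.Alg n →⋆ₐ[ℂ] m.Alg n where
  toFun a := unitaryGroup m κ β n t * a * unitaryGroup m κ β n (-t)
  map_one' := by rw [mul_one, unitaryGroup_mul_neg]
  map_mul' a b := by
    rw [mul_assoc (_ * a), mul_assoc (unitaryGroup m κ β n t) b, ← mul_assoc (unitaryGroup m κ β n (-t)),
      unitaryGroup_neg_mul, one_mul]
    simp only [mul_assoc]
  map_zero' := by rw [mul_zero, zero_mul]
  map_add' a b := by rw [mul_add, add_mul]
  commutes' r := by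
    rw [← Algebra.commutes, mul_assoc, unitaryGroup_mul_neg, mul_one]
  map_star' a := by
    rw [star_mul, star_mul, star_unitaryGroup, star_unitaryGroup, neg_neg, mul_assoc]

lemma comp_algFlow {n : ℕ} (t : ℝ) (a : m.Alg n) (z : G.V n) :
    comp (algFlow m κ β n t a) z = Ell2.conj (ham m κ β z) t (comp a z) := rfl

lemma algFlow_zero (n : ℕ) (a : m.Alg n) : algFlow m κ β n 0 a = a := by
  change unitaryGroup m κ β n 0 * a * unitaryGroup m κ β n (-0) = a
  rw [neg_zero, unitaryGroup_zero, one_mul, mul_one]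

lemma algFlow_add (n : ℕ) (s t : ℝ) (a : m.Alg n) :
    algFlow m κ β n (s + t) a = algFlow m κ β n s (algFlow m κ β n t a) := by
  change unitaryGroup m κ β n (s + t) * a * unitaryGroup m κ β n (-(s + t)) =
    unitaryGroup m κ β n s * (unitaryGroup m κ β n t * a * unitaryGroup m κ β n (-t)) *
      unitaryGroup m κ β n (-s)
  rw [← unitaryGroup_mul, neg_add_rev, ← unitaryGroup_mul]
  simp only [mul_assoc]

/-- The constant in `ham_succ` contributes a scalar of modulus one on each summand, which disappears
when the unitaries act by conjugation. -/
lemma slice_phase (hpos : ∀ n e, 0 < κ n e) {n : ℕ} (z : G.V (n + 1)) (t : ℝ) (v : m.H z)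
    (c : m.Summand z) : slice (Ell2.phase (ham m κ β z) t v) c =
      Complex.exp (Complex.I * (-Real.log (summandWeight m κ c) / β : ℝ) * t) •
        Ell2.phase (ham m κ β (G.s c.1.1)) t (slice v c) := by
  ext p
  have h1 : slice (Ell2.phase (ham m κ β z) t v) c p =
    Complex.exp (Complex.I * ham m κ β z ⟨c, p⟩ * t) * slice v c p := rfl
  rw [h1, lp.coeFn_smul, Pi.smul_apply, smul_eq_mul, Ell2.phase_apply, ← mul_assoc,
    ← Complex.exp_add, ham_succ m κ β hpos]
  congr 2
  push_cast
  ring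

/-- The flows on the algebras `A_n` are compatible. -/
lemma algFlow_incl (hpos : ∀ n e, 0 < κ n e) (t : ℝ) (n : ℕ) (a : m.Alg n) :
    algFlow m κ β (n + 1) t (m.incl n a) = m.incl n (algFlow m κ β n t a) := by
  refine ext_comp fun z => ext_H fun v c => ?_
  have h1 : comp (m.incl n (algFlow m κ β n t a)) z = inclComp (algFlow m κ β n t a) z := rfl
  have h2 : comp (m.incl n a) z = inclComp a z := rfl
  rw [comp_algFlow, h1, h2, slice_inclComp, comp_algFlow, Ell2.conj, Ell2.conj, mul_apply_eq_comp,
    mul_apply_eq_comp, mul_apply_eq_comp, mul_apply_eq_comp, slice_phase m κ β hpos, slice_inclComp,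
    slice_phase m κ β hpos, map_smul, map_smul, smul_smul, ← Complex.exp_add]
  have h3 : ∀ x : ℂ, x * (t : ℂ) + x * ((-t : ℝ) : ℂ) = 0 := fun x => by push_cast; ring
  rw [h3, Complex.exp_zero, one_smul]

variable (hpos : ∀ n e, 0 < κ n e)

/-- The endomorphisms of the flow on the limit algebra. -/
def flowHom (t : ℝ) : m.Limit →⋆ₐ[ℂ] m.Limit :=
  CStarLimit.map (fun n => algFlow m κ β n t) (algFlow_incl m κ β hpos t)

lemma flowHom_ι (t : ℝ) (n : ℕ) (a : m.Alg n) :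
    flowHom m κ β hpos t (m.ι n a) = m.ι n (algFlow m κ β n t a) := CStarLimit.map_ι _ _ n a

lemma continuous_flowHom (t : ℝ) : Continuous (flowHom m κ β hpos t) :=
  CStarLimit.continuous_map _ _

lemma flowHom_zero (x : m.Limit) : flowHom m κ β hpos 0 x = x :=
  CStarLimit.ι_induction (isClosed_eq (continuous_flowHom m κ β hpos 0) continuous_id)
    (fun n b => by rw [flowHom_ι, algFlow_zero]; rfl) x

lemma flowHom_add (s t : ℝ) (x : m.Limit) : flowHom m κ β hpos (s + t) x =
    flowHom m κ β hpos s (flowHom m κ β hpos t x) :=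
  CStarLimit.ι_induction (isClosed_eq (continuous_flowHom m κ β hpos (s + t))
    ((continuous_flowHom m κ β hpos s).comp (continuous_flowHom m κ β hpos t)))
    (fun n b => by
      rw [flowHom_ι, algFlow_add, Function.comp_apply, flowHom_ι, flowHom_ι]) x

/-- The inductive flow of the link `κ` on the limit algebra. -/
def flow : m.InductiveFlow where
  toFun t := StarAlgEquiv.ofStarAlgHom (flowHom m κ β hpos t) (flowHom m κ β hpos (-t))
    (StarAlgHom.ext fun x => by
      change flowHom m κ β hpos (-t) (flowHom m κ β hpos t x) = x
      rw [← flowHom_add, neg_add_cancel, flowHom_zero])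
    (StarAlgHom.ext fun x => by
      change flowHom m κ β hpos t (flowHom m κ β hpos (-t) x) = x
      rw [← flowHom_add, add_neg_cancel, flowHom_zero])
  map_zero := flowHom_zero m κ β hpos
  map_add := flowHom_add m κ β hpos
  map_range t n := by
    ext x
    constructor
    · rintro ⟨_, ⟨a, rfl⟩, rfl⟩
      exact ⟨algFlow m κ β n t a, (flowHom_ι m κ β hpos t n a).symm⟩
    · rintro ⟨a, rfl⟩
      refine ⟨_, ⟨algFlow m κ β n (-t) a, rfl⟩, (flowHom_ι m κ β hpos t n _).trans ?_⟩
      rw [← algFlow_add, add_neg_cancel, algFlow_zero]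

lemma flow_ι (t : ℝ) (n : ℕ) (a : m.Alg n) :
    (flow m κ β hpos).toFun t (m.ι n a) = m.ι n (algFlow m κ β n t a) :=
  flowHom_ι m κ β hpos t n a

/-- `loc` is a chosen preimage under `ι`; injectivity of `ι` leaves no choice. -/
lemma flow_loc (n : ℕ) (t : ℝ) (a : m.Alg n) :
    (flow m κ β hpos).loc n t a = algFlow m κ β n t a :=
  m.ι_injective n (by rw [InductiveFlow.ι_loc, flow_ι])

lemma comp_corner_self {m : G.Multiplicity} {n : ℕ} (z : G.V n) (x : m.H z →L[ℂ] m.H z) : comp (corner z x) z = x :=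
  by
  classical
  exact lp.single_apply_self (E := fun z : G.V n => m.H z →L[ℂ] m.H z) _ z x

lemma comp_corner_ne {m : G.Multiplicity} {n : ℕ} {z z' : G.V n} (h : z' ≠ z) (x : m.H z →L[ℂ] m.H z) :
    comp (corner z x) z' = 0 :=
  by
  classical
  exact lp.single_apply_ne (E := fun z : G.V n => m.H z →L[ℂ] m.H z) _ z x h

lemma flow_locVertex {n : ℕ} (z : G.V n) (t : ℝ) (x : m.H z →L[ℂ] m.H z) :
    (flow m κ β hpos).locVertex z t x = Ell2.conj (ham m κ β z) t x := by
  unfold InductiveFlow.locVertex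
  rw [flow_loc, comp_algFlow, comp_corner_self]

lemma norm_flow (t : ℝ) (x : m.Limit) : ‖(flow m κ β hpos).toFun t x‖ = ‖x‖ :=
  NonUnitalStarAlgHom.norm_map (flowHom m κ β hpos t) ((flow m κ β hpos).toFun t).injective x

end GradedGraph.Multiplicity

/-! ### Continuity of the flow -/

namespace Ell2

variable {X J : Type*}

/-- Strong continuity and the bound `‖phase h t‖ ≤ 1` give joint continuity. It is needed because in
`conj h t a v` the outer unitary acts on a vector that also moves with t. -/
lemma tendsto_phase (h : X → ℝ) {l : Filter J} {τ : J → ℝ} {t₀ : ℝ} {v : J → Ell2 X} {v₀ : Ell2 X}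
    (hτ : Tendsto τ l (𝓝 t₀)) (hv : Tendsto v l (𝓝 v₀)) :
    Tendsto (fun j => phase h (τ j) (v j)) l (𝓝 (phase h t₀ v₀)) := by
  have h1 : Tendsto (fun j => phase h (τ j) (v j - v₀)) l (𝓝 0) := by
    refine squeeze_zero_norm (a := fun j => ‖v j - v₀‖) (fun j => ?_) ?_
    · simpa using (phase h (τ j)).le_of_opNorm_le (norm_phase_op_le h _) (v j - v₀)
    · exact tendsto_iff_norm_sub_tendsto_zero.1 hv
  have h2 : Tendsto (fun j => phase h (τ j) v₀) l (𝓝 (phase h t₀ v₀)) :=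
    ((continuous_phase h v₀).tendsto t₀).comp hτ
  have h3 := h1.add h2
  rw [zero_add] at h3
  refine h3.congr fun j => ?_
  rw [← map_add, sub_add_cancel]

lemma continuous_conj_apply (h : X → ℝ) (a : Ell2 X →L[ℂ] Ell2 X) (v : Ell2 X) :
    Continuous fun t => conj h t a v :=
  continuous_iff_continuousAt.2 fun t =>
    tendsto_phase h tendsto_id ((a.continuous.tendsto _).comp
      (tendsto_phase h ((continuous_neg.tendsto t).comp tendsto_id) tendsto_const_nhds))

lemma inner_phase (h : X → ℝ) (t : ℝ) (v w : Ell2 X) :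
    inner ℂ v (phase h t w) = inner ℂ (phase h (-t) v) w := by
  rw [← star_phase, ContinuousLinearMap.star_eq_adjoint, ContinuousLinearMap.adjoint_inner_left]

/-- Moving the unitaries onto v and w leaves a bound that sees a only through its norm. Thus strong
continuity of the unitaries becomes norm continuity on functionals. -/
lemma norm_inner_conj_sub_le (h : X → ℝ) (t : ℝ) (a : Ell2 X →L[ℂ] Ell2 X) (v w : Ell2 X) :
    ‖inner ℂ w (conj h t a v) - inner ℂ w (a v)‖ ≤
      (‖phase h (-t) w - w‖ * ‖v‖ + ‖w‖ * ‖phase h (-t) v - v‖) * ‖a‖ := by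
  have h1 : inner ℂ w (conj h t a v) - inner ℂ w (a v) =
      inner ℂ (phase h (-t) w - w) (a (phase h (-t) v)) +
        inner ℂ w (a (phase h (-t) v - v)) := by
    rw [conj, mul_apply_eq_comp, mul_apply_eq_comp, inner_phase, inner_sub_left, map_sub,
      inner_sub_right]
    ring
  rw [h1, add_mul]
  refine (norm_add_le _ _).trans (add_le_add ?_ ?_)
  · refine (norm_inner_le_norm _ _).trans ?_
    rw [mul_assoc]
    refine mul_le_mul_of_nonneg_left ?_ (norm_nonneg _)
    refine (a.le_opNorm _).trans ?_
    rw [mul_comm]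
    refine mul_le_mul_of_nonneg_right ?_ (norm_nonneg _)
    simpa using (phase h (-t)).le_of_opNorm_le (norm_phase_op_le h _) v
  · refine (norm_inner_le_norm _ _).trans ?_
    rw [mul_assoc]
    refine mul_le_mul_of_nonneg_left ?_ (norm_nonneg _)
    rw [mul_comm]
    exact a.le_opNorm _

lemma norm_phase_sub_le (h : X → ℝ) (t : ℝ) (v : Ell2 X) : ‖phase h t v - v‖ ≤ 2 * ‖v‖ := by
  refine (norm_sub_le _ _).trans ?_
  have := (phase h t).le_of_opNorm_le (norm_phase_op_le h _) v
  linarith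

end Ell2

namespace GradedGraph.Multiplicity

variable {G : GradedGraph.{u, v}} {m : G.Multiplicity}

/-- Normal functionals are continuous along bounded, strongly convergent nets. -/
lemma IsNormal.tendsto {n : ℕ} {ω : m.Alg n → ℂ} (hω : IsNormal ω) {J : Type*} {l : Filter J}
    {y : J → m.Alg n} {y₀ : m.Alg n} (M : ℝ) (hM : ∀ j, ‖y j‖ ≤ M)
    (hy : ∀ z v, Tendsto (fun j => comp (y j) z v) l (𝓝 (comp y₀ z v))) :
    Tendsto (fun j => ω (y j)) l (𝓝 (ω y₀)) := by
  obtain ⟨z, ξ, η, hs, hsum⟩ := hω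
  simp_rw [← (hsum _).tsum_eq]
  refine tendsto_tsum_of_dominated_convergence (hs.mul_left M)
    (fun k => tendsto_const_nhds.inner (hy (z k) (ξ k))) (Eventually.of_forall fun j k => ?_)
  refine (norm_inner_le_norm _ _).trans ?_
  have h1 := (comp (y j) (z k)).le_of_opNorm_le ((norm_comp_le (y j) (z k)).trans (hM j)) (ξ k)
  calc _ ≤ ‖η k‖ * (M * ‖ξ k‖) := mul_le_mul_of_nonneg_left h1 (norm_nonneg _)
    _ = _ := by ring

/-- A normal functional on a corner defines a normal functional on the algebra. -/
lemma IsNormalCorner.isNormal {n : ℕ} {z : G.V n} {τ : (m.H z →L[ℂ] m.H z) → ℂ}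
    (hτ : IsNormalCorner τ) : IsNormal fun a : m.Alg n => τ (comp a z) := by
  obtain ⟨ξ, η, hs, hsum⟩ := hτ
  exact ⟨fun _ => z, ξ, η, hs, fun a => hsum (comp a z)⟩

/-- Absolutely summable families of vector functionals define normal functionals. -/
lemma isNormal_of_hasSum {n : ℕ} {ω : m.Alg n → ℂ} {I : Type*} [Countable I] [Nonempty (G.V n)]
    (z : I → G.V n) (ξ η : ∀ i, m.H (z i)) (hs : Summable fun i => ‖ξ i‖ * ‖η i‖)
    (hsum : ∀ a, HasSum (fun i => inner ℂ (η i) (comp a (z i) (ξ i))) (ω a)) : IsNormal ω := by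
  obtain ⟨f, hf⟩ := exists_injective_nat I
  -- `IsNormal` asks for a family indexed by ℕ: transport along an injection and pad with zero
  -- vectors. Vertex and vectors are bundled because the type of the vectors depends on the vertex.
  let T : ℕ → Σ z : G.V n, m.H z × m.H z :=
    Function.extend f (fun i => ⟨z i, ξ i, η i⟩) fun _ => ⟨Classical.arbitrary _, 0, 0⟩
  have hT : ∀ i, T (f i) = ⟨z i, ξ i, η i⟩ := fun i => hf.extend_apply _ _ i
  have hT' : ∀ k, k ∉ Set.range f → T k = ⟨Classical.arbitrary _, 0, 0⟩ := fun k hk =>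
    Function.extend_apply' _ _ _ hk
  let N : (Σ z : G.V n, m.H z × m.H z) → ℝ := fun s => ‖s.2.1‖ * ‖s.2.2‖
  let P : m.Alg n → (Σ z : G.V n, m.H z × m.H z) → ℂ := fun a s =>
    inner ℂ s.2.2 (comp a s.1 s.2.1)
  refine ⟨fun k => (T k).1, fun k => (T k).2.1, fun k => (T k).2.2, ?_, fun a => ?_⟩
  · refine (hf.summable_iff fun k hk => ?_).1 (hs.congr fun i => (congrArg N (hT i)).symm)
    refine (congrArg N (hT' k hk)).trans ?_
    simp [N]
  · refine (hf.hasSum_iff fun k hk => ?_).1 ((hsum a).congr_fun fun i => congrArg (P a) (hT i))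
    refine (congrArg (P a) (hT' k hk)).trans ?_
    simp [P]

/-- Absolutely summable families of vector functionals define normal functionals on corners. -/
lemma isNormalCorner_of_hasSum {n : ℕ} {z : G.V n} {τ : (m.H z →L[ℂ] m.H z) → ℂ} {I : Type*}
    [Countable I] (ξ η : I → m.H z) (hs : Summable fun i => ‖ξ i‖ * ‖η i‖)
    (hsum : ∀ a, HasSum (fun i => inner ℂ (η i) (a (ξ i))) (τ a)) : IsNormalCorner τ := by
  obtain ⟨f, hf⟩ := exists_injective_nat I
  let T : ℕ → m.H z × m.H z := Function.extend f (fun i => ⟨ξ i, η i⟩) fun _ => ⟨0, 0⟩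
  have hT : ∀ i, T (f i) = ⟨ξ i, η i⟩ := fun i => hf.extend_apply _ _ i
  have hT' : ∀ k, k ∉ Set.range f → T k = ⟨0, 0⟩ := fun k hk => Function.extend_apply' _ _ _ hk
  refine ⟨fun k => (T k).1, fun k => (T k).2, ?_, fun a => ?_⟩
  · refine (hf.summable_iff fun k hk => ?_).1 ?_
    · beta_reduce
      rw [hT' k hk]
      simp
    · refine hs.congr fun i => ?_
      simp only [Function.comp_apply]
      rw [hT]
  · refine (hf.hasSum_iff fun k hk => ?_).1 ?_
    · beta_reduce
      rw [hT' k hk]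
      simp
    · refine (hsum a).congr_fun fun i => ?_
      simp only [Function.comp_apply]
      rw [hT]

variable (m) {κ : ∀ n, G.E n → ℝ} (β : ℝ) (hpos : ∀ n e, 0 < κ n e)

lemma norm_algFlow_le (n : ℕ) (t : ℝ) (a : m.Alg n) : ‖algFlow m κ β n t a‖ ≤ ‖a‖ :=
  NonUnitalStarAlgHom.norm_apply_le (algFlow m κ β n t) a

/-- As the flow is isometric and ω bounded, the elements with continuous orbit function form a norm
closed set. On A_n the orbit is bounded and strongly continuous, and normal functionals respect such
limits. -/
lemma flow_isWeaklyContinuous : (flow m κ β hpos).IsWeaklyContinuous := by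
  intro a ω hω
  refine CStarLimit.ι_induction (p := fun a => Continuous fun t => ω ((flow m κ β hpos).toFun t a))
    (isClosed_of_closure_subset fun x hx => ?_) (fun n b => ?_) a
  · refine continuous_of_uniform_approx_of_continuous fun u hu => ?_
    obtain ⟨ε, hε, hεu⟩ := Metric.mem_uniformity_dist.1 hu
    obtain ⟨y, hy, hxy⟩ := Metric.mem_closure_iff.1 hx (ε / (‖ω‖ + 1)) (by positivity)
    refine ⟨_, hy, fun t => hεu ?_⟩
    rw [dist_eq_norm, ← map_sub, ← map_sub]
    rw [dist_eq_norm, lt_div_iff₀ (by positivity)] at hxy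
    refine (ω.le_opNorm _).trans_lt ?_
    rw [norm_flow]
    nlinarith [norm_nonneg (x - y)]
  · simp_rw [flow_ι]
    exact continuous_iff_continuousAt.2 fun t => (hω n).tendsto ‖b‖
      (fun t => norm_algFlow_le m β n t b)
      fun z v => (Ell2.continuous_conj_apply (ham m κ β z) (comp b z) v).tendsto t

lemma flow_isUContinuous : (flow m κ β hpos).IsUContinuous := by
  rintro n ω ⟨z, ξ, η, hs, hsum⟩ ε hε
  -- The sum over k of `d k t` bounds the norm of ω ∘ α^t - ω. Each term tends to 0, and 4‖ξ k‖‖η k‖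
  -- dominates it, two from each summand, so dominated convergence applies.
  let d : ℕ → ℝ → ℝ := fun k t =>
    ‖Ell2.phase (ham m κ β (z k)) (-t) (η k) - η k‖ * ‖ξ k‖ +
      ‖η k‖ * ‖Ell2.phase (ham m κ β (z k)) (-t) (ξ k) - ξ k‖
  have hd0 : ∀ k t, 0 ≤ d k t := fun k t => by positivity
  have hd : ∀ k t, d k t ≤ 4 * (‖ξ k‖ * ‖η k‖) := fun k t => by
    have h1 := mul_le_mul_of_nonneg_right
      (Ell2.norm_phase_sub_le (ham m κ β (z k)) (-t) (η k)) (norm_nonneg (ξ k))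
    have h2 := mul_le_mul_of_nonneg_left
      (Ell2.norm_phase_sub_le (ham m κ β (z k)) (-t) (ξ k)) (norm_nonneg (η k))
    simp only [d]
    linarith
  have hds : ∀ t, Summable fun k => d k t := fun t =>
    Summable.of_nonneg_of_le (fun k => hd0 k t) (fun k => hd k t) (hs.mul_left 4)
  have hneg : Tendsto (fun t : ℝ => -t) (𝓝 0) (𝓝 0) := by
    simpa using (continuous_neg (G := ℝ)).tendsto 0
  have hph : ∀ k (v : m.H (z k)),
      Tendsto (fun t => ‖Ell2.phase (ham m κ β (z k)) (-t) v - v‖) (𝓝 0) (𝓝 0) := fun k v => by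
    have h1 := Ell2.tendsto_phase (ham m κ β (z k)) hneg (tendsto_const_nhds (x := v))
    rw [Ell2.phase_zero, one_apply_eq_self] at h1
    exact tendsto_iff_norm_sub_tendsto_zero.1 h1
  have hlim : Tendsto (fun t => ∑' k, d k t) (𝓝 0) (𝓝 0) := by
    have h1 := tendsto_tsum_of_dominated_convergence (f := fun t k => d k t) (g := fun _ => (0 : ℝ))
      (hs.mul_left 4) (𝓕 := 𝓝 0) (fun k => ?_) (Eventually.of_forall fun t k => ?_)
    · simpa using h1
    · simpa using ((hph k (η k)).mul_const ‖ξ k‖).add ((hph k (ξ k)).const_mul ‖η k‖)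
    · rw [Real.norm_of_nonneg (hd0 k t)]
      exact hd k t
  filter_upwards [hlim.eventually (gt_mem_nhds hε)] with t ht a
  rw [flow_loc]
  have h1 := (hsum (algFlow m κ β n t a)).sub (hsum a)
  have h2 : ‖ω (algFlow m κ β n t a) - ω a‖ ≤ (∑' k, d k t) * ‖a‖ := by
    rw [← h1.tsum_eq]
    refine tsum_of_norm_bounded ((hds t).hasSum.mul_right ‖a‖) fun k => ?_
    rw [comp_algFlow]
    refine (Ell2.norm_inner_conj_sub_le _ _ _ _ _).trans ?_
    exact mul_le_mul_of_nonneg_left (norm_comp_le a (z k)) (hd0 k t)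
  exact h2.trans (mul_le_mul_of_nonneg_right ht.le (norm_nonneg a))

end GradedGraph.Multiplicity

/-! ### Harmonic functions as a closed subset of a product of ℓ¹-spaces -/

lemma HasSum.of_fibers {α β M : Type*} [AddCommMonoid M] [TopologicalSpace M] [ContinuousAdd M]
    [RegularSpace M] {f : α → M} {g : β → M} {S : M} (r : α → β) (h : HasSum f S)
    (hg : ∀ b, HasSum (fun x : {x // r x = b} => f x) (g b)) : HasSum g S :=
  ((Equiv.sigmaFiberEquiv r).hasSum_iff.2 h).sigma hg

lemma hasSum_of_fibers_of_nonneg {α β : Type*} {f : α → ℝ} {g : β → ℝ} {S : ℝ} (r : α → β)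
    (hf : ∀ x, 0 ≤ f x) (hg : ∀ b, HasSum (fun x : {x // r x = b} => f x) (g b)) (h : HasSum g S) :
    HasSum f S :=
  (Equiv.sigmaFiberEquiv r).hasSum_iff.1
    (hasSum_sigma_of_nonneg (f := f ∘ Equiv.sigmaFiberEquiv r) (fun _ => hf _) hg h)

/-- Scheffé's lemma: pointwise convergence of discrete probability measures implies convergence in
`ℓ¹`. -/
lemma tendsto_tsum_abs_sub {V J : Type*} {l : Filter J} {f : J → V → ℝ} {f₀ : V → ℝ}
    (hf : ∀ j z, 0 ≤ f j z) (hs : ∀ j, HasSum (f j) 1) (hf₀ : ∀ z, 0 ≤ f₀ z) (hs₀ : HasSum f₀ 1)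
    (h : ∀ z, Tendsto (fun j => f j z) l (𝓝 (f₀ z))) :
    Tendsto (fun j => ∑' z, |f j z - f₀ z|) l (𝓝 0) := by
  -- The functions f j need not be dominated, but their minima with f₀ are; and |f - f₀| = f + f₀ -
  -- 2 min(f, f₀), where f and f₀ both have sum one.
  have hmin : ∀ j z, ‖min (f j z) (f₀ z)‖ ≤ f₀ z := fun j z => by
    rw [Real.norm_of_nonneg (le_min (hf j z) (hf₀ z))]
    exact min_le_right _ _
  have h1 : Tendsto (fun j => ∑' z, min (f j z) (f₀ z)) l (𝓝 (∑' z, f₀ z)) := by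
    refine tendsto_tsum_of_dominated_convergence hs₀.summable (fun z => ?_)
      (Eventually.of_forall hmin)
    simpa using (h z).min (tendsto_const_nhds (x := f₀ z))
  have h2 : ∀ j, ∑' z, |f j z - f₀ z| = 2 - 2 * ∑' z, min (f j z) (f₀ z) := fun j => by
    have h3 : Summable fun z => min (f j z) (f₀ z) :=
      Summable.of_norm_bounded hs₀.summable (hmin j)
    have h4 := ((hs j).add hs₀).sub (h3.hasSum.mul_left 2)
    rw [show (2 : ℝ) = 1 + 1 by norm_num] at h4 ⊢
    rw [← h4.tsum_eq]
    refine tsum_congr fun z => ?_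
    rcases le_total (f j z) (f₀ z) with h5 | h5
    · rw [min_eq_left h5, abs_of_nonpos (by linarith)]
      ring
    · rw [min_eq_right h5, abs_of_nonneg (by linarith)]
      ring
  simp_rw [h2]
  rw [hs₀.tsum_eq] at h1
  simpa using (h1.const_mul 2).const_sub 2

namespace GradedGraph

variable {G : GradedGraph.{u, v}} {κ : ∀ n, G.E n → ℝ}

lemma r_injective_of_source {n : ℕ} (z' : G.V n) :
    Function.Injective fun e : {e : G.E n // G.s e = z'} => G.r e.1 := by
  rintro ⟨e, he⟩ ⟨e', he'⟩ h
  exact Subtype.ext (G.injective n (Prod.ext h (he.trans he'.symm)))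

/-- The measure ν(r(e))κ(e) on edges has range marginal ν, because κ is a link. Harmonicity says
that its source marginal is the function one level down. -/
lemma IsLink.hasSum_edge (hκ : G.IsLink κ) {n : ℕ} {ν : G.V (n + 1) → ℝ} (h0 : ∀ z, 0 ≤ ν z)
    {S : ℝ} (hs : HasSum ν S) : HasSum (fun e : G.E n => ν (G.r e) * κ n e) S := by
  refine hasSum_of_fibers_of_nonneg (fun e : G.E n => G.r e)
    (fun e => mul_nonneg (h0 _) (hκ.nonneg n e)) (fun z => ?_) hs
  have h := (hκ.hasSum n z).mul_left (ν z)
  rw [mul_one] at h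
  exact h.congr_fun fun e => by rw [e.2]

/-- Induction from the root: the edge measure between two consecutive levels has the two measures as
its marginals, so their masses agree. -/
lemma mem_probMeasures_of_mem_harmonic (hκ : G.IsLink κ) {ν : ∀ n, G.V n → ℝ}
    (h : ν ∈ G.harmonic κ) (n : ℕ) : ν n ∈ G.probMeasures n := by
  obtain ⟨h0, h1, hs⟩ := h
  refine ⟨h0 n, ?_⟩
  induction n with
  | zero =>
    let _ := G.uniqueRoot
    rw [← h1]
    exact hasSum_unique (ν 0)
  | succ n ih =>
    have h2 : HasSum (fun e : G.E n => ν (n + 1) (G.r e) * κ n e) 1 :=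
      hasSum_of_fibers_of_nonneg (fun e : G.E n => G.s e)
        (fun e => mul_nonneg (h0 _ _) (hκ.nonneg n e)) (hs n) ih
    refine h2.of_fibers (fun e : G.E n => G.r e) fun z => ?_
    have h := (hκ.hasSum n z).mul_left (ν (n + 1) z)
    rw [mul_one] at h
    exact h.congr_fun fun e => by rw [e.2]

/-- The harmonic functions are the projective limit of the sets of probability measures. -/
lemma harmonic_eq_projectiveLimit (hκ : G.IsLink κ) : G.harmonic κ = G.projectiveLimit κ := by
  ext ν
  constructor
  · intro h
    exact ⟨mem_probMeasures_of_mem_harmonic hκ h, fun n => funext fun z' => (h.2.2 n z').tsum_eq⟩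
  · rintro ⟨hp, hl⟩
    refine ⟨fun n => (hp n).1, ?_, fun n z' => ?_⟩
    · let _ := G.uniqueRoot
      exact (hasSum_unique (ν 0)).unique (hp 0).2
    · rw [← hl n]
      exact ((hκ.hasSum_edge (hp (n + 1)).1 (hp (n + 1)).2).summable.subtype _).hasSum

lemma convex_harmonic : Convex ℝ (G.harmonic κ) := by
  rintro ν ⟨h0, h1, hs⟩ ν' ⟨h0', h1', hs'⟩ a b ha hb hab
  refine ⟨fun n z => ?_, ?_, fun n z' => ?_⟩
  · exact add_nonneg (mul_nonneg ha (h0 n z)) (mul_nonneg hb (h0' n z))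
  · simp [h1, h1', hab]
  · refine (((hs n z').mul_left a).add ((hs' n z').mul_left b)).congr_fun fun e => ?_
    simp
    ring

/-- The `ℓ¹`-space of signed measures on the vertices of level `n`. -/
abbrev Meas (G : GradedGraph.{u, v}) (n : ℕ) : Type u := lp (fun _ : G.V n => ℝ) 1

lemma summable_meas {n : ℕ} (x : G.Meas n) : Summable fun z => |x z| := by
  have := (memℓp_gen_iff (p := 1) (by norm_num)).1 x.2
  simpa using this

lemma norm_meas {n : ℕ} (x : G.Meas n) : ‖x‖ = ∑' z, |x z| := by
  rw [lp.norm_eq_tsum_rpow (by norm_num)]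
  simp

lemma summable_push_and_norm_le (hκ : G.IsLink κ) {n : ℕ} (z' : G.V n) (x : G.Meas (n + 1)) :
    Summable (fun e : {e : G.E n // G.s e = z'} => x (G.r e.1) * κ n e.1) ∧
      ‖∑' e : {e : G.E n // G.s e = z'}, x (G.r e.1) * κ n e.1‖ ≤ ‖x‖ := by
  have h1 : Summable fun e : {e : G.E n // G.s e = z'} => |x (G.r e.1)| :=
    (summable_meas x).comp_injective (r_injective_of_source z')
  have h2 : ∀ e : {e : G.E n // G.s e = z'}, ‖x (G.r e.1) * κ n e.1‖ ≤ |x (G.r e.1)| := fun e => by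
    rw [Real.norm_eq_abs, abs_mul, abs_of_nonneg (hκ.nonneg n e.1)]
    exact mul_le_of_le_one_right (abs_nonneg _) (hκ.le_one n e.1)
  refine ⟨Summable.of_norm_bounded h1 h2, (tsum_of_norm_bounded h1.hasSum h2).trans ?_⟩
  rw [norm_meas]
  exact tsum_comp_le_tsum_of_inj (summable_meas x) (fun _ => abs_nonneg _) (r_injective_of_source z')

/-- The value at a vertex of the image of a signed measure under a link. -/
def push (hκ : G.IsLink κ) {n : ℕ} (z' : G.V n) : G.Meas (n + 1) →L[ℝ] ℝ :=
  LinearMap.mkContinuous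
    { toFun := fun x => ∑' e : {e : G.E n // G.s e = z'}, x (G.r e.1) * κ n e.1
      map_add' := fun x y => by
        rw [← (summable_push_and_norm_le hκ z' x).1.tsum_add (summable_push_and_norm_le hκ z' y).1]
        exact tsum_congr fun e => add_mul _ _ _
      map_smul' := fun r x => by
        rw [RingHom.id_apply, smul_eq_mul, ← tsum_mul_left]
        exact tsum_congr fun e => mul_assoc _ _ _ } 1 fun x => by
    rw [one_mul]
    exact (summable_push_and_norm_le hκ z' x).2

/-- The embedding of the harmonic functions into the product of the `ℓ¹`-spaces. -/
def toMeas (hκ : G.IsLink κ) (ν : G.harmonic κ) (n : ℕ) : G.Meas n :=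
  ⟨ν.1 n, (memℓp_gen_iff (p := 1) (by norm_num)).2 (by
    have h := mem_probMeasures_of_mem_harmonic hκ ν.2 n
    simpa using h.2.summable.abs)⟩

/-- Scheffé's lemma on every level: pointwise limits inside the harmonic functions lose no mass. -/
lemma continuous_toMeas (hκ : G.IsLink κ) : Continuous (toMeas hκ) := by
  refine continuous_pi fun n => continuous_iff_continuousAt.2 fun ν₀ => ?_
  rw [ContinuousAt, tendsto_iff_norm_sub_tendsto_zero]
  simp_rw [norm_meas]
  have h := fun ν : G.harmonic κ => mem_probMeasures_of_mem_harmonic hκ ν.2 n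
  exact tendsto_tsum_abs_sub (f := fun ν : G.harmonic κ => ν.1 n) (fun ν => (h ν).1)
    (fun ν => (h ν).2) (h ν₀).1 (h ν₀).2 fun z => by
      have h0 : Continuous fun f : ∀ n, G.V n → ℝ => f n z :=
        (continuous_apply z).comp (continuous_apply n)
      exact (h0.comp continuous_subtype_val).tendsto ν₀

lemma continuous_eval_meas {n : ℕ} (z : G.V n) : Continuous fun x : G.Meas n => x z :=
  (continuous_apply z).comp lp.uniformContinuous_coe.continuous

/-- Harmonicity need not survive pointwise limits of functions, since mass can escape to infinity.
In ℓ¹ it is a closed condition, because `push` is continuous there. -/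
lemma isClosedEmbedding_toMeas (hκ : G.IsLink κ) : IsClosedEmbedding (toMeas hκ) := by
  have hev : Continuous fun (x : ∀ n, G.Meas n) (n : ℕ) (z : G.V n) => x n z :=
    continuous_pi fun n => continuous_pi fun z =>
      (continuous_eval_meas z).comp (continuous_apply n)
  have hemb : IsEmbedding (toMeas hκ) :=
    IsEmbedding.of_comp (continuous_toMeas hκ) hev IsEmbedding.subtypeVal
  refine ⟨hemb, ?_⟩
  have hrange : Set.range (toMeas hκ) = {x : ∀ n, G.Meas n | (∀ n z, 0 ≤ x n z) ∧
      x 0 G.uniqueRoot.default = 1 ∧ ∀ n z', push hκ z' (x (n + 1)) = x n z'} := by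
    ext x
    constructor
    · rintro ⟨ν, rfl⟩
      exact ⟨ν.2.1, ν.2.2.1, fun n z' => (ν.2.2.2 n z').tsum_eq⟩
    · rintro ⟨h0, h1, hs⟩
      refine ⟨⟨fun n z => x n z, h0, h1, fun n z' => ?_⟩, rfl⟩
      have h2 := (summable_push_and_norm_le hκ z' (x (n + 1))).1.hasSum
      have h3 : ∑' e : {e : G.E n // G.s e = z'}, x (n + 1) (G.r e.1) * κ n e.1 = x n z' := hs n z'
      rwa [h3] at h2
  rw [hrange]
  have hev' : ∀ n (z : G.V n), Continuous fun x : ∀ n, G.Meas n => x n z := fun n z =>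
    (continuous_eval_meas z).comp (continuous_apply n)
  simp only [Set.ofPred_and, Set.ofPred_forall]
  refine IsClosed.inter (isClosed_iInter fun n => isClosed_iInter fun z =>
    isClosed_le continuous_const (hev' n z)) (IsClosed.inter
    (isClosed_eq (hev' 0 _) continuous_const) (isClosed_iInter fun n => isClosed_iInter fun z' =>
      isClosed_eq ((push hκ z').continuous.comp (continuous_apply (n + 1))) (hev' n z')))

lemma isCompletelyMetrizableSpace_harmonic (hκ : G.IsLink κ) :
    TopologicalSpace.IsCompletelyMetrizableSpace (G.harmonic κ) :=
  (isClosedEmbedding_toMeas hκ).IsCompletelyMetrizableSpace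

end GradedGraph

/-! ### Normal KMS states at the vertices and the link of the flow -/

namespace GradedGraph.Multiplicity

variable {G : GradedGraph.{u, v}} {m : G.Multiplicity}

instance countable_path : ∀ {n} (z : G.V n), Countable (m.Path z)
  | 0, _ => inferInstanceAs (Countable PUnit.{v + 1})
  | n + 1, z => by
    have := G.countable_E n
    have := fun c : m.Summand z => countable_path (G.s c.1.1)
    exact inferInstanceAs (Countable (Σ c : m.Summand z, m.Path (G.s c.1.1)))

/-- The inclusion of `B(H_z)` into `A_n` as a linear map. -/
def cornerLin {n : ℕ} (z : G.V n) : (m.H z →L[ℂ] m.H z) →ₗ[ℂ] m.Alg n where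
  toFun := corner z
  map_add' x y := by
    classical
    exact lp.single_add (E := fun z : G.V n => m.H z →L[ℂ] m.H z) _ z x y
  map_smul' r x := by
    classical
    exact lp.single_smul (E := fun z : G.V n => m.H z →L[ℂ] m.H z) _ z r x

lemma cornerLin_apply {n : ℕ} (z : G.V n) (x : m.H z →L[ℂ] m.H z) : cornerLin z x = corner z x :=
  rfl

lemma norm_corner {n : ℕ} (z : G.V n) (x : m.H z →L[ℂ] m.H z) :
    ‖(corner z x : m.Alg n)‖ = ‖x‖ := by
  classical
  exact lp.norm_single (E := fun z : G.V n => m.H z →L[ℂ] m.H z) (by simp) z x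

lemma corner_mul {n : ℕ} (z : G.V n) (x y : m.H z →L[ℂ] m.H z) :
    (corner z (x * y) : m.Alg n) = corner z x * corner z y := by
  refine ext_comp fun z' => ?_
  rw [comp_mul]
  by_cases h : z' = z
  · subst h
    simp only [comp_corner_self]
  · simp only [comp_corner_ne h, mul_zero]

lemma star_corner {n : ℕ} (z : G.V n) (x : m.H z →L[ℂ] m.H z) :
    star (corner z x : m.Alg n) = corner z (star x) := by
  refine ext_comp fun z' => ?_
  rw [comp_star]
  by_cases h : z' = z
  · subst h
    simp only [comp_corner_self]
  · simp only [comp_corner_ne h, star_zero]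

lemma star_proj_mul_proj {n : ℕ} (z : G.V n) : star (m.proj z) * m.proj z = m.proj z := by
  rw [proj, star_corner, ← corner_mul, star_one, one_mul]

lemma proj_root : m.proj G.uniqueRoot.default = 1 := by
  let _ := G.uniqueRoot
  refine ext_comp fun z => ?_
  rw [comp_one, Unique.eq_default z]
  exact comp_corner_self _ _

/-- The component at a vertex as a linear map. -/
def compLin {n : ℕ} (z : G.V n) : m.Alg n →ₗ[ℂ] (m.H z →L[ℂ] m.H z) where
  toFun a := comp a z
  map_add' _ _ := rfl
  map_smul' _ _ := rfl

lemma comp_sum {n : ℕ} {I : Type*} (s : Finset I) (a : I → m.Alg n) (z : G.V n) :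
    comp (∑ i ∈ s, a i) z = ∑ i ∈ s, comp (a i) z := map_sum (compLin z) a s

lemma norm_le_of_comp {n : ℕ} {a : m.Alg n} {C : ℝ} (hC : 0 ≤ C) (h : ∀ z, ‖comp a z‖ ≤ C) :
    ‖a‖ ≤ C := lp.norm_le_of_forall_le hC h

lemma comp_sum_corner {n : ℕ} [DecidableEq (G.V n)] (s : Finset (G.V n)) (a : m.Alg n) (z : G.V n) :
    comp (∑ z' ∈ s, corner z' (comp a z')) z = if z ∈ s then comp a z else 0 := by
  rw [comp_sum]
  split_ifs with h
  · rw [Finset.sum_eq_single z (fun z' _ hz' => comp_corner_ne hz'.symm _) (fun h' => absurd h h'),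
      comp_corner_self]
  · exact Finset.sum_eq_zero fun z' hz' =>
      comp_corner_ne (fun h' => h (by rwa [h'])) _

/-- A normal functional is determined by its values on the corners. -/
lemma IsNormal.hasSum_corner {n : ℕ} {ω : m.Alg n →ₗ[ℂ] ℂ} (hω : IsNormal ω) (a : m.Alg n) :
    HasSum (fun z => ω (corner z (comp a z))) (ω a) := by
  classical
  -- The finite partial sums of corners are bounded by ‖a‖ and converge strongly to a.
  have h := hω.tendsto (l := atTop) (y := fun s : Finset (G.V n) => ∑ z ∈ s, corner z (comp a z))
    (y₀ := a) ‖a‖ (fun s => norm_le_of_comp (norm_nonneg a) fun z => ?_) fun z v => ?_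
  · simp only [map_sum] at h
    exact h
  · rw [comp_sum_corner]
    split_ifs
    · exact norm_comp_le a z
    · simp
  · refine tendsto_const_nhds.congr' ?_
    filter_upwards [eventually_ge_atTop {z}] with s hs
    rw [comp_sum_corner, if_pos (hs (Finset.mem_singleton_self z))]

/-- A normal functional is determined on a corner by its values on the matrix units. -/
lemma IsNormal.hasSum_E {n : ℕ} {ω : m.Alg n →ₗ[ℂ] ℂ} (hω : IsNormal ω) (z : G.V n)
    (x : m.H z →L[ℂ] m.H z) :
    HasSum (fun p => ω (corner z (x * Ell2.E p p))) (ω (corner z x)) := by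
  have h := hω.tendsto (l := atTop)
    (y := fun s : Finset (m.Path z) => corner z (∑ p ∈ s, x * Ell2.E p p))
    (y₀ := corner z x) ‖x‖ (fun s => ?_) fun z' v => ?_
  · have h1 : ∀ s : Finset (m.Path z), ω (corner z (∑ p ∈ s, x * Ell2.E p p)) =
        ∑ p ∈ s, ω (corner z (x * Ell2.E p p)) := fun s => by
      simp_rw [← cornerLin_apply, map_sum]
    simp only [h1] at h
    exact h
  · rw [norm_corner, ← Finset.mul_sum]
    exact (norm_mul_le _ _).trans
      (mul_le_of_le_one_right (norm_nonneg x) (Ell2.norm_sum_E_le s))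
  · by_cases hz : z' = z
    · subst hz
      simp only [comp_corner_self]
      have h2 : Tendsto (fun s : Finset (m.Path z') => x (∑ p ∈ s, Ell2.E p p v)) atTop
          (𝓝 (x v)) := (x.continuous.tendsto v).comp (Ell2.hasSum_E_apply v)
      refine h2.congr fun s => ?_
      rw [sum_apply, map_sum]
      rfl
    · simp only [comp_corner_ne hz]
      exact tendsto_const_nhds

variable (m) {κ : ∀ n, G.E n → ℝ} (hκ : G.IsLink κ) (hpos : ∀ n e, 0 < κ n e)

/-- The normal KMS state of the flow on `B(H_z)`. -/
def vertexState {n : ℕ} (z : G.V n) : (m.H z →L[ℂ] m.H z) →L[ℂ] ℂ :=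
  Ell2.weightState (fun p => (pathWeight_pos m hpos z p).le) (hasSum_pathWeight m hκ hpos z)

lemma hasSum_vertexState {n : ℕ} (z : G.V n) (x : m.H z →L[ℂ] m.H z) :
    HasSum (fun p => (pathWeight m κ z p : ℂ) * x (Ell2.e p) p) (vertexState m hκ hpos z x) :=
  Ell2.hasSum_weightState _ _ x

lemma norm_vertexState_le {n : ℕ} (z : G.V n) (x : m.H z →L[ℂ] m.H z) :
    ‖vertexState m hκ hpos z x‖ ≤ ‖x‖ := Ell2.norm_weightState_le _ _ x

lemma vertexState_one {n : ℕ} (z : G.V n) : vertexState m hκ hpos z 1 = 1 :=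
  Ell2.weightState_one _ _

variable {β : ℝ} (hβ : β ≠ 0)

include hβ in
lemma isStripPair_vertexState {n : ℕ} (z : G.V n) (x y : m.H z →L[ℂ] m.H z) :
    IsStripPair β (fun t => vertexState m hκ hpos z (x * Ell2.conj (ham m κ β z) t y))
      (fun t => vertexState m hκ hpos z (Ell2.conj (ham m κ β z) t y * x)) :=
  Ell2.isStripPair_weightState _ _ hβ _ (fun p q => by
    rw [pathWeight_eq_exp m κ hpos hβ, mul_div_cancel₀ _ (pathWeight_pos m hpos z p).ne']) x y

lemma inner_smul_e {X : Type*} (r : ℝ) (x : X) (a : Ell2 X →L[ℂ] Ell2 X) :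
    inner ℂ (Ell2.e x) (a ((r : ℂ) • Ell2.e x)) = r * a (Ell2.e x) x := by
  rw [map_smul, inner_smul_right, Ell2.inner_e]

lemma norm_smul_e_mul {X : Type*} {r : ℝ} (hr : 0 ≤ r) (x : X) :
    ‖(r : ℂ) • Ell2.e x‖ * ‖Ell2.e x‖ = r := by
  rw [norm_smul, Ell2.norm_e, Complex.norm_real, Real.norm_of_nonneg hr]
  ring

include hβ in
lemma vertexState_mem {n : ℕ} (z : G.V n) :
    vertexState m hκ hpos z ∈ (flow m κ β hpos).vertexKMS β z := by
  refine ⟨Ell2.isCStarState_weightState _ _, fun x y => ?_, ?_⟩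
  · simp_rw [flow_locVertex]
    exact isStripPair_vertexState m hκ hpos hβ z x y
  · refine isNormalCorner_of_hasSum (fun p => (pathWeight m κ z p : ℂ) • Ell2.e p)
      (fun p => Ell2.e p) ?_ fun x => ?_
    · refine (hasSum_pathWeight m hκ hpos z).summable.congr fun p => ?_
      rw [norm_smul_e_mul (pathWeight_pos m hpos z p).le]
    · exact (hasSum_vertexState m hκ hpos z x).congr_fun fun p => inner_smul_e _ p x

-- Matrix units are eigenvectors of the local flow, so the KMS condition gives the Gibbs relations
-- for the path weights. With normality these fix τ up to the factor τ(1) = 1.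
include hβ in
lemma eq_vertexState {n : ℕ} (z : G.V n) {τ : (m.H z →L[ℂ] m.H z) →L[ℂ] ℂ}
    (hτ : τ ∈ (flow m κ β hpos).vertexKMS β z) : τ = vertexState m hκ hpos z := by
  obtain ⟨hs, hK, hN⟩ := hτ
  refine ContinuousLinearMap.ext fun x => ?_
  have h := Ell2.eq_weightState_of_gibbs (fun p => (pathWeight_pos m hpos z p).le)
    (hasSum_pathWeight m hκ hpos z) (pathWeight_pos m hpos z) τ.toLinearMap (fun p q a => ?_)
    (fun a => ?_) x
  · change τ x = τ 1 * vertexState m hκ hpos z x at h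
    rw [h, hs.1, one_mul]
  · have h1 := hK.apply_mul_of_eigenvector hβ (v := Ell2.E p q)
      (l := ham m κ β z p - ham m κ β z q) (fun t => by rw [flow_locVertex, Ell2.conj_E]) a
    rw [pathWeight_eq_exp m κ hpos hβ] at h1
    exact h1
  · have h1 := IsNormal.hasSum_E (ω := τ.toLinearMap ∘ₗ compLin z) hN.isNormal z a
    have h2 : ∀ y, (τ.toLinearMap ∘ₗ compLin z) (corner z y) = τ y := fun y => by
      change τ (comp (corner z y) z) = τ y
      rw [comp_corner_self]
    simp only [h2] at h1
    exact h1

/-- A normal functional that satisfies the Gibbs condition on the matrix units is a combination of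
the vertex states. -/
lemma hasSum_of_gibbs {n : ℕ} {ω : m.Alg n →ₗ[ℂ] ℂ} (hω : IsNormal ω)
    (hG : ∀ (z : G.V n) (p q : m.Path z) (a : m.Alg n), ω (corner z (Ell2.E p q) * a) =
      (pathWeight m κ z p / pathWeight m κ z q : ℝ) * ω (a * corner z (Ell2.E p q)))
    (a : m.Alg n) :
    HasSum (fun z => ω (m.proj z) * vertexState m hκ hpos z (comp a z)) (ω a) := by
  refine (hω.hasSum_corner a).congr_fun fun z => ?_
  -- On each corner ω is a multiple of the vertex state; the factor is its value at the unit of the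
  -- corner, which is `proj z`.
  refine Eq.symm (Ell2.eq_weightState_of_gibbs (fun p => (pathWeight_pos m hpos z p).le)
    (hasSum_pathWeight m hκ hpos z) (pathWeight_pos m hpos z) (ω ∘ₗ cornerLin z) (fun p q x => ?_)
    (fun x => hω.hasSum_E z x) (comp a z))
  change ω (corner z _) = _ * ω (corner z _)
  rw [corner_mul, corner_mul, hG]

lemma algFlow_corner_E {n : ℕ} (z : G.V n) (p q : m.Path z) (t : ℝ) :
    algFlow m κ β n t (corner z (Ell2.E p q)) =
      Complex.exp (Complex.I * (ham m κ β z p - ham m κ β z q : ℝ) * t) •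
        corner z (Ell2.E p q) := by
  refine ext_comp fun z' => ?_
  rw [comp_algFlow, comp_smul]
  by_cases h : z' = z
  · subst h
    rw [comp_corner_self, Ell2.conj_E]
  · rw [comp_corner_ne h, Ell2.conj, mul_zero, zero_mul, smul_zero]

include hβ in
/-- A locally normal KMS state on the limit is a combination of the vertex states on every
level. -/
lemma hasSum_of_isKMS {ω : m.Limit →L[ℂ] ℂ}
    (hK : IsKMS (fun t a => (flow m κ β hpos).toFun t a) β ω) (hN : IsLocallyNormal ω) {n : ℕ}
    (a : m.Alg n) :
    HasSum (fun z => ω (m.ι n (m.proj z)) * vertexState m hκ hpos z (comp a z)) (ω (m.ι n a)) := by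
  refine hasSum_of_gibbs m hκ hpos
    (ω := ω.toLinearMap ∘ₗ (m.ι n).toAlgHom.toLinearMap) (hN n) (fun z p q b => ?_) a
  have h1 := hK.apply_mul_of_eigenvector hβ (v := m.ι n (corner z (Ell2.E p q)))
    (l := ham m κ β z p - ham m κ β z q)
    (fun t => by rw [flow_ι, algFlow_corner_E, map_smul]) (m.ι n b)
  rw [pathWeight_eq_exp m κ hpos hβ, ← map_mul, ← map_mul] at h1
  exact h1

/-- The vertex states and the inclusions. -/
lemma hasSum_vertexState_incl {n : ℕ} (a : m.Alg n) (z : G.V (n + 1)) :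
    HasSum (fun e : {e : G.E n // G.r e = z} =>
        (κ n e.1 : ℂ) * vertexState m hκ hpos (G.s e.1) (comp a (G.s e.1)))
      (vertexState m hκ hpos z (comp (m.incl n a) z)) := by
  -- Group the paths ending at z by their last edge and copy index: the included operator is block
  -- diagonal for this grouping, and the weight splits off the factor of the last step.
  have h1 : HasSum (fun c : m.Summand z => (summandWeight m κ c : ℂ) *
      vertexState m hκ hpos (G.s c.1.1) (comp a (G.s c.1.1)))
      (vertexState m hκ hpos z (comp (m.incl n a) z)) := by
    have h2 : HasSum (fun p : Σ c : m.Summand z, m.Path (G.s c.1.1) => (pathWeight m κ z p : ℂ) *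
      (comp (m.incl n a) z) (Ell2.e (X := m.Path z) p) p)
      (vertexState m hκ hpos z (comp (m.incl n a) z)) := hasSum_vertexState m hκ hpos z _
    refine h2.sigma fun c => ?_
    refine ((hasSum_vertexState m hκ hpos (G.s c.1.1) (comp a (G.s c.1.1))).mul_left
      (summandWeight m κ c : ℂ)).congr_fun fun p => ?_
    have h3 : slice (Ell2.e (X := m.Path z) ⟨c, p⟩) c = Ell2.e p := by
      ext q
      by_cases hq : q = p
      · subst hq
        rw [Ell2.e_apply_self]
        exact Ell2.e_apply_self (X := m.Path z) ⟨c, q⟩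
      · rw [Ell2.e_apply_ne hq]
        refine Ell2.e_apply_ne (X := m.Path z) (x := ⟨c, p⟩) (y := ⟨c, q⟩) fun h => hq ?_
        exact eq_of_heq (Sigma.mk.inj h).2
    have h4 : (comp (m.incl n a) z) (Ell2.e (X := m.Path z) ⟨c, p⟩) ⟨c, p⟩ =
        comp a (G.s c.1.1) (slice (Ell2.e (X := m.Path z) ⟨c, p⟩) c) p := rfl
    rw [h4, h3, pathWeight_succ]
    push_cast
    ring
  -- The blocks of the copies of e are equal, so only the total weight κ(e) remains.
  refine h1.sigma fun e => ?_
  have h2 := (Complex.hasSum_ofReal.2 (hasSum_idx m (κ := κ) e)).mul_right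
    (vertexState m hκ hpos (G.s e.1) (comp a (G.s e.1)))
  exact h2

lemma vertexState_proj_self {n : ℕ} (z : G.V n) :
    vertexState m hκ hpos z (comp (m.proj z) z) = 1 := by
  rw [proj, comp_corner_self, vertexState_one]

/-- An edge is determined by its range and source, so only the term of e survives in the
decomposition over the edges with range r(e). -/
lemma vertexState_incl_proj {n : ℕ} (e : G.E n) :
    vertexState m hκ hpos (G.r e) (comp (m.incl n (m.proj (G.s e))) (G.r e)) = κ n e := by
  refine (hasSum_vertexState_incl m hκ hpos _ (G.r e)).unique ?_
  have h1 := hasSum_single (f := fun e' : {e' : G.E n // G.r e' = G.r e} => (κ n e'.1 : ℂ) *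
    vertexState m hκ hpos (G.s e'.1) (comp (m.proj (G.s e)) (G.s e'.1))) ⟨e, rfl⟩ ?_
  · beta_reduce at h1
    rw [vertexState_proj_self, mul_one] at h1
    exact h1
  · rintro ⟨e', he'⟩ hne
    have h2 : G.s e' ≠ G.s e := fun h =>
      hne (Subtype.ext (G.injective n (Prod.ext he' h)))
    rw [proj, comp_corner_ne h2, map_zero, mul_zero]

lemma vertexState_incl_proj_eq_zero {n : ℕ} (z : G.V (n + 1)) (z' : G.V n)
    (h : ∀ e : G.E n, ¬(G.r e = z ∧ G.s e = z')) :
    vertexState m hκ hpos z (comp (m.incl n (m.proj z')) z) = 0 := by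
  refine (hasSum_vertexState_incl m hκ hpos _ z).unique ?_
  refine hasSum_zero.congr_fun ?_
  rintro ⟨e, he⟩
  rw [proj, comp_corner_ne (fun h' => h e ⟨he, h'⟩), map_zero, mul_zero]

-- The state selected by choice in `link` is the vertex state, by existence and uniqueness.
include hκ hβ in
lemma flow_link {n : ℕ} (z : G.V (n + 1)) (z' : G.V n) :
    (flow m κ β hpos).link β z z' =
      vertexState m hκ hpos z (comp (m.incl n (m.proj z')) z) := by
  have h : ((flow m κ β hpos).vertexKMS β z).Nonempty := ⟨_, vertexState_mem m hκ hpos hβ z⟩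
  rw [InductiveFlow.link, dif_pos h, eq_vertexState m hκ hpos hβ z h.some_mem]

end GradedGraph.Multiplicity

/-! ### Locally normal KMS states and harmonic functions -/

namespace GradedGraph.Multiplicity

variable {G : GradedGraph.{u, v}} (m : G.Multiplicity) {κ : ∀ n, G.E n → ℝ} (hκ : G.IsLink κ)
  (hpos : ∀ n e, 0 < κ n e)

lemma norm_weight_mul_le {n : ℕ} {ν : G.V n → ℝ} (hν : ν ∈ G.probMeasures n) (a : m.Alg n)
    (z : G.V n) : ‖(ν z : ℂ) * vertexState m hκ hpos z (comp a z)‖ ≤ ν z * ‖a‖ := by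
  rw [norm_mul, Complex.norm_real, Real.norm_of_nonneg (hν.1 z)]
  exact mul_le_mul_of_nonneg_left
    ((norm_vertexState_le m hκ hpos z _).trans (norm_comp_le a z)) (hν.1 z)

lemma summable_levelState {n : ℕ} {ν : G.V n → ℝ} (hν : ν ∈ G.probMeasures n) (a : m.Alg n) :
    Summable fun z => (ν z : ℂ) * vertexState m hκ hpos z (comp a z) :=
  Summable.of_norm_bounded (hν.2.summable.mul_right ‖a‖) (norm_weight_mul_le m hκ hpos hν a)

/-- The state on `A_n` defined by a probability measure on the vertices of level `n`. -/
def levelState {n : ℕ} {ν : G.V n → ℝ} (hν : ν ∈ G.probMeasures n) : m.Alg n →ₗ[ℂ] ℂ where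
  toFun a := ∑' z, (ν z : ℂ) * vertexState m hκ hpos z (comp a z)
  map_add' a b := by
    rw [← (summable_levelState m hκ hpos hν a).tsum_add (summable_levelState m hκ hpos hν b)]
    refine tsum_congr fun z => ?_
    rw [comp_add, map_add, mul_add]
  map_smul' r a := by
    rw [RingHom.id_apply, smul_eq_mul, ← tsum_mul_left]
    refine tsum_congr fun z => ?_
    rw [comp_smul, map_smul, smul_eq_mul]
    ring

lemma hasSum_levelState {n : ℕ} {ν : G.V n → ℝ} (hν : ν ∈ G.probMeasures n) (a : m.Alg n) :
    HasSum (fun z => (ν z : ℂ) * vertexState m hκ hpos z (comp a z))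
      (levelState m hκ hpos hν a) :=
  (summable_levelState m hκ hpos hν a).hasSum

lemma norm_levelState_le {n : ℕ} {ν : G.V n → ℝ} (hν : ν ∈ G.probMeasures n) (a : m.Alg n) :
    ‖levelState m hκ hpos hν a‖ ≤ ‖a‖ :=
  tsum_of_norm_bounded (by simpa using hν.2.mul_right ‖a‖) (norm_weight_mul_le m hκ hpos hν a)

lemma levelState_one {n : ℕ} {ν : G.V n → ℝ} (hν : ν ∈ G.probMeasures n) :
    levelState m hκ hpos hν 1 = 1 := by
  refine (hasSum_levelState m hκ hpos hν 1).unique ?_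
  have h := Complex.hasSum_ofReal.2 hν.2
  rw [Complex.ofReal_one] at h
  refine h.congr_fun fun z => ?_
  rw [comp_one, vertexState_one, mul_one]

lemma levelState_star_mul_self {n : ℕ} {ν : G.V n → ℝ} (hν : ν ∈ G.probMeasures n) (a : m.Alg n) :
    0 ≤ levelState m hκ hpos hν (star a * a) := by
  refine (hasSum_levelState m hκ hpos hν _).nonneg fun z => ?_
  rw [comp_mul, comp_star]
  exact mul_nonneg (Complex.zero_le_real.2 (hν.1 z))
    (Ell2.weightState_star_mul_self _ _ (comp a z))

lemma levelState_proj {n : ℕ} {ν : G.V n → ℝ} (hν : ν ∈ G.probMeasures n) (z : G.V n) :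
    levelState m hκ hpos hν (m.proj z) = ν z := by
  refine (hasSum_levelState m hκ hpos hν _).unique ?_
  have h := hasSum_single (f := fun z' => (ν z' : ℂ) *
    vertexState m hκ hpos z' (comp (m.proj z) z')) z fun z' hz' => by
      rw [proj, comp_corner_ne hz', map_zero, mul_zero]
  beta_reduce at h
  rwa [vertexState_proj_self, mul_one] at h

lemma isNormal_levelState {n : ℕ} {ν : G.V n → ℝ} (hν : ν ∈ G.probMeasures n) :
    IsNormal (levelState m hκ hpos hν) := by
  have := G.countable_V n
  have : Nonempty (G.V n) := by
    by_contra h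
    rw [not_nonempty_iff] at h
    exact zero_ne_one (hasSum_empty.unique hν.2)
  -- Vertices and their paths form one countable index set, on which w is a probability weight; it
  -- gives the absolutely summable family of vector functionals.
  let w : (Σ z : G.V n, m.Path z) → ℝ := fun i => ν i.1 * pathWeight m κ i.1 i.2
  have hw0 : ∀ i, 0 ≤ w i := fun i => mul_nonneg (hν.1 _) (pathWeight_pos m hpos _ _).le
  have hw : HasSum w 1 := by
    refine hasSum_sigma_of_nonneg hw0 (fun z => ?_) hν.2
    simpa only [mul_one] using! (hasSum_pathWeight m hκ hpos z).mul_left (ν z)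
  refine isNormal_of_hasSum (fun i : Σ z : G.V n, m.Path z => i.1)
    (fun i => (w i : ℂ) • Ell2.e i.2) (fun i => Ell2.e i.2) ?_ fun a => ?_
  · refine hw.summable.congr fun i => ?_
    rw [norm_smul_e_mul (hw0 i)]
  · have h1 : ∀ i : Σ z : G.V n, m.Path z, inner ℂ (Ell2.e i.2)
        (comp a i.1 ((w i : ℂ) • Ell2.e i.2)) = w i * comp a i.1 (Ell2.e i.2) i.2 :=
      fun i => inner_smul_e _ _ _
    have h2 : Summable fun i : Σ z : G.V n, m.Path z =>
        (w i : ℂ) * comp a i.1 (Ell2.e i.2) i.2 := by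
      refine Summable.of_norm_bounded (hw.summable.mul_right ‖a‖) fun i => ?_
      rw [norm_mul, Complex.norm_real, Real.norm_of_nonneg (hw0 i)]
      exact mul_le_mul_of_nonneg_left
        ((Ell2.norm_apply_e_apply_le _ _ _).trans (norm_comp_le a i.1)) (hw0 i)
    have h3 := HasSum.sigma_of_hasSum (hasSum_levelState m hκ hpos hν a) (fun z => by
      refine ((hasSum_vertexState m hκ hpos z (comp a z)).mul_left (ν z : ℂ)).congr_fun
        fun p => ?_
      simp only [w]
      push_cast
      rw [mul_assoc]) h2
    exact h3.congr_fun h1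

variable {β : ℝ} (hβ : β ≠ 0)

include hβ in
lemma isStripPair_levelState {n : ℕ} {ν : G.V n → ℝ} (hν : ν ∈ G.probMeasures n) (a b : m.Alg n) :
    IsStripPair β (fun t => levelState m hκ hpos hν (a * algFlow m κ β n t b))
      (fun t => levelState m hκ hpos hν (algFlow m κ β n t b * a)) := by
  refine IsStripPair.tsum hβ (u := fun z => ν z * (‖a‖ * ‖b‖)) (hν.2.summable.mul_right _)
    (fun z => (isStripPair_vertexState m hκ hpos hβ z (comp a z) (comp b z)).const_mul _)
    (fun z t => ?_) (fun z t => ?_)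
  · refine (norm_weight_mul_le m hκ hpos hν (a * algFlow m κ β n t b) z).trans ?_
    refine mul_le_mul_of_nonneg_left ((norm_mul_le _ _).trans ?_) (hν.1 z)
    exact mul_le_mul_of_nonneg_left (norm_algFlow_le m β n t b) (norm_nonneg a)
  · refine (norm_weight_mul_le m hκ hpos hν (algFlow m κ β n t b * a) z).trans ?_
    refine mul_le_mul_of_nonneg_left ((norm_mul_le _ _).trans ?_) (hν.1 z)
    rw [mul_comm]
    exact mul_le_mul_of_nonneg_left (norm_algFlow_le m β n t b) (norm_nonneg a)

/-- The states of the levels are compatible for a harmonic function. -/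
lemma levelState_incl {ν : ∀ n, G.V n → ℝ} (hν : ν ∈ G.harmonic κ) (n : ℕ) (a : m.Alg n) :
    levelState m hκ hpos (mem_probMeasures_of_mem_harmonic hκ hν (n + 1)) (m.incl n a) =
      levelState m hκ hpos (mem_probMeasures_of_mem_harmonic hκ hν n) a := by
  have hp := mem_probMeasures_of_mem_harmonic hκ hν
  -- Both states are sums of this one absolutely summable family over edges: grouped by range for
  -- level n + 1, grouped by source for level n.
  let f : G.E n → ℂ := fun e => (ν (n + 1) (G.r e) * κ n e : ℝ) *
    vertexState m hκ hpos (G.s e) (comp a (G.s e))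
  have hf : Summable f := by
    refine Summable.of_norm_bounded
      ((hκ.hasSum_edge (hp (n + 1)).1 (hp (n + 1)).2).summable.mul_right ‖a‖) fun e => ?_
    have h0 : 0 ≤ ν (n + 1) (G.r e) * κ n e := mul_nonneg (hν.1 _ _) (hpos n e).le
    rw [norm_mul, Complex.norm_real, Real.norm_of_nonneg h0]
    exact mul_le_mul_of_nonneg_left
      ((norm_vertexState_le m hκ hpos _ _).trans (norm_comp_le a _)) h0
  have h1 : HasSum (fun z => (ν (n + 1) z : ℂ) *
      vertexState m hκ hpos z (comp (m.incl n a) z)) (∑' e, f e) := by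
    refine hf.hasSum.of_fibers (fun e : G.E n => G.r e) fun z => ?_
    refine ((hasSum_vertexState_incl m hκ hpos a z).mul_left (ν (n + 1) z : ℂ)).congr_fun ?_
    rintro ⟨e, rfl⟩
    simp only [f]
    push_cast
    ring
  have h2 : HasSum (fun z' => (ν n z' : ℂ) * vertexState m hκ hpos z' (comp a z'))
      (∑' e, f e) := by
    refine hf.hasSum.of_fibers (fun e : G.E n => G.s e) fun z' => ?_
    refine ((Complex.hasSum_ofReal.2 (hν.2.2 n z')).mul_right
      (vertexState m hκ hpos z' (comp a z'))).congr_fun ?_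
    rintro ⟨e, rfl⟩
    rfl
  rw [(hasSum_levelState m hκ hpos (hp (n + 1)) _).unique h1,
    (hasSum_levelState m hκ hpos (hp n) _).unique h2]

/-- The state on the limit algebra defined by a harmonic function. -/
def limitState (ν : G.harmonic κ) : m.Limit →L[ℂ] ℂ :=
  CStarLimit.functional
    (fun n => levelState m hκ hpos (mem_probMeasures_of_mem_harmonic hκ ν.2 n))
    (levelState_incl m hκ hpos ν.2)
    fun n => norm_levelState_le m hκ hpos (mem_probMeasures_of_mem_harmonic hκ ν.2 n)

lemma limitState_ι (ν : G.harmonic κ) (n : ℕ) (a : m.Alg n) : limitState m hκ hpos ν (m.ι n a) =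
    levelState m hκ hpos (mem_probMeasures_of_mem_harmonic hκ ν.2 n) a :=
  CStarLimit.functional_ι _ _ _ n a

lemma norm_limitState_le (ν : G.harmonic κ) (x : m.Limit) : ‖limitState m hκ hpos ν x‖ ≤ ‖x‖ :=
  CStarLimit.norm_functional_le _ _ _ x

lemma limitState_proj (ν : G.harmonic κ) (n : ℕ) (z : G.V n) :
    limitState m hκ hpos ν (m.ι n (m.proj z)) = ν.1 n z := by
  rw [limitState_ι, levelState_proj]

lemma isCStarState_limitState (ν : G.harmonic κ) : IsCStarState (limitState m hκ hpos ν) := by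
  constructor
  · rw [← map_one (m.ι 0), limitState_ι, levelState_one]
  · refine CStarLimit.ι_induction (isClosed_le continuous_const (by fun_prop)) fun n a => ?_
    rw [← map_star, ← map_mul, limitState_ι]
    exact levelState_star_mul_self m hκ hpos _ a

include hβ in
lemma isKMS_limitState (ν : G.harmonic κ) :
    IsKMS (fun t a => (flow m κ β hpos).toFun t a) β (limitState m hκ hpos ν) := by
  refine IsKMS.of_dense hβ CStarLimit.dense_range_ι (fun t a b => map_sub _ a b)
    (norm_flow m κ β hpos) ?_
  intro x hx y hy
  obtain ⟨n, a, rfl⟩ := Set.mem_iUnion.1 hx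
  obtain ⟨k, b, rfl⟩ := Set.mem_iUnion.1 hy
  -- Elements of different levels are moved to a common level, where the KMS condition is known.
  obtain ⟨a', ha'⟩ := CStarLimit.exists_ι_of_le (f := m.incl) (le_max_left n k) a
  obtain ⟨b', hb'⟩ := CStarLimit.exists_ι_of_le (f := m.incl) (le_max_right n k) b
  rw [← ha', ← hb']
  simp_rw [flow_ι, ← map_mul, limitState_ι]
  exact isStripPair_levelState m hκ hpos hβ _ a' b'

lemma isLocallyNormal_limitState (ν : G.harmonic κ) : IsLocallyNormal (limitState m hκ hpos ν) :=
  fun n => by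
    simp_rw [limitState_ι]
    exact isNormal_levelState m hκ hpos _

/-- The function on the vertices defined by a functional. -/
def vertexValue (ω : m.Limit →L[ℂ] ℂ) (n : ℕ) (z : G.V n) : ℝ := (ω (m.ι n (m.proj z))).re

variable {m}

/-- Since `proj z` has the form p*p, positivity makes the value real, and taking the real part loses
nothing. -/
lemma ofReal_vertexValue {ω : m.Limit →L[ℂ] ℂ} (hω : IsCStarState ω) (n : ℕ) (z : G.V n) :
    (vertexValue m ω n z : ℂ) = ω (m.ι n (m.proj z)) := by
  have h := hω.2 (m.ι n (m.proj z))
  rw [← map_star, ← map_mul, star_proj_mul_proj] at h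
  exact (Complex.eq_re_of_ofReal_le (r := 0) (by simpa using h)).symm

-- The decomposition of ω on level n + 1, evaluated at the image of `proj z'`, is the harmonicity
-- equation: the vertex states take the value κ(e) on edges with source z' and vanish at all other
-- vertices.
include hκ hβ in
lemma vertexValue_mem_harmonic {ω : m.Limit →L[ℂ] ℂ} (hω : IsCStarState ω)
    (hK : IsKMS (fun t a => (flow m κ β hpos).toFun t a) β ω) (hN : IsLocallyNormal ω) :
    vertexValue m ω ∈ G.harmonic κ := by
  refine ⟨fun n z => ?_, ?_, fun n z' => ?_⟩
  · have h := hω.2 (m.ι n (m.proj z))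
    rw [← map_star, ← map_mul, star_proj_mul_proj] at h
    exact (Complex.nonneg_iff.1 h).1
  · rw [vertexValue, proj_root, map_one, hω.1, Complex.one_re]
  · have h1 := hasSum_of_isKMS m hκ hpos hβ hK hN (m.incl n (m.proj z'))
    have h2 : ω (m.ι (n + 1) (m.incl n (m.proj z'))) = vertexValue m ω n z' := by
      rw [ofReal_vertexValue hω, ι, CStarLimit.ι_succ]
    rw [h2] at h1
    refine Complex.hasSum_ofReal.1 ?_
    refine ((r_injective_of_source z').hasSum_iff fun z hz => ?_).2 h1 |>.congr_fun ?_
    · rw [vertexState_incl_proj_eq_zero, mul_zero]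
      rintro e ⟨rfl, he⟩
      exact hz ⟨⟨e, he⟩, rfl⟩
    · rintro ⟨e, rfl⟩
      rw [Function.comp_apply, vertexState_incl_proj, ← ofReal_vertexValue hω]
      push_cast
      rfl

include hβ in
lemma eq_limitState {ω : m.Limit →L[ℂ] ℂ} (hω : IsCStarState ω)
    (hK : IsKMS (fun t a => (flow m κ β hpos).toFun t a) β ω) (hN : IsLocallyNormal ω) :
    limitState m hκ hpos ⟨vertexValue m ω, vertexValue_mem_harmonic hκ hpos hβ hω hK hN⟩ = ω := by
  refine CStarLimit.functional_ext fun n a => ?_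
  have h1 := hasSum_of_isKMS m hκ hpos hβ hK hN a
  simp_rw [← ofReal_vertexValue hω] at h1
  exact (limitState_ι m hκ hpos _ n a).trans ((hasSum_levelState m hκ hpos _ a).unique h1)

variable (m)

/-- On A_n two such states differ at b by at most ‖b‖ times the ℓ¹ distance of their measures, and
Scheffé's lemma applies. Contractivity of the states extends continuity to the closure of the union.
-/
lemma continuous_limitState (x : m.Limit) :
    Continuous fun ν : G.harmonic κ => limitState m hκ hpos ν x := by
  refine CStarLimit.ι_induction (p := fun x => Continuous fun ν => limitState m hκ hpos ν x)
    (isClosed_of_closure_subset fun x hx => ?_) (fun n b => ?_) x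
  · refine continuous_of_uniform_approx_of_continuous fun u hu => ?_
    obtain ⟨ε, hε, hεu⟩ := Metric.mem_uniformity_dist.1 hu
    obtain ⟨y, hy, hxy⟩ := Metric.mem_closure_iff.1 hx ε hε
    refine ⟨_, hy, fun t => hεu ?_⟩
    rw [dist_eq_norm, ← map_sub]
    rw [dist_eq_norm] at hxy
    exact (norm_limitState_le m hκ hpos t _).trans_lt hxy
  · simp_rw [limitState_ι]
    refine continuous_iff_continuousAt.2 fun ν₀ => ?_
    have hp := fun ν : G.harmonic κ => mem_probMeasures_of_mem_harmonic hκ ν.2 n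
    have h1 := tendsto_tsum_abs_sub (l := 𝓝 ν₀) (f := fun ν : G.harmonic κ => ν.1 n)
      (fun ν => (hp ν).1) (fun ν => (hp ν).2) (hp ν₀).1 (hp ν₀).2 fun z => by
        have h0 : Continuous fun f : ∀ n, G.V n → ℝ => f n z :=
          (continuous_apply z).comp (continuous_apply n)
        exact (h0.comp continuous_subtype_val).tendsto ν₀
    rw [ContinuousAt, tendsto_iff_norm_sub_tendsto_zero]
    refine squeeze_zero (fun _ => norm_nonneg _) (fun ν => ?_) (by simpa using h1.mul_const ‖b‖)
    have h2 : Summable fun z => |ν.1 n z - ν₀.1 n z| :=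
      ((hp ν).2.summable.sub (hp ν₀).2.summable).abs
    rw [← ((hasSum_levelState m hκ hpos (hp ν) b).sub
      (hasSum_levelState m hκ hpos (hp ν₀) b)).tsum_eq]
    refine tsum_of_norm_bounded (h2.hasSum.mul_right ‖b‖) fun z => ?_
    rw [← sub_mul, ← Complex.ofReal_sub, norm_mul, Complex.norm_real, Real.norm_eq_abs]
    exact mul_le_mul_of_nonneg_left
      ((norm_vertexState_le m hκ hpos z _).trans (norm_comp_le b z)) (abs_nonneg _)

include hβ in
lemma limitState_mem (ν : G.harmonic κ) :
    (limitState m hκ hpos ν : WeakDual ℂ m.Limit) ∈ (flow m κ β hpos).locallyNormalKMS β :=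
  ⟨isCStarState_limitState m hκ hpos ν, isKMS_limitState m hκ hpos hβ ν,
    isLocallyNormal_limitState m hκ hpos ν⟩

/-- The locally normal KMS states are homeomorphic to the harmonic functions. -/
def kmsHomeomorph : (flow m κ β hpos).locallyNormalKMS β ≃ₜ G.harmonic κ where
  toFun ω := ⟨vertexValue m ω.1,
    vertexValue_mem_harmonic hκ hpos hβ ω.2.1 ω.2.2.1 ω.2.2.2⟩
  invFun ν := ⟨limitState m hκ hpos ν, limitState_mem m hκ hpos hβ ν⟩
  left_inv ω := Subtype.ext (eq_limitState hκ hpos hβ ω.2.1 ω.2.2.1 ω.2.2.2)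
  right_inv ν := Subtype.ext (funext fun n => funext fun z => by
    change (limitState m hκ hpos ν (m.ι n (m.proj z))).re = _
    rw [limitState_proj, Complex.ofReal_re])
  continuous_toFun := by
    refine Continuous.subtype_mk (continuous_pi fun n => continuous_pi fun z => ?_) _
    exact Complex.continuous_re.comp
      ((WeakDual.eval_continuous (m.ι n (m.proj z))).comp continuous_subtype_val)
  continuous_invFun := by
    refine Continuous.subtype_mk ?_ _
    exact WeakDual.continuous_of_continuous_eval (continuous_limitState m hκ hpos)

/-- Convexity is transported from the harmonic functions, `limitState` being affine in ν; no convex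
combination of vector families or of analytic functions has to be formed. -/
lemma convex_locallyNormalKMS (hκ : G.IsLink κ) (hβ : β ≠ 0) :
    Convex ℝ ((flow m κ β hpos).locallyNormalKMS β) := by
  intro ω hω ω' hω' a b ha hb hab
  let ν : G.harmonic κ := kmsHomeomorph m hκ hpos hβ ⟨ω, hω⟩
  let ν' : G.harmonic κ := kmsHomeomorph m hκ hpos hβ ⟨ω', hω'⟩
  have h1 : limitState m hκ hpos ν = ω := eq_limitState hκ hpos hβ hω.1 hω.2.1 hω.2.2
  have h2 : limitState m hκ hpos ν' = ω' := eq_limitState hκ hpos hβ hω'.1 hω'.2.1 hω'.2.2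
  let ν'' : G.harmonic κ := ⟨a • ν.1 + b • ν'.1, convex_harmonic ν.2 ν'.2 ha hb hab⟩
  have h3 : limitState m hκ hpos ν'' = (a : ℂ) • limitState m hκ hpos ν +
      (b : ℂ) • limitState m hκ hpos ν' := by
    refine CStarLimit.functional_ext fun n x => ?_
    have hp := fun ν : G.harmonic κ => mem_probMeasures_of_mem_harmonic hκ ν.2 n
    refine ((limitState_ι m hκ hpos ν'' n x).trans
      ((hasSum_levelState m hκ hpos (hp ν'') x).unique
        ((((hasSum_levelState m hκ hpos (hp ν) x).mul_left (a : ℂ)).add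
          ((hasSum_levelState m hκ hpos (hp ν') x).mul_left (b : ℂ))).congr_fun fun z => ?_))).trans
      ?_
    · have h4 : ν''.1 n z = a * ν.1 n z + b * ν'.1 n z := rfl
      rw [h4]
      push_cast
      ring
    · rw [← limitState_ι, ← limitState_ι]
      rfl
  have h4 : a • ω + b • ω' = (limitState m hκ hpos ν'' : WeakDual ℂ m.Limit) := by
    rw [h3, h1, h2]
    refine DFunLike.ext _ _ fun x => ?_
    change a • ω x + b • ω' x = (a : ℂ) • ω x + (b : ℂ) • ω' x
    rw [Complex.coe_smul, Complex.coe_smul]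
  rw [h4]
  exact limitState_mem m hκ hpos hβ ν''

end GradedGraph.Multiplicity

end

theorem proposition9p5 (G : GradedGraph.{u, v}) (κ : ∀ n, G.E n → ℝ) (hκ : G.IsLink κ)
    (hpos : ∀ n e, 0 < κ n e) (m : G.Multiplicity) (β : ℝ) (hβ : β ≠ 0) :
    ∃ α : m.InductiveFlow,
      -- the continuity conditions
      (α.IsWeaklyContinuous ∧ α.IsUContinuous) ∧
      -- the link of the flow is `κ`
      ((∀ n (e : G.E n), α.link β (G.r e) (G.s e) = κ n e) ∧
        ∀ n (z : G.V (n + 1)) (z' : G.V n), (∀ e : G.E n, ¬(G.r e = z ∧ G.s e = z')) →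
          α.link β z z' = 0) ∧
      -- the locally normal KMS states and the projective limit, as completely metrizable convex sets
      G.harmonic κ = G.projectiveLimit κ ∧
      Convex ℝ (α.locallyNormalKMS β) ∧ Convex ℝ (G.harmonic κ) ∧
      TopologicalSpace.IsCompletelyMetrizableSpace (α.locallyNormalKMS β) ∧
      TopologicalSpace.IsCompletelyMetrizableSpace (G.harmonic κ) ∧
      ∃ Φ : α.locallyNormalKMS β ≃ₜ G.harmonic κ,
        (∀ (ω : α.locallyNormalKMS β) (n : ℕ) (z : G.V n), ((Φ ω).1 n z : ℂ) = ω.1 (m.ι n (m.proj z))) ∧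
        ∀ (ω₁ ω₂ ω : α.locallyNormalKMS β) (a b : ℝ), 0 ≤ a → 0 ≤ b → a + b = 1 →
          ω.1 = a • ω₁.1 + b • ω₂.1 → (Φ ω).1 = a • (Φ ω₁).1 + b • (Φ ω₂).1 := by
  refine ⟨GradedGraph.Multiplicity.flow m κ β hpos,
    ⟨GradedGraph.Multiplicity.flow_isWeaklyContinuous m β hpos,
      GradedGraph.Multiplicity.flow_isUContinuous m β hpos⟩, ⟨fun n e => ?_, fun n z z' h => ?_⟩,
    GradedGraph.harmonic_eq_projectiveLimit hκ,
    GradedGraph.Multiplicity.convex_locallyNormalKMS m hpos hκ hβ, GradedGraph.convex_harmonic,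
    ?_, GradedGraph.isCompletelyMetrizableSpace_harmonic hκ,
    GradedGraph.Multiplicity.kmsHomeomorph m hκ hpos hβ, fun ω n z => ?_, ?_⟩
  · rw [GradedGraph.Multiplicity.flow_link m hκ hpos hβ,
      GradedGraph.Multiplicity.vertexState_incl_proj]
  · rw [GradedGraph.Multiplicity.flow_link m hκ hpos hβ,
      GradedGraph.Multiplicity.vertexState_incl_proj_eq_zero m hκ hpos z z' h]
  · have := GradedGraph.isCompletelyMetrizableSpace_harmonic hκ
    exact (GradedGraph.Multiplicity.kmsHomeomorph m hκ hpos
      hβ).isClosedEmbedding.IsCompletelyMetrizableSpace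
  · exact GradedGraph.Multiplicity.ofReal_vertexValue ω.2.1 n z
  · intro ω₁ ω₂ ω a b _ _ _ h
    funext n z
    change (ω.1 (m.ι n (m.proj z))).re =
      a * (ω₁.1 (m.ι n (m.proj z))).re + b * (ω₂.1 (m.ι n (m.proj z))).re
    rw [h]
    change (a • ω₁.1 (m.ι n (m.proj z)) + b • ω₂.1 (m.ι n (m.proj z))).re = _
    simp
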